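/- Let $F$ be a non-archimedean local field with integer ring $O_F$, maximal ideal $\mathfrak p=(\varpi)$ and residue field $O_F/\mathfrak p$ of $q$ elements and of characteristic $p\neq 2$. Let $\tau:F\to\mathbb C^\times$ be a continuous unitary additive character such that $\{x\in F\mid \tau(xO_F)=1\}=O_F$. Let $K/F$ be a field extension of degree $n$ with $p\nmid n$, let $O_K$ be its integer ring and let $f$ be the inertia degree of $K/F$. By the regular representation with respect to an $O_F$-basis of $O_K$, regard $K$ as an $F$-subalgebra of $M_n(F)$, so that $O_K\subset M_n(O_F)$. Let $\beta\in O_K$ be a generator of $O_K$ as an $O_F$-algebra with $T_{K/F}(\beta)=0$. Let $r\ge 2$ be an integer, $l'=\lfloor r/2\rfloor$ and $l=r-l'$. Let $G(\mathfrak p^l/\mathfrak p^r)$ be the kernel of the canonical homomorphism $SL_n(O_F/\mathfrak p^r)\to SL_n(O_F/\mathfrak p^l)$, and let $\psi_\beta:G(\mathfrak p^l/\mathfrak p^r)\to\mathbb C^\times$ be the character $\psi_\beta(\overline{1_n+\varpi^lX})=\tau(\varpi^{-l'}\,\mathrm{tr}(X\beta))$. Then every irreducible complex representation $\delta$ of $SL_n(O_F/\mathfrak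 p^r)$ whose restriction to $G(\mathfrak p^l/\mathfrak p^r)$ contains $\psi_\beta$ is finite-dimensional, the index $(O_F^\times:N_{K/F}(O_K^\times))$ is finite, and $$\dim\delta=\frac{q^{rn(n-1)/2}}{(O_F^\times:N_{K/F}(O_K^\times))}\cdot\frac{\prod_{k=1}^n(1-q^{-k})}{1-q^{-f}}.$$ -/

import Mathlib

open scoped ValuativeRel

namespace SLRep

section Characters

variable (F : Type*) [Field F] [ValuativeRel F] [TopologicalSpace F] [IsNonarchimedeanLocalField F]

/-- The group `SL_n(O_F / 𝔭^r)`. -/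
abbrev SLQuot (n r : ℕ) : Type _ :=
  Matrix.SpecialLinearGroup (Fin n) (𝒪[F] ⧸ 𝓂[F] ^ r)

/-- The congruence subgroup `G(𝔭^l / 𝔭^r)`: the kernel of the canonical homomorphism
`SL_n(O_F / 𝔭^r) → SL_n(O_F / 𝔭^l)`, for `l ≤ r`. -/
noncomputable def congruenceKernel (n : ℕ) {l r : ℕ} (hlr : l ≤ r) : Subgroup (SLQuot F n r) :=
  (Matrix.SpecialLinearGroup.map (n := Fin n)
    (Ideal.Quotient.factor (Ideal.pow_le_pow_right (I := 𝓂[F]) hlr))).ker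

variable {F}

/-- The condition `{x ∈ F ∣ τ(x O_F) = 1} = O_F` on an additive character `τ` of `F`. -/
def HasConductorIntegers (τ : AddChar F Circle) : Prop :=
  {x : F | ∀ y : 𝒪[F], τ (x * (y : F)) = 1} = {x : F | x ∈ 𝒪[F]}

/-- Reduction of matrices modulo `𝔭^r`. -/
noncomputable abbrev redMat (n r : ℕ) (A : Matrix (Fin n) (Fin n) 𝒪[F]) :
    Matrix (Fin n) (Fin n) (𝒪[F] ⧸ 𝓂[F] ^ r) :=
  (Ideal.Quotient.mk (𝓂[F] ^ r)).mapMatrix A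

/-- The number `τ(ϖ^{-l'} tr(X B))`. -/
noncomputable def traceChar {n : ℕ} (τ : AddChar F Circle) (ϖ : 𝒪[F]) (l' : ℕ)
    (B X : Matrix (Fin n) (Fin n) 𝒪[F]) : Circle :=
  τ (((ϖ : F) ^ l')⁻¹ * ((Matrix.trace (X * B) : 𝒪[F]) : F))

set_option linter.unusedSectionVars false in
theorem traceChar_add {n : ℕ} (τ : AddChar F Circle) (ϖ : 𝒪[F]) (l' : ℕ)
    (B X Y : Matrix (Fin n) (Fin n) 𝒪[F]) :
    traceChar τ ϖ l' B (X + Y) = traceChar τ ϖ l' B X * traceChar τ ϖ l' B Y := by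
  unfold traceChar
  rw [← AddChar.map_add_eq_mul, add_mul, Matrix.trace_add]
  congr 1
  push_cast
  ring

theorem uniformizer_ne_zero {ϖ : 𝒪[F]} (hϖ : 𝓂[F] = Ideal.span {ϖ}) : ϖ ≠ 0 := by
  rintro rfl
  refine IsDiscreteValuationRing.not_a_field 𝒪[F] ?_
  rw [hϖ]
  simp

theorem traceChar_smul {n : ℕ} {τ : AddChar F Circle} (hτ : HasConductorIntegers τ)
    {ϖ : 𝒪[F]} (hϖ : 𝓂[F] = Ideal.span {ϖ}) (l' : ℕ)
    (B Z : Matrix (Fin n) (Fin n) 𝒪[F]) :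
    traceChar τ ϖ l' B (ϖ ^ l' • Z) = 1 := by
  have h0 : (ϖ : F) ≠ 0 := fun h => uniformizer_ne_zero hϖ (Subtype.ext h)
  have h1 : ((ϖ : F) ^ l')⁻¹ * ((Matrix.trace ((ϖ ^ l' • Z) * B) : 𝒪[F]) : F)
      = ((Matrix.trace (Z * B) : 𝒪[F]) : F) := by
    rw [Matrix.smul_mul, Matrix.trace_smul, smul_eq_mul]
    push_cast
    rw [← mul_assoc, inv_mul_cancel₀ (pow_ne_zero _ h0), one_mul]
  unfold traceChar
  rw [h1]
  have h2 : ((Matrix.trace (Z * B) : 𝒪[F]) : F) ∈ {x : F | x ∈ 𝒪[F]} := Subtype.property _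
  rw [← hτ] at h2
  simpa using h2 1

theorem redMat_eq_iff {n r : ℕ} {ϖ : 𝒪[F]} (hϖ : 𝓂[F] = Ideal.span {ϖ})
    (A C : Matrix (Fin n) (Fin n) 𝒪[F]) :
    redMat n r A = redMat n r C ↔ ∃ Z : Matrix (Fin n) (Fin n) 𝒪[F], A = C + ϖ ^ r • Z := by
  constructor
  · intro h
    have key : ∀ i j, ∃ z, A i j = C i j + ϖ ^ r * z := by
      intro i j
      have hij := congrFun (congrFun h i) j
      simp only [redMat, RingHom.mapMatrix_apply, Matrix.map_apply] at hij
      rw [Ideal.Quotient.mk_eq_mk_iff_sub_mem, hϖ, Ideal.span_singleton_pow,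
        Ideal.mem_span_singleton] at hij
      obtain ⟨z, hz⟩ := hij
      exact ⟨z, by rw [← hz]; ring⟩
    choose Z hZ using key
    exact ⟨Matrix.of Z, by ext i j; simp [hZ i j]⟩
  · rintro ⟨Z, rfl⟩
    ext i j
    simp only [redMat, RingHom.mapMatrix_apply, Matrix.map_apply]
    rw [Ideal.Quotient.mk_eq_mk_iff_sub_mem, hϖ, Ideal.span_singleton_pow,
      Ideal.mem_span_singleton]
    exact ⟨Z i j, by simp⟩

/-- Every element of `G(𝔭^l / 𝔭^r)` is the class of `1 + ϖ^l X` for some matrix `X` over `O_F`. -/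
theorem exists_rep {n l r : ℕ} (hlr : l ≤ r) {ϖ : 𝒪[F]} (hϖ : 𝓂[F] = Ideal.span {ϖ})
    (h : congruenceKernel F n hlr) :
    ∃ X : Matrix (Fin n) (Fin n) 𝒪[F],
      (h : SLQuot F n r).val = redMat n r (1 + ϖ ^ l • X) := by
  have hlift : ∀ i j, ∃ a : 𝒪[F],
      Ideal.Quotient.mk (𝓂[F] ^ r) a = (h : SLQuot F n r).val i j :=
    fun i j => Ideal.Quotient.mk_surjective _
  choose A hA using hlift
  have hAh : redMat n r (Matrix.of A) = (h : SLQuot F n r).val := by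
    ext i j
    simp [redMat, hA]
  have hker : redMat n l (Matrix.of A) = redMat n l 1 := by
    have h1 := MonoidHom.mem_ker.mp h.2
    ext i j
    have h2 := congrFun (congrFun (congrArg Subtype.val h1) i) j
    simp only [Matrix.SpecialLinearGroup.map_apply_coe, RingHom.mapMatrix_apply,
      Matrix.map_apply, Matrix.SpecialLinearGroup.coe_one] at h2
    rw [← hA i j, Ideal.Quotient.factor_mk] at h2
    simp only [redMat, map_one]
    simpa using h2
  obtain ⟨X, hX⟩ := (redMat_eq_iff hϖ _ _).mp hker
  exact ⟨X, by rw [← hAh, hX]⟩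

theorem traceChar_eq {n l l' r : ℕ} (hr : r = l + l')
    {τ : AddChar F Circle} (hτ : HasConductorIntegers τ)
    {ϖ : 𝒪[F]} (hϖ : 𝓂[F] = Ideal.span {ϖ}) (B X Y : Matrix (Fin n) (Fin n) 𝒪[F])
    (h : redMat n r (1 + ϖ ^ l • X) = redMat n r (1 + ϖ ^ l • Y)) :
    traceChar τ ϖ l' B X = traceChar τ ϖ l' B Y := by
  obtain ⟨Z, hZ⟩ := (redMat_eq_iff hϖ _ _).mp h
  have hXY : X = Y + ϖ ^ l' • Z := by
    refine Matrix.ext fun i j => ?_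
    have hij := congrFun (congrFun hZ i) j
    simp only [Matrix.add_apply, Matrix.smul_apply, smul_eq_mul] at hij ⊢
    apply mul_left_cancel₀ (pow_ne_zero l (uniformizer_ne_zero hϖ))
    rw [hr, pow_add] at hij
    linear_combination hij
  rw [hXY, traceChar_add, traceChar_smul hτ hϖ, mul_one]

/-- For `r = l + l'` with `l' ≤ l` and a matrix `B` over `O_F`, the character
`ψ_B : G(𝔭^l / 𝔭^r) → ℂ^×` (with values in the unit circle) whose value at the class of
`1 + ϖ^l X` is `τ(ϖ^{-l'} tr(X B))`; see `psi_apply`. -/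
noncomputable def psi {n l l' r : ℕ} (hl : l' ≤ l) (hr : r = l + l')
    {τ : AddChar F Circle} (hτ : HasConductorIntegers τ)
    {ϖ : 𝒪[F]} (hϖ : 𝓂[F] = Ideal.span {ϖ}) (B : Matrix (Fin n) (Fin n) 𝒪[F]) :
    congruenceKernel F n (show l ≤ r by omega) →* Circle :=
  MonoidHom.mk' (fun h => traceChar τ ϖ l' B (exists_rep (by omega) hϖ h).choose) (by
    intro g h
    have hg' := (exists_rep (by omega) hϖ g).choose_spec
    have hh' := (exists_rep (by omega) hϖ h).choose_spec
    have hgh' := (exists_rep (by omega) hϖ (g * h)).choose_spec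
    set X := (exists_rep (by omega) hϖ g).choose
    set Y := (exists_rep (by omega) hϖ h).choose
    set W := (exists_rep (by omega) hϖ (g * h)).choose
    have hW : redMat n r (1 + ϖ ^ l • W)
        = redMat n r (1 + ϖ ^ l • (X + Y + ϖ ^ l' • (ϖ ^ (l - l') • (X * Y)))) := by
      rw [← hgh', Subgroup.coe_mul, Matrix.SpecialLinearGroup.coe_mul, hg', hh', ← map_mul]
      congr 1
      rw [smul_smul (ϖ ^ l'), ← pow_add, Nat.add_sub_cancel' hl]
      simp only [add_mul, mul_add, one_mul, mul_one, smul_add, Matrix.smul_mul, Matrix.mul_smul]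
      abel
    rw [traceChar_eq hr hτ hϖ B _ _ hW, traceChar_add, traceChar_add, traceChar_smul hτ hϖ,
      mul_one])

theorem psi_apply {n l l' r : ℕ} (hl : l' ≤ l) (hr : r = l + l')
    {τ : AddChar F Circle} (hτ : HasConductorIntegers τ)
    {ϖ : 𝒪[F]} (hϖ : 𝓂[F] = Ideal.span {ϖ}) (B : Matrix (Fin n) (Fin n) 𝒪[F])
    (h : congruenceKernel F n (show l ≤ r by omega)) (X : Matrix (Fin n) (Fin n) 𝒪[F])
    (hX : (h : SLQuot F n r).val = redMat n r (1 + ϖ ^ l • X)) :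
    psi hl hr hτ hϖ B h = τ (((ϖ : F) ^ l')⁻¹ * ((Matrix.trace (X * B) : 𝒪[F]) : F)) :=
  traceChar_eq hr hτ hϖ B _ X (by
    rw [← hX]
    exact (exists_rep (by omega) hϖ h).choose_spec.symm)

end Characters

/-- The restriction to the subgroup `H` of the representation `δ` contains the character `χ`. -/
def ContainsCharacter {G V : Type*} [Group G] [AddCommGroup V] [Module ℂ V]
    (δ : Representation ℂ G V) {H : Subgroup G} (χ : H →* Circle) : Prop :=
  ∃ v : V, v ≠ 0 ∧ ∀ h : H, δ (h : G) v = (χ h : ℂ) • v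

section Extensions

variable (F K : Type*) [Field F] [ValuativeRel F] [Field K] [Algebra F K]

/-- The ring of integers `O_K` of an extension `K / F`: the integral closure of `O_F` in `K`. -/
noncomputable abbrev ringOfIntegers : Subalgebra 𝒪[F] K := integralClosure 𝒪[F] K

/-- The subgroup `N_{K/F}(O_K^×)` of `O_F^×`. -/
noncomputable def normUnits : Subgroup 𝒪[F]ˣ :=
  (((Units.map (algebraMap (ringOfIntegers F K) K : ringOfIntegers F K →* K)).range).map
    (Units.map (Algebra.norm F : K →* F))).comap
      (Units.map (algebraMap 𝒪[F] F : 𝒪[F] →* F))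

end Extensions

end SLRep

namespace SLRep

/-! ### Irreducible representations of finite groups, Schur's lemma and Clifford theory. -/

section Representations

variable {G : Type*} [Group G] {V : Type*} [AddCommGroup V] [Module ℂ V]

/-! Put `R = O_F / 𝔭^r`, with `π` the class of `ϖ`, and let `B` be the matrix of multiplication by
`β`. Four subgroups of `SL_n(R)` matter: `N` (congruent to 1 mod `π^l`), `H` (congruent to 1 mod
`π^l'`), `J` (elements of `H` commuting with `B` mod `π^l`) and `Γ` (elements commuting with `B` mod
`π^l'`), with `N ≤ J ≤ H ≤ Γ`. Congruences are encoded by annihilators: being killed by `π^j` means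
being divisible by `π^(r-j)`. Hence `N` is `congSubgroup n (π ^ l')` and `H` is `congSubgroup n (π ^
l)`.

The group `Γ` is the stabilizer of `ψ_β`, so Clifford theory (`clifford`) gives `dim δ = (SL_n(R) :
Γ) d`, where `d` is the dimension of the `ψ_β`-eigenspace of `N`, an irreducible representation of
`Γ`. Commutators in `H` lie in `N`, and through `ψ_β` they define a pairing on `H` with radical `J`.
As for a Heisenberg group, one expects `d² = (H : J)`. What has to be shown is that `J` acts by a
character `χ` and that `H` already acts irreducibly. Every extension of `ψ_β` to `J` is `j ↦
θ(tr(log(j) B'))` with `B' = B + π^l' C`. The exact centralizer `T` of `B'` is commutative, fixes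
`χ`, satisfies `Γ = T H`, and `χ` is trivial on the commutators of `H` with `T` that lie in `J`
(`exists_stabilizing_centralizer`). This forces the operators of `T` into the span of those of `H`
(`card_mul_finrank_sq`). Since `3 l' ≥ r` and `p ≠ 2`, logarithm and exponential truncated at order
two suffice.

The orders are computed from the fact that `β` generates `O_K`: the coordinate vector of `1` is
cyclic for `B`, so matrices commuting with `B` modulo a power of `π` are polynomials in `B` modulo
that power. A polynomial in `B` is invertible exactly when the element of `O_K` it comes from is a
unit, whence the factor `1 - q^(-f)`. The determinant on the units commuting with `B` mod `π^l'` has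
kernel `Γ`, and its image is the reduction of `N(O_K^×)`, because `p ∤ n` makes elements congruent
to 1 into `n`-th powers (`comap_range_detUnits`). -/

theorem isIrreducible_iff (ρ : Representation ℂ G V) :
    ρ.IsIrreducible ↔ Nontrivial V ∧
      ∀ W : Submodule ℂ V, (∀ g, ∀ w ∈ W, ρ g w ∈ W) → W = ⊥ ∨ W = ⊤ := by
  constructor
  · intro h
    refine ⟨?_, fun W hW => ?_⟩
    · by_contra hV
      rw [not_nontrivial_iff_subsingleton] at hV
      obtain ⟨a, b, hab⟩ := h.toNontrivial
      exact hab (Subrepresentation.toSubmodule_injective (Subsingleton.elim _ _))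
    · rcases h.eq_bot_or_eq_top ⟨W, fun g v hv => hW g v hv⟩ with h' | h'
      · exact Or.inl (congrArg Subrepresentation.toSubmodule h')
      · exact Or.inr (congrArg Subrepresentation.toSubmodule h')
  · rintro ⟨hV, h⟩
    refine { exists_pair_ne := ⟨⊥, ⊤, fun hbt => ?_⟩, eq_bot_or_eq_top := fun W => ?_ }
    · have : (⊥ : Submodule ℂ V) = ⊤ := congrArg Subrepresentation.toSubmodule hbt
      exact bot_ne_top this
    · rcases h W.toSubmodule (fun g v hv => W.apply_mem_toSubmodule g hv) with h' | h'
      · exact Or.inl (Subrepresentation.toSubmodule_injective h')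
      · exact Or.inr (Subrepresentation.toSubmodule_injective h')

/-- The orbit of a nonzero vector is finite, and its span is stable, hence everything. -/
theorem finiteDimensional_of_isIrreducible [Finite G] {ρ : Representation ℂ G V}
    (hρ : ρ.IsIrreducible) : FiniteDimensional ℂ V := by
  obtain ⟨hV, h⟩ := (isIrreducible_iff ρ).1 hρ
  obtain ⟨v, hv⟩ := exists_ne (0 : V)
  have hfin : (Set.range fun g => ρ g v).Finite := Set.finite_range _
  rcases h (Submodule.span ℂ (Set.range fun g => ρ g v)) (by
    intro g w hw
    have := Submodule.mem_map_of_mem (f := ρ g) hw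
    rw [Submodule.map_span] at this
    refine Submodule.span_mono ?_ this
    rintro _ ⟨_, ⟨g', rfl⟩, rfl⟩
    exact ⟨g * g', by simp⟩) with h' | h'
  · refine absurd ?_ hv
    rw [← Submodule.mem_bot ℂ, ← h']
    exact Submodule.subset_span ⟨1, by simp⟩
  · exact Module.finite_def.2 (h' ▸ Submodule.fg_span hfin)

theorem exists_eq_smul_one_of_commute [FiniteDimensional ℂ V] {ρ : Representation ℂ G V}
    (hρ : ρ.IsIrreducible) (A : V →ₗ[ℂ] V) (hA : ∀ g, A * ρ g = ρ g * A) :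
    ∃ c : ℂ, A = c • 1 := by
  obtain ⟨hV, h⟩ := (isIrreducible_iff ρ).1 hρ
  obtain ⟨c, hc⟩ := Module.End.exists_eigenvalue A
  refine ⟨c, ?_⟩
  rcases h (Module.End.eigenspace A c) (by
    intro g w hw
    rw [Module.End.mem_eigenspace_iff] at hw ⊢
    have := LinearMap.congr_fun (hA g) w
    simp only [Module.End.mul_apply] at this
    rw [this, hw, map_smul]) with h' | h'
  · exact absurd h' hc
  · ext v
    have : v ∈ Module.End.eigenspace A c := h' ▸ Submodule.mem_top
    simpa [Module.End.mem_eigenspace_iff] using this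

/-- The restriction of a representation to a subgroup, acting on a stable subspace. -/
def restrictRep (ρ : Representation ℂ G V) (Γ : Subgroup G) (U : Submodule ℂ V)
    (hU : ∀ g ∈ Γ, ∀ u ∈ U, ρ g u ∈ U) : Representation ℂ Γ U where
  toFun g := (ρ g).restrict (hU g g.2)
  map_one' := by ext; simp
  map_mul' x y := by ext; simp

/-- The vectors on which a subgroup `N` acts by the scalars `f`. -/
def eigenspaceOf (ρ : Representation ℂ G V) (N : Subgroup G) (f : G → ℂ) : Submodule ℂ V where
  carrier := {v | ∀ x ∈ N, ρ x v = f x • v}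
  add_mem' := by
    intro a b ha hb x hx
    rw [map_add, ha x hx, hb x hx, smul_add]
  zero_mem' := by intro x _; simp
  smul_mem' := by
    intro c v hv x hx
    rw [map_smul, hv x hx, smul_comm]

theorem apply_mem_eigenspaceOf {ρ : Representation ℂ G V} {N : Subgroup G} {f : G → ℂ} {g : G}
    (hN : ∀ x ∈ N, g⁻¹ * x * g ∈ N) (hf : ∀ x ∈ N, f (g⁻¹ * x * g) = f x)
    {v : V} (hv : v ∈ eigenspaceOf ρ N f) : ρ g v ∈ eigenspaceOf ρ N f := by
  intro x hx
  have h1 : ρ x (ρ g v) = ρ g (ρ (g⁻¹ * x * g) v) := by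
    rw [← Module.End.mul_apply, ← Module.End.mul_apply, ← map_mul, ← map_mul]
    congr 2
    group
  rw [h1, hv _ (hN x hx), hf x hx, map_smul]

/-- Clifford theory for a one-dimensional character of a normal subgroup. -/
theorem clifford [Finite G] {ρ : Representation ℂ G V} (hρ : ρ.IsIrreducible)
    (N : Subgroup G) (hN : N.Normal) (f : G → ℂ) (Γ : Subgroup G)
    (hf0 : ∀ x ∈ N, f x ≠ 0) (hf : ∀ x ∈ N, ∀ y ∈ N, f (x * y) = f x * f y)
    (hΓ : ∀ g, g ∈ Γ ↔ ∀ x ∈ N, f (g⁻¹ * x * g) = f x)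
    (hne : eigenspaceOf ρ N f ≠ ⊥)
    (hU : ∀ g ∈ Γ, ∀ u ∈ eigenspaceOf ρ N f, ρ g u ∈ eigenspaceOf ρ N f) :
    (restrictRep ρ Γ _ hU).IsIrreducible ∧
      Nat.card Γ * Module.finrank ℂ V = Nat.card G * Module.finrank ℂ (eigenspaceOf ρ N f) := by
  classical
  have := Fintype.ofFinite G
  have := Fintype.ofFinite N
  have hfd := finiteDimensional_of_isIrreducible hρ
  obtain ⟨hV, hirr⟩ := (isIrreducible_iff ρ).1 hρ
  set U := eigenspaceOf ρ N f with hUdef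
  have hNc : (Fintype.card N : ℂ) ≠ 0 := by exact_mod_cast Fintype.card_ne_zero
  -- the projection onto `U`
  let P : V →ₗ[ℂ] V := (Fintype.card N : ℂ)⁻¹ • ∑ x : N, (f x)⁻¹ • ρ x
  have hPU : ∀ u ∈ U, P u = u := by
    intro u hu
    have : ∀ x : N, (f x)⁻¹ • ρ x u = u := by
      intro x
      rw [hu x x.2, smul_smul, inv_mul_cancel₀ (hf0 x x.2), one_smul]
    simp only [P, LinearMap.smul_apply, LinearMap.sum_apply, this]
    rw [Finset.sum_const, Finset.card_univ, ← Nat.cast_smul_eq_nsmul ℂ, smul_smul,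
      inv_mul_cancel₀ hNc, one_smul]
  have hPmem : ∀ v, P v ∈ U := by
    intro v x hx
    simp only [P, LinearMap.smul_apply, LinearMap.sum_apply, map_smul, map_sum]
    rw [smul_comm (f x)]
    congr 1
    rw [Finset.smul_sum]
    refine Fintype.sum_equiv (Equiv.mulLeft (⟨x, hx⟩ : N)) _ _ fun y => ?_
    simp only [Equiv.coe_mulLeft, Subgroup.coe_mul]
    rw [hf x hx y y.2, map_mul, Module.End.mul_apply, smul_smul]
    congr 1
    field_simp [hf0 x hx]
  -- For `g` outside `Γ`, `N` acts on `ρ g u` by a character different from `f`, so projecting to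
  -- the `f`-part gives zero. This is seen by evaluating `P (ρ x (ρ g u))` in two ways.
  have hP0 : ∀ g, g ∉ Γ → ∀ u ∈ U, P (ρ g u) = 0 := by
    intro g hg u hu
    rw [hΓ] at hg
    push Not at hg
    obtain ⟨x, hx, hne⟩ := hg
    have h1 := hPmem (ρ g u) x hx
    have hxg : g⁻¹ * x * g ∈ N := by simpa using hN.conj_mem x hx g⁻¹
    have h2 : P (ρ x (ρ g u)) = f (g⁻¹ * x * g) • P (ρ g u) := by
      have h1 : ρ x (ρ g u) = ρ g (ρ (g⁻¹ * x * g) u) := by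
        rw [← Module.End.mul_apply, ← Module.End.mul_apply, ← map_mul, ← map_mul]
        congr 2
        group
      rw [h1, hu _ hxg, map_smul, map_smul]
    have h3 : P (ρ x (ρ g u)) = f x • P (ρ g u) := by
      simp only [P, LinearMap.smul_apply, LinearMap.sum_apply]
      rw [smul_comm (f x)]
      congr 1
      rw [Finset.smul_sum]
      refine Fintype.sum_equiv (Equiv.mulRight (⟨x, hx⟩ : N)) _ _ fun y => ?_
      simp only [Equiv.coe_mulRight, Subgroup.coe_mul]
      rw [hf y y.2 x hx, map_mul, Module.End.mul_apply, smul_smul]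
      congr 1
      field_simp [hf0 x hx]
    rw [h2] at h3
    have h4 : (f (g⁻¹ * x * g) - f x) • P (ρ g u) = 0 := by rw [sub_smul, h3, sub_self]
    rcases smul_eq_zero.1 h4 with h5 | h5
    · exact absurd (sub_eq_zero.1 h5) hne
    · exact h5
  refine ⟨?_, ?_⟩
  · rw [isIrreducible_iff]
    refine ⟨Submodule.nontrivial_iff_ne_bot.2 hne, fun W hW => ?_⟩
    by_cases hW0 : W = ⊥
    · exact Or.inl hW0
    right
    -- The translates of `W` span `V`. Applying `P` kills the translates by elements outside `Γ` and
    -- keeps the others in `W`, so `U = P V` is contained in `W`.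
    let S : Submodule ℂ V := Submodule.span ℂ {v | ∃ g, ∃ w ∈ W, v = ρ g (w : V)}
    have hS : S = ⊤ := by
      refine (hirr S ?_).resolve_left ?_
      · intro g w hw
        have := Submodule.mem_map_of_mem (f := ρ g) hw
        rw [Submodule.map_span] at this
        refine Submodule.span_mono ?_ this
        rintro _ ⟨_, ⟨g', w', hw', rfl⟩, rfl⟩
        exact ⟨g * g', w', hw', by simp⟩
      · intro hS
        apply hW0
        rw [Submodule.eq_bot_iff]
        intro w hw
        have : (w : V) ∈ S := Submodule.subset_span ⟨1, w, hw, by simp⟩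
        rw [hS, Submodule.mem_bot] at this
        exact Subtype.ext this
    have hPS : ∀ v ∈ S, P v ∈ W.map U.subtype := by
      intro v hv
      induction hv using Submodule.span_induction with
      | mem v hv =>
        obtain ⟨g, w, hw, rfl⟩ := hv
        by_cases hg : g ∈ Γ
        · rw [hPU _ (hU g hg w w.2)]
          exact ⟨_, hW ⟨g, hg⟩ w hw, rfl⟩
        · rw [hP0 g hg w w.2]
          exact Submodule.zero_mem _
      | zero => simp
      | add x y _ _ hx hy => rw [map_add]; exact Submodule.add_mem _ hx hy
      | smul a x _ hx => rw [map_smul]; exact Submodule.smul_mem _ _ hx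
    rw [Submodule.eq_top_iff']
    intro u
    have h1 := hPS u (hS ▸ Submodule.mem_top)
    rw [hPU u u.2] at h1
    obtain ⟨w, hw, hwu⟩ := h1
    have : w = u := Subtype.ext hwu
    exact this ▸ hw
  -- The dimension formula is a trace computation: `Q` is a scalar by Schur, the scalar is `|Γ|` as
  -- read off on a vector of `U`, and its trace is `|G| dim U`.
  · let Q : V →ₗ[ℂ] V := ∑ g : G, ρ g * P * ρ g⁻¹
    have hQ : ∀ g, Q * ρ g = ρ g * Q := by
      intro g
      simp only [Q, Finset.sum_mul, Finset.mul_sum]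
      refine Fintype.sum_equiv (Equiv.mulLeft g⁻¹) _ _ fun y => ?_
      simp only [Equiv.coe_mulLeft, mul_inv_rev, inv_inv, map_mul]
      simp only [mul_assoc]
      rw [← mul_assoc (ρ g) (ρ g⁻¹), ← map_mul ρ g g⁻¹, mul_inv_cancel, map_one, one_mul]
    obtain ⟨c, hc⟩ := exists_eq_smul_one_of_commute hρ Q hQ
    obtain ⟨u, hu, hu0⟩ := Submodule.exists_mem_ne_zero_of_ne_bot hne
    have hcard : ∑ g : G, (if g ∈ Γ then (1 : ℂ) else 0) = Nat.card Γ := by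
      rw [Finset.sum_boole, Nat.card_eq_fintype_card, Fintype.card_subtype]
    have hQu : Q u = (Nat.card Γ : ℂ) • u := by
      rw [← hcard, Finset.sum_smul]
      simp only [Q, LinearMap.sum_apply]
      refine Finset.sum_congr rfl fun g _ => ?_
      by_cases hg : g ∈ Γ
      · simp only [hg, if_true, one_smul, Module.End.mul_apply]
        rw [hPU _ (hU _ (Γ.inv_mem hg) u hu), ← Module.End.mul_apply, ← map_mul]
        simp
      · simp only [hg, if_false, zero_smul, Module.End.mul_apply]
        rw [hP0 _ (fun h => hg (by simpa using Γ.inv_mem h)) u hu, map_zero]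
    have hcΓ : c = Nat.card Γ := by
      rw [hc] at hQu
      simp only [LinearMap.smul_apply, Module.End.one_apply] at hQu
      exact smul_left_injective ℂ hu0 hQu
    have htrP : LinearMap.trace ℂ V P = Module.finrank ℂ U :=
      LinearMap.IsProj.trace ⟨hPmem, hPU⟩
    have htrQ : LinearMap.trace ℂ V Q = Nat.card G * Module.finrank ℂ U := by
      simp only [Q, map_sum]
      have : ∀ g, LinearMap.trace ℂ V (ρ g * P * ρ g⁻¹) = Module.finrank ℂ U := by
        intro g
        rw [LinearMap.trace_mul_comm, ← mul_assoc, ← map_mul, inv_mul_cancel, map_one, one_mul,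
          htrP]
      simp [this]
    rw [hc, hcΓ, map_smul, LinearMap.trace_one, smul_eq_mul] at htrQ
    exact_mod_cast htrQ

end Representations

/-! ### Heisenberg-type groups: dimension from a nondegenerate commutator pairing. -/

section Heisenberg

variable {G : Type*} [Group G] {V : Type*} [AddCommGroup V] [Module ℂ V]

/-- Schur orthogonality without unitarity. The average of the conjugates of a matrix unit is a
scalar fixed by its trace, and its `(i, j)` entry is a sum of products of diagonal entries of `ρ g`
and `ρ g⁻¹`. -/
theorem sum_trace_mul_trace_inv [Fintype G] [FiniteDimensional ℂ V] {ρ : Representation ℂ G V}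
    (hρ : ρ.IsIrreducible) :
    ∑ g : G, LinearMap.trace ℂ V (ρ g) * LinearMap.trace ℂ V (ρ g⁻¹) = Fintype.card G := by
  classical
  obtain ⟨hV, hirr⟩ := (isIrreducible_iff ρ).1 hρ
  let b := Module.finBasis ℂ V
  let M : G → Matrix (Fin (Module.finrank ℂ V)) (Fin (Module.finrank ℂ V)) ℂ := fun g => LinearMap.toMatrix b b (ρ g)
  have hd : (Module.finrank ℂ V : ℂ) ≠ 0 := by exact_mod_cast Module.finrank_pos.ne'
  have key : ∀ i j, ∑ g : G, M g i i * M g⁻¹ j j =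
      if i = j then (Fintype.card G : ℂ) / Module.finrank ℂ V else 0 := by
    intro i j
    let A : V →ₗ[ℂ] V := Matrix.toLin b b (Matrix.single i j 1)
    let Q : V →ₗ[ℂ] V := ∑ g : G, ρ g * A * ρ g⁻¹
    have hQ : ∀ g, Q * ρ g = ρ g * Q := by
      intro g
      simp only [Q, Finset.sum_mul, Finset.mul_sum]
      refine Fintype.sum_equiv (Equiv.mulLeft g⁻¹) _ _ fun y => ?_
      simp only [Equiv.coe_mulLeft, mul_inv_rev, inv_inv, map_mul]
      simp only [mul_assoc]
      rw [← mul_assoc (ρ g) (ρ g⁻¹), ← map_mul ρ g g⁻¹, mul_inv_cancel, map_one, one_mul]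
    obtain ⟨c, hc⟩ := exists_eq_smul_one_of_commute hρ Q hQ
    have hM : ∑ g : G, M g * Matrix.single i j 1 * M g⁻¹ = c • 1 := by
      have h1 := congrArg (LinearMap.toMatrix b b) hc
      simp only [Q, map_sum, LinearMap.toMatrix_mul, map_smul, LinearMap.toMatrix_one, A,
        LinearMap.toMatrix_toLin] at h1
      exact h1
    have htr := congrArg Matrix.trace hM
    rw [Matrix.trace_sum, Matrix.trace_smul, Matrix.trace_one, Fintype.card_fin] at htr
    have h2 : ∀ g, Matrix.trace (M g * Matrix.single i j (1 : ℂ) * M g⁻¹) =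
        if i = j then 1 else 0 := by
      intro g
      rw [Matrix.trace_mul_comm, ← mul_assoc]
      have : M g⁻¹ * M g = 1 := by
        simp only [M]
        rw [← LinearMap.toMatrix_mul, ← map_mul, inv_mul_cancel, map_one, LinearMap.toMatrix_one]
      rw [this, one_mul]
      split_ifs with h
      · subst h; simp
      · exact Matrix.trace_single_eq_of_ne _ _ _ h
    simp only [h2, Finset.sum_const, Finset.card_univ, smul_eq_mul, nsmul_eq_mul] at htr
    have hij := congrFun (congrFun hM i) j
    rw [Matrix.sum_apply] at hij
    have h3 : ∀ g, (M g * Matrix.single i j (1 : ℂ) * M g⁻¹ : Matrix _ _ ℂ) i j = M g i i * M g⁻¹ j j := by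
      intro g
      rw [Matrix.mul_apply, Finset.sum_eq_single j]
      · simp
      · intro k _ hk
        rw [Matrix.mul_single_apply_of_ne _ _ _ _ _ hk, zero_mul]
      · simp
    simp only [h3] at hij
    rw [hij, Matrix.smul_apply, Matrix.one_apply, smul_eq_mul]
    split_ifs with h
    · rw [if_pos h, mul_one] at htr
      rw [mul_one, htr, mul_div_cancel_right₀ _ hd]
    · rw [mul_zero]
  have htr : ∀ g, LinearMap.trace ℂ V (ρ g) = ∑ i, M g i i := by
    intro g
    rw [LinearMap.trace_eq_matrix_trace ℂ b]
    rfl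
  simp only [htr, Finset.sum_mul_sum]
  rw [Finset.sum_comm]
  have : ∀ i, ∑ g : G, ∑ j, M g i i * M g⁻¹ j j = (Fintype.card G : ℂ) / Module.finrank ℂ V := by
    intro i
    rw [Finset.sum_comm]
    simp [key]
  simp only [this, Finset.sum_const, Finset.card_univ, Fintype.card_fin, nsmul_eq_mul]
  field_simp

/-- Irreducible representations of a group `T H` on which the subgroup `J` of `H` acts by a
character `χ` that is nondegenerate on `H / J`, where `T` is commutative and `χ` vanishes on the
commutators `[h, t]` contained in `J`: the dimension is the square root of `(H : J)`. -/
theorem card_mul_finrank_sq [Finite G] {ρ : Representation ℂ G V} (hρ : ρ.IsIrreducible)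
    (H J T : Subgroup G) (hJH : J ≤ H) (hHn : H.Normal) (χ : G → ℂ)
    (hχ : ∀ j ∈ J, ρ j = χ j • 1)
    (hnd : ∀ h ∈ H, h ∉ J → ∃ h' ∈ H, h' * h * h'⁻¹ * h⁻¹ ∈ J ∧ χ (h' * h * h'⁻¹ * h⁻¹) ≠ 1)
    (hTc : ∀ s ∈ T, ∀ t ∈ T, s * t = t * s)
    (hTH : ∀ g, ∃ t ∈ T, ∃ h ∈ H, g = t * h)
    (htriv : ∀ t ∈ T, ∀ h ∈ H, h * t * h⁻¹ * t⁻¹ ∈ J → χ (h * t * h⁻¹ * t⁻¹) = 1) :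
    Nat.card J * Module.finrank ℂ V ^ 2 = Nat.card H := by
  classical
  have := Fintype.ofFinite H
  have hfd := finiteDimensional_of_isIrreducible hρ
  obtain ⟨hV, hirr⟩ := (isIrreducible_iff ρ).1 hρ
  have inv_mul : ∀ g, ρ g⁻¹ * ρ g = 1 := fun g => by
    rw [← map_mul, inv_mul_cancel, map_one]
  have mul_inv : ∀ g, ρ g * ρ g⁻¹ = 1 := fun g => by
    rw [← map_mul, mul_inv_cancel, map_one]
  have hconj : ∀ h h', ρ h' * ρ h * ρ h'⁻¹ = ρ (h' * h * h'⁻¹ * h⁻¹) * ρ h := fun h h' => by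
    simp only [← map_mul]
    congr 1
    group
  -- averaging over `H`
  have hav : ∀ h ∈ H, ∑ x : H, ρ x * ρ h * ρ (x : G)⁻¹ =
      if h ∈ J then (Fintype.card H : ℂ) • ρ h else 0 := by
    intro h hh
    split_ifs with hhJ
    · have : ∀ x : H, ρ x * ρ h * ρ (x : G)⁻¹ = ρ h := by
        intro x
        rw [hχ h hhJ, mul_smul_comm, mul_one, smul_mul_assoc, mul_inv]
      simp only [this, Finset.sum_const, Finset.card_univ]
      rw [Nat.cast_smul_eq_nsmul]
    · obtain ⟨h', hh', hcJ, hc⟩ := hnd h hh hhJ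
      set S := ∑ x : H, ρ x * ρ h * ρ (x : G)⁻¹
      -- Conjugation by `h'` multiplies `ρ h` by a scalar other than 1, but does not change an
      -- average over `H`.
      have hS : S = χ (h' * h * h'⁻¹ * h⁻¹) • S := by
        simp only [S, Finset.smul_sum]
        refine Fintype.sum_equiv (Equiv.mulRight (⟨h', hh'⟩ : H)⁻¹) _ _ fun x => ?_
        simp only [Equiv.coe_mulRight, Subgroup.coe_mul, InvMemClass.coe_inv]
        have e1 : ρ x * ρ h * ρ (x : G)⁻¹ =
            ρ (x * h'⁻¹) * (ρ h' * ρ h * ρ h'⁻¹) * ρ (x * h'⁻¹)⁻¹ := by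
          simp only [← map_mul]
          congr 1
          group
        rw [e1, hconj, hχ _ hcJ, smul_one_mul, mul_smul_comm, smul_mul_assoc]
      have h0 : (1 - χ (h' * h * h'⁻¹ * h⁻¹)) • S = 0 := by
        rw [sub_smul, one_smul, ← hS, sub_self]
      exact (smul_eq_zero.1 h0).resolve_left (sub_ne_zero.2 (Ne.symm hc))
  -- The average `Φ` of `ρ t` over `H` commutes with `H` by construction and with `T` because `T` is
  -- commutative and normalizes `H`; so it is a scalar. But `Φ ρ(t⁻¹)` is a sum of operators of
  -- commutators lying in `H`. It only remains to see that the scalar is nonzero.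
  have hspan : ∀ t ∈ T, ρ t⁻¹ ∈ Submodule.span ℂ (Set.range fun h : H => ρ h) := by
    intro t ht
    let Φ : V →ₗ[ℂ] V := ∑ x : H, ρ x * ρ t * ρ (x : G)⁻¹
    have hΦH : ∀ h ∈ H, Φ * ρ h = ρ h * Φ := by
      intro h hh
      simp only [Φ, Finset.sum_mul, Finset.mul_sum]
      refine Fintype.sum_equiv (Equiv.mulLeft (⟨h, hh⟩ : H)⁻¹) _ _ fun y => ?_
      simp only [Equiv.coe_mulLeft, Subgroup.coe_mul, InvMemClass.coe_inv, ← map_mul]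
      congr 1
      group
    have hΦT : ∀ s ∈ T, Φ * ρ s = ρ s * Φ := by
      intro s hs
      simp only [Φ, Finset.sum_mul, Finset.mul_sum]
      refine Fintype.sum_equiv (MulAut.conjNormal s⁻¹ : MulAut H).toEquiv _ _ fun y => ?_
      simp only [MulEquiv.toEquiv_eq_coe, EquivLike.coe_coe,
        MulAut.conjNormal_apply, inv_inv, ← map_mul]
      congr 1
      have e : t = s * t * s⁻¹ := by rw [← hTc t ht s hs, mul_inv_cancel_right]
      calc (y : G) * t * (y : G)⁻¹ * s = y * (s * t * s⁻¹) * (y : G)⁻¹ * s := by rw [← e]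
        _ = _ := by group
    obtain ⟨c, hc⟩ := exists_eq_smul_one_of_commute hρ Φ (by
      intro g
      obtain ⟨s, hs, h, hh, rfl⟩ := hTH g
      rw [map_mul, ← mul_assoc, hΦT s hs, mul_assoc, hΦH h hh, mul_assoc])
    have hΦt : Φ * ρ t⁻¹ = ∑ x : H, ρ ((x : G) * t * (x : G)⁻¹ * t⁻¹) := by
      simp only [Φ, Finset.sum_mul, ← map_mul]
    have hmem : ∀ x : H, (x : G) * t * (x : G)⁻¹ * t⁻¹ ∈ H := by
      intro x
      have := hHn.conj_mem _ (H.inv_mem x.2) t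
      have e : (x : G) * t * (x : G)⁻¹ * t⁻¹ = x * (t * (x : G)⁻¹ * t⁻¹) := by group
      rw [e]
      exact H.mul_mem x.2 this
    -- Average once more over `H`. Commutators outside `J` disappear, while each one in `J`
    -- contributes `|H|` because `χ` is 1 there. The element `x = 1` is of the second kind, so the
    -- total is a nonzero scalar.
    have hc0 : c ≠ 0 := by
      intro hc0
      rw [hc0, zero_smul] at hc
      rw [hc, zero_mul] at hΦt
      have h1 : ∑ y : H, ρ y * (∑ x : H, ρ ((x : G) * t * (x : G)⁻¹ * t⁻¹)) * ρ (y : G)⁻¹ = 0 := by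
        rw [← hΦt]; simp
      simp only [Finset.mul_sum, Finset.sum_mul] at h1
      rw [Finset.sum_comm] at h1
      have h2 : ∀ x : H, ∑ y : H, ρ y * ρ ((x : G) * t * (x : G)⁻¹ * t⁻¹) * ρ (y : G)⁻¹ =
          (if (x : G) * t * (x : G)⁻¹ * t⁻¹ ∈ J then (Fintype.card H : ℂ) else 0) • 1 := by
        intro x
        rw [hav _ (hmem x)]
        split_ifs with hx
        · rw [hχ _ hx, htriv t ht x x.2 hx, one_smul]
        · rw [zero_smul]
      simp only [h2] at h1
      rw [← Finset.sum_smul, ← Finset.sum_filter, Finset.sum_const, smul_eq_zero] at h1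
      rcases h1 with h1 | h1
      · rw [nsmul_eq_mul, mul_eq_zero] at h1
        rcases h1 with h1 | h1
        · have h3 : (Finset.univ.filter
              fun x : H => (x : G) * t * (x : G)⁻¹ * t⁻¹ ∈ J).card = 0 := by
            exact_mod_cast h1
          rw [Finset.card_eq_zero] at h3
          have : (1 : H) ∈ Finset.univ.filter
              fun x : H => (x : G) * t * (x : G)⁻¹ * t⁻¹ ∈ J := by
            simp [J.one_mem]
          rw [h3] at this
          simp at this
        · exact Fintype.card_ne_zero (by exact_mod_cast h1)
      · exact one_ne_zero h1
    have h4 : ρ t⁻¹ = c⁻¹ • ∑ x : H, ρ ((x : G) * t * (x : G)⁻¹ * t⁻¹) := by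
      rw [← hΦt, hc, smul_one_mul, smul_smul, inv_mul_cancel₀ hc0, one_smul]
    rw [h4]
    exact Submodule.smul_mem _ _ (Submodule.sum_mem _ fun x _ =>
      Submodule.subset_span ⟨⟨_, hmem x⟩, rfl⟩)
  have hirrH : Representation.IsIrreducible (k := ℂ) (G := H) (V := V) (ρ.comp H.subtype) := by
    rw [isIrreducible_iff]
    refine ⟨hV, fun W hW => hirr W fun g w hw => ?_⟩
    have hA : ∀ A ∈ Submodule.span ℂ (Set.range fun h : H => ρ h), ∀ w ∈ W, A w ∈ W := by
      intro A hA
      induction hA using Submodule.span_induction with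
      | mem A hA =>
        obtain ⟨h, rfl⟩ := hA
        exact hW h
      | zero => intro w _; simp
      | add x y _ _ hx hy => intro w hw; exact W.add_mem (hx w hw) (hy w hw)
      | smul a x _ hx => intro w hw; exact W.smul_mem a (hx w hw)
    obtain ⟨t, ht, h, hh, rfl⟩ := hTH g
    rw [map_mul, Module.End.mul_apply]
    have ht' := hA _ (hspan t⁻¹ (T.inv_mem ht))
    rw [inv_inv] at ht'
    exact ht' _ (hW ⟨h, hh⟩ w hw)
  have horth := sum_trace_mul_trace_inv hirrH
  have hHc : (Fintype.card H : ℂ) ≠ 0 := by exact_mod_cast Fintype.card_ne_zero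
  -- Off `J` the trace vanishes, since it is invariant under conjugation while the average of the
  -- conjugates is zero. Orthogonality then reads `|J| d² = |H|`.
  have htr : ∀ h : H, LinearMap.trace ℂ V (ρ h) * LinearMap.trace ℂ V (ρ (h : G)⁻¹) =
      if (h : G) ∈ J then (Module.finrank ℂ V : ℂ) ^ 2 else 0 := by
    intro h
    split_ifs with hh
    · have h1 : χ h * χ (h : G)⁻¹ = 1 := by
        have h1 := mul_inv h
        rw [hχ _ hh, hχ _ (J.inv_mem hh), smul_mul_smul_comm, mul_one] at h1
        obtain ⟨v, hv⟩ := exists_ne (0 : V)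
        have h2 := LinearMap.congr_fun h1 v
        simp only [LinearMap.smul_apply, Module.End.one_apply] at h2
        refine smul_left_injective ℂ hv ?_
        simpa using h2
      rw [hχ _ hh, hχ _ (J.inv_mem hh), map_smul, map_smul, LinearMap.trace_one, smul_eq_mul,
        smul_eq_mul]
      linear_combination (Module.finrank ℂ V : ℂ) ^ 2 * h1
    · have h1 := congrArg (LinearMap.trace ℂ V) (hav h h.2)
      rw [if_neg hh, map_zero, map_sum] at h1
      have h2 : ∀ x : H, LinearMap.trace ℂ V (ρ x * ρ h * ρ (x : G)⁻¹) =
          LinearMap.trace ℂ V (ρ h) := by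
        intro x
        rw [LinearMap.trace_mul_comm, ← mul_assoc, inv_mul, one_mul]
      simp only [h2, Finset.sum_const, Finset.card_univ, nsmul_eq_mul] at h1
      rw [(mul_eq_zero.1 h1).resolve_left hHc, zero_mul]
  have hsum : ∑ h : H, (if (h : G) ∈ J then (Module.finrank ℂ V : ℂ) ^ 2 else 0) =
      Fintype.card H := by
    rw [← horth]
    exact Finset.sum_congr rfl fun h _ => (htr h).symm
  rw [← Finset.sum_filter, Finset.sum_const, nsmul_eq_mul] at hsum
  have hJcard : (Finset.univ.filter fun h : H => (h : G) ∈ J).card = Nat.card J := by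
    rw [← Fintype.card_subtype, ← Nat.card_eq_fintype_card]
    exact Nat.card_congr
      { toFun := fun x => ⟨x.1, x.2⟩
        invFun := fun x => ⟨⟨x.1, hJH x.2⟩, x.2⟩
        left_inv := fun _ => rfl
        right_inv := fun _ => rfl }
  rw [hJcard] at hsum
  rw [Nat.card_eq_fintype_card (α := H)]
  exact_mod_cast hsum

/-- A commuting family coming from a subgroup has a common eigenvector. -/
theorem exists_common_eigenvector [FiniteDimensional ℂ V] [Nontrivial V] (ρ : Representation ℂ G V)
    (J : Subgroup G) (hJ : ∀ a ∈ J, ∀ b ∈ J, ρ a * ρ b = ρ b * ρ a) :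
    ∃ χ : J →* ℂˣ, ∃ v : V, v ≠ 0 ∧ ∀ j : J, ρ j v = (χ j : ℂ) • v := by
  classical
  -- Take a nonzero `J`-stable subspace of least dimension. The operators commute, so an eigenspace
  -- of one of them is again stable; by minimality each operator is scalar on it.
  let p : ℕ → Prop := fun d => ∃ W : Submodule ℂ V, W ≠ ⊥ ∧ (∀ j ∈ J, ∀ w ∈ W, ρ j w ∈ W) ∧
    Module.finrank ℂ W = d
  have hp : ∃ d, p d := ⟨_, ⊤, top_ne_bot, fun _ _ _ _ => Submodule.mem_top, rfl⟩
  obtain ⟨W, hW0, hWJ, hWd⟩ := Nat.find_spec hp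
  have hmin : ∀ W' : Submodule ℂ V, W' ≠ ⊥ → (∀ j ∈ J, ∀ w ∈ W', ρ j w ∈ W') → W' ≤ W → W' = W := by
    intro W' h0 hJ' hle
    refine Submodule.eq_of_le_of_finrank_le hle ?_
    rw [hWd]
    exact Nat.find_min' hp ⟨W', h0, hJ', rfl⟩
  have hscal : ∀ j : J, ∃ c : ℂ, ∀ w ∈ W, ρ j w = c • w := by
    intro j
    have : Nontrivial W := Submodule.nontrivial_iff_ne_bot.2 hW0
    obtain ⟨c, hc⟩ := Module.End.exists_eigenvalue ((ρ j).restrict (hWJ j j.2))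
    obtain ⟨u, hu⟩ := hc.exists_hasEigenvector
    have hu1 := hu.apply_eq_smul
    have hu2 : ρ j (u : V) = c • (u : V) := congrArg Subtype.val hu1
    have hu0 : (u : V) ≠ 0 := fun h => hu.2 (Subtype.ext h)
    have := hmin (W ⊓ Module.End.eigenspace (ρ j) c) (by
        intro h
        apply hu0
        rw [← Submodule.mem_bot ℂ, ← h]
        exact ⟨u.2, Module.End.mem_eigenspace_iff.2 hu2⟩) (by
        rintro j' hj' w ⟨hw, hw'⟩
        refine ⟨hWJ j' hj' w hw, ?_⟩
        rw [SetLike.mem_coe, Module.End.mem_eigenspace_iff] at hw' ⊢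
        rw [← Module.End.mul_apply, hJ j j.2 j' hj', Module.End.mul_apply, hw', map_smul])
      inf_le_left
    refine ⟨c, fun w hw => ?_⟩
    rw [← this] at hw
    exact Module.End.mem_eigenspace_iff.1 hw.2
  choose c hc using hscal
  obtain ⟨v, hv, hv0⟩ := Submodule.exists_mem_ne_zero_of_ne_bot hW0
  let χ : J →* ℂ :=
    { toFun := c
      map_one' := by
        refine smul_left_injective ℂ hv0 ?_
        have := hc 1 v hv
        simp only [Subgroup.coe_one, map_one, Module.End.one_apply] at this
        simpa using this.symm
      map_mul' := by
        intro a b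
        refine smul_left_injective ℂ hv0 ?_
        have := hc (a * b) v hv
        simp only [Subgroup.coe_mul, map_mul, Module.End.mul_apply] at this
        rw [hc b v hv, map_smul, hc a v hv, smul_smul, mul_comm] at this
        exact this.symm }
  exact ⟨χ.toHomUnits, v, hv0, fun j => hc j v hv⟩

end Heisenberg

/-! ### Clifford theory combined with the Heisenberg structure. -/

section Dimension

variable {G : Type*} [Group G] {V : Type*} [AddCommGroup V] [Module ℂ V]

/-- The dimension of an irreducible representation lying over a character `f` of a normal subgroup
`N` with stabilizer `Γ`, when `Γ` is the product of a normal subgroup `H`, on which `f` gives a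
Heisenberg structure with radical `J`, and of commutative groups `T` stabilizing the extensions
of `f` to `J`. -/
theorem dimension_of_heisenberg [Finite G] {ρ : Representation ℂ G V} (hρ : ρ.IsIrreducible)
    (N J H Γ : Subgroup G) (hNJ : N ≤ J) (hJH : J ≤ H) (hHΓ : H ≤ Γ) (hN : N.Normal)
    (hH : H.Normal) (f : G → ℂ)
    (hf0 : ∀ x ∈ N, f x ≠ 0) (hf : ∀ x ∈ N, ∀ y ∈ N, f (x * y) = f x * f y)
    (hΓ : ∀ g, g ∈ Γ ↔ ∀ x ∈ N, f (g⁻¹ * x * g) = f x)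
    (hne : ∃ v : V, v ≠ 0 ∧ ∀ x ∈ N, ρ x v = f x • v)
    (hcomm : ∀ h ∈ H, ∀ j ∈ J, h * j * h⁻¹ * j⁻¹ ∈ N ∧ f (h * j * h⁻¹ * j⁻¹) = 1)
    (hnd : ∀ h ∈ H, h ∉ J → ∃ h' ∈ H, h' * h * h'⁻¹ * h⁻¹ ∈ N ∧ f (h' * h * h'⁻¹ * h⁻¹) ≠ 1)
    (hT : ∀ χ : G → ℂ, (∀ a ∈ J, ∀ b ∈ J, χ (a * b) = χ a * χ b) →
      (∀ x ∈ N, χ x = f x) → ∃ T : Subgroup G, T ≤ Γ ∧ (∀ s ∈ T, ∀ t ∈ T, s * t = t * s) ∧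
        (∀ g ∈ Γ, ∃ t ∈ T, ∃ h ∈ H, g = t * h) ∧
        (∀ t ∈ T, ∀ j ∈ J, t⁻¹ * j * t ∈ J ∧ χ (t⁻¹ * j * t) = χ j) ∧
        (∀ t ∈ T, ∀ h ∈ H, h * t * h⁻¹ * t⁻¹ ∈ J → χ (h * t * h⁻¹ * t⁻¹) = 1)) :
    ∃ d : ℕ, Nat.card Γ * Module.finrank ℂ V = Nat.card G * d ∧ Nat.card J * d ^ 2 = Nat.card H := by
  classical
  have hfd := finiteDimensional_of_isIrreducible hρ
  obtain ⟨v₀, hv₀, hv₀f⟩ := hne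
  have hU0 : eigenspaceOf ρ N f ≠ ⊥ := fun h => hv₀ (by
    rw [← Submodule.mem_bot ℂ, ← h]; exact hv₀f)
  have hU : ∀ g ∈ Γ, ∀ u ∈ eigenspaceOf ρ N f, ρ g u ∈ eigenspaceOf ρ N f := fun g hg u hu =>
    apply_mem_eigenspaceOf (fun x hx => by simpa using hN.conj_mem x hx g⁻¹) ((hΓ g).1 hg) hu
  obtain ⟨hσ, hdim⟩ := clifford hρ N hN f Γ hf0 hf hΓ hU0 hU
  refine ⟨_, hdim, ?_⟩
  set U := eigenspaceOf ρ N f with hUdef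
  set σ := restrictRep ρ Γ U hU with hσdef
  have hσN : ∀ x : Γ, (x : G) ∈ N → σ x = f x • 1 := by
    intro x hx
    ext u
    exact u.2 x hx
  have hσN' : ∀ x : Γ, (x : G) ∈ N → f x = 1 → σ x = 1 := fun x hx hfx => by
    rw [hσN x hx, hfx, one_smul]
  obtain ⟨hUn, hirr⟩ := (isIrreducible_iff σ).1 hσ
  -- Commutators of elements of `J` lie in `N`, where `f` takes the value 1 on them, so `J` acts on
  -- `U` by commuting operators.
  obtain ⟨χ', u, hu0, hu⟩ := exists_common_eigenvector σ (J.subgroupOf Γ) (by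
    intro a ha b hb
    rw [Subgroup.mem_subgroupOf] at ha hb
    obtain ⟨h1, h2⟩ := hcomm a (hJH ha) b hb
    have h3 := hσN (a * b * a⁻¹ * b⁻¹) h1
    have h4 : a * b = (a * b * a⁻¹ * b⁻¹) * (b * a) := by group
    rw [← map_mul, h4, map_mul, h3]
    simp only [Subgroup.coe_mul, InvMemClass.coe_inv, h2]
    rw [one_smul, one_mul, map_mul])
  let e : J →* J.subgroupOf Γ :=
    ((Subgroup.subgroupOfEquivOfLe (hJH.trans hHΓ)).symm : J ≃* J.subgroupOf Γ).toMonoidHom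
  let χ : G → ℂ := fun g => if hg : g ∈ J then ((χ' (e ⟨g, hg⟩) : ℂˣ) : ℂ) else 0
  have hχ : ∀ g (hg : g ∈ J), χ g = ((χ' (e ⟨g, hg⟩) : ℂˣ) : ℂ) := fun g hg => dif_pos hg
  have hχu : ∀ j : Γ, (j : G) ∈ J → σ j u = χ j • u := by
    intro j hj
    rw [hχ _ hj]
    exact hu (e ⟨j, hj⟩)
  -- The group `T` is chosen only now, since it depends on the extension `χ` occurring in `U`.
  obtain ⟨T, hTΓ, hTc, hTH, hTJ, htriv⟩ := hT χ
    (fun a ha b hb => by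
      rw [hχ a ha, hχ b hb, hχ _ (J.mul_mem ha hb), ← Units.val_mul, ← map_mul, ← map_mul]
      rfl)
    (fun x hx => by
      have h1 := hχu ⟨x, hHΓ (hJH (hNJ hx))⟩ (hNJ hx)
      rw [hσN _ hx] at h1
      exact (smul_left_injective ℂ hu0 h1).symm)
  -- `E` is stable under `H`, as commutators of `H` with `J` act trivially, and under `T`, which
  -- fixes `χ`. So it is stable under `Γ` and equals `U`: all of `J` acts by scalars.
  let E := eigenspaceOf σ (J.subgroupOf Γ) (fun g => χ g)
  have hEH : ∀ y : Γ, (y : G) ∈ H → ∀ w ∈ E, σ y w ∈ E := by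
    intro y hy w hw x hx
    obtain ⟨h1, h2⟩ := hcomm (y : G)⁻¹ (H.inv_mem hy) x hx
    have h3 : σ (y⁻¹ * x * y⁻¹⁻¹ * x⁻¹) = 1 := hσN' _ h1 h2
    have e1 : x * y = y * ((y⁻¹ * x * y⁻¹⁻¹ * x⁻¹) * x) := by group
    have h4 : σ x * σ y = σ y * σ x := by
      rw [← map_mul, e1, map_mul, map_mul, h3, one_mul]
    rw [← Module.End.mul_apply, h4, Module.End.mul_apply, hw x hx, map_smul]
  have hEmem : ∀ g : Γ, ∀ w ∈ E, σ g w ∈ E := by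
    intro g w hw
    obtain ⟨t, ht, h, hh, hg⟩ := hTH g g.2
    have hg' : g = ⟨t, hTΓ ht⟩ * ⟨h, hHΓ hh⟩ := Subtype.ext hg
    rw [hg', map_mul, Module.End.mul_apply]
    refine apply_mem_eigenspaceOf (fun x hx => ?_) (fun x hx => ?_) (hEH ⟨h, hHΓ hh⟩ hh w hw)
    · exact (hTJ t ht x hx).1
    · exact (hTJ t ht x hx).2
  have hEtop : E = ⊤ := (hirr E hEmem).resolve_left fun hE => hu0 (by
    rw [← Submodule.mem_bot ℂ, ← hE]
    exact fun x hx => hχu x hx)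
  have hscal : ∀ j ∈ J.subgroupOf Γ, σ j = χ j • 1 := by
    intro j hj
    ext1 w
    exact (hEtop ▸ Submodule.mem_top : w ∈ E) j hj
  have hχN : ∀ x : G, x ∈ N → χ x = f x := fun x hx => by
    have h1 := hχu ⟨x, hHΓ (hJH (hNJ hx))⟩ (hNJ hx)
    rw [hσN _ hx] at h1
    exact (smul_left_injective ℂ hu0 h1).symm
  have hmain := card_mul_finrank_sq hσ (H.subgroupOf Γ) (J.subgroupOf Γ) (T.subgroupOf Γ)
    (fun x hx => hJH hx) inferInstance (fun g => χ g) hscal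
    (fun h hh hhJ => by
      obtain ⟨h', hh', h1, h2⟩ := hnd h hh hhJ
      exact ⟨⟨h', hHΓ hh'⟩, hh', hNJ h1, fun h3 => h2 (by rw [← hχN _ h1]; exact h3)⟩)
    (fun s hs t ht => Subtype.ext (hTc s hs t ht))
    (fun g => by
      obtain ⟨t, ht, h, hh, hg⟩ := hTH g g.2
      exact ⟨⟨t, hTΓ ht⟩, ht, ⟨h, hHΓ hh⟩, hh, Subtype.ext hg⟩)
    (fun t ht h hh hJ => htriv t ht h hh hJ)
  rw [Nat.card_congr (Subgroup.subgroupOfEquivOfLe (hJH.trans hHΓ)).toEquiv,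
    Nat.card_congr (Subgroup.subgroupOfEquivOfLe hHΓ).toEquiv] at hmain
  exact hmain

end Dimension

/-! ### Truncated discrete valuation rings: determinants and roots near 1. -/

section ChainRing

/-- The properties of the quotient `R` of a discrete valuation ring with uniformizer `π` by the
ideal `π ^ r`. -/
structure IsTruncatedDVR {R : Type*} [CommRing R] (π : R) (r : ℕ) : Prop where
  pow_eq_zero : π ^ r = 0
  dvd_of_mul_eq_zero : ∀ i j, i + j = r → ∀ x, π ^ j * x = 0 → π ^ i ∣ x

variable {R : Type*} [CommRing R] {π : R} {r n : ℕ}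

theorem IsTruncatedDVR.pow_eq_zero_of_le (hπ : IsTruncatedDVR π r) {k : ℕ} (hk : r ≤ k) :
    π ^ k = 0 := by
  rw [← Nat.add_sub_cancel' hk, pow_add, hπ.pow_eq_zero, zero_mul]

theorem IsTruncatedDVR.exists_eq_smul (hπ : IsTruncatedDVR π r) {i j : ℕ} (hij : i + j = r)
    {A : Matrix (Fin n) (Fin n) R} (hA : π ^ j • A = 0) :
    ∃ X : Matrix (Fin n) (Fin n) R, A = π ^ i • X := by
  have h : ∀ a b, ∃ x, A a b = π ^ i * x := fun a b =>
    hπ.dvd_of_mul_eq_zero i j hij _ (congrFun (congrFun hA a) b)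
  choose X hX using h
  exact ⟨Matrix.of X, by ext a b; simp [hX a b]⟩

/-- The even terms in `s` cancel: with `P` the part of the determinant beyond first order, `s -
(-s)` divides `P(s) - P(-s)`, so the factor `s²` in front makes the remainder a multiple of `s³`. -/
theorem det_one_add_sub_det_one_sub {s : R} (hs : s ^ 3 = 0) (M : Matrix (Fin n) (Fin n) R) :
    (1 + s • M).det - (1 - s • M).det = 2 * s * M.trace := by
  have h1 := Matrix.det_one_add_smul s M
  have h2 := Matrix.det_one_add_smul (-s) M
  rw [neg_smul, ← sub_eq_add_neg] at h2
  obtain ⟨k, hk⟩ := Polynomial.sub_dvd_eval_sub s (-s)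
    (1 + (Polynomial.X : Polynomial R) • M.map (Polynomial.C : R →+* Polynomial R)).det.divX.divX
  rw [h1, h2]
  linear_combination s ^ 2 * hk + 2 * k * hs

theorem det_one_add_smul_of_sq {s : R} (hs : s ^ 2 = 0) (M : Matrix (Fin n) (Fin n) R) :
    (1 + s • M).det = 1 + s * M.trace := by
  rw [Matrix.det_one_add_smul, hs]
  ring

theorem isUnit_det_one_add_smul {s : R} (hs : IsNilpotent s) (M : Matrix (Fin n) (Fin n) R) :
    IsUnit (1 + s • M).det := by
  rw [Matrix.det_one_add_smul, add_assoc]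
  refine IsNilpotent.isUnit_add_left_of_commute ?_ isUnit_one (Commute.all _ _)
  have : M.trace * s + Polynomial.eval s (1 + (Polynomial.X : Polynomial R) • M.map (Polynomial.C : R →+* Polynomial R)).det.divX.divX
      * s ^ 2 = s * (M.trace +
        Polynomial.eval s (1 + (Polynomial.X : Polynomial R) • M.map (Polynomial.C : R →+* Polynomial R)).det.divX.divX * s) := by ring
  rw [this]
  exact (Commute.all _ _).isNilpotent_mul_right hs

/-- Existence of `n`-th roots of elements congruent to `1`. -/
theorem exists_pow_eq_of_dvd_sub_one [Finite R] (hπ : IsNilpotent π) (hn : IsUnit (n : R))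
    {i : ℕ} (hi : 1 ≤ i) {u : R} (hu : π ^ i ∣ u - 1) : ∃ c, c ^ n = u ∧ π ^ i ∣ c - 1 := by
  have hpow : ∀ c : R, π ^ i ∣ c - 1 → ∀ k : ℕ, π ^ i ∣ c ^ k - 1 := by
    intro c hc k
    exact hc.trans (sub_one_dvd_pow_sub_one c k)
  -- The power map on the finite set `1 + π^i R` is injective, hence surjective: `c^n - d^n` is `c -
  -- d` times a sum congruent to `n` modulo `π`, which is a unit.
  let F : {c : R // π ^ i ∣ c - 1} → {c : R // π ^ i ∣ c - 1} := fun c => ⟨c ^ n, hpow c c.2 n⟩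
  have hF : Function.Injective F := by
    rintro ⟨c, hc⟩ ⟨d, hd⟩ hcd
    have hcd : c ^ n = d ^ n := congrArg Subtype.val hcd
    have h1 := (Commute.all c d).geom_sum₂_mul n
    rw [hcd, sub_self] at h1
    have h2 : π ∣ (∑ i ∈ Finset.range n, c ^ i * d ^ (n - 1 - i)) - n := by
      have : (∑ i ∈ Finset.range n, c ^ i * d ^ (n - 1 - i)) - n =
          ∑ i ∈ Finset.range n, (c ^ i * d ^ (n - 1 - i) - 1) := by
        simp [Finset.sum_sub_distrib]
      rw [this]
      refine Finset.dvd_sum fun k _ => ?_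
      have e : c ^ k * d ^ (n - 1 - k) - 1 =
        (c ^ k - 1) * d ^ (n - 1 - k) + (d ^ (n - 1 - k) - 1) := by ring
      rw [e]
      refine (dvd_pow_self π (by omega : i ≠ 0)).trans ?_
      exact dvd_add ((hpow c hc k).mul_right _) (hpow d hd _)
    obtain ⟨z, hz⟩ := h2
    have h3 : IsUnit (∑ i ∈ Finset.range n, c ^ i * d ^ (n - 1 - i)) := by
      rw [eq_add_of_sub_eq' hz]
      exact IsNilpotent.isUnit_add_left_of_commute ((Commute.all _ _).isNilpotent_mul_right hπ)
        hn (Commute.all _ _)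
    exact Subtype.ext (sub_eq_zero.1 (h3.mul_right_eq_zero.1 h1))
  obtain ⟨⟨c, hc⟩, hcu⟩ := Finite.surjective_of_injective hF ⟨u, hu⟩
  exact ⟨c, congrArg Subtype.val hcu, hc⟩

end ChainRing

/-! ### Logarithm and exponential truncated at order two. -/

section TruncatedLog

variable {R A : Type*} [CommRing R] [Ring A] [Algebra R A] {c : R}

/-- The truncated logarithm `(g - 1) - (g - 1)² / 2`, with `c = 1 / 2`. -/
def truncLog (c : R) (g : A) : A := (g - 1) - c • (g - 1) ^ 2

/-- The Baker–Campbell–Hausdorff formula to second order; the hypotheses remove the mixed cubic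
terms, and with them the quartic one. -/
theorem truncLog_mul (hc : 2 * c = 1) {g h : A}
    (h1 : (g - 1) * (g - 1) * (h - 1) = 0) (h2 : (h - 1) * (g - 1) * (h - 1) = 0)
    (h3 : (g - 1) * (h - 1) * (g - 1) = 0) (h4 : (g - 1) * (h - 1) * (h - 1) = 0) :
    truncLog c (g * h) = truncLog c g + truncLog c h +
      c • ((g - 1) * (h - 1) - (h - 1) * (g - 1)) := by
  set a := g - 1 with ha
  set b := h - 1 with hb
  have hgh : g * h - 1 = a + b + a * b := by
    rw [ha, hb]; noncomm_ring
  have hsq : (a + b + a * b) ^ 2 = a ^ 2 + b ^ 2 + a * b + b * a := by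
    have : (a + b + a * b) ^ 2 = a ^ 2 + b ^ 2 + a * b + b * a + a * a * b + b * a * b
      + a * b * a + a * b * b + a * b * a * b := by noncomm_ring
    rw [this, h1, h2, h3, h4]
    simp
  have hab : a * b = c • (a * b) + c • (a * b) := by
    rw [← add_smul, ← two_mul, hc, one_smul]
  unfold truncLog
  rw [hgh, hsq, ← ha, ← hb]
  simp only [smul_add, smul_sub]
  nth_rewrite 1 [hab]
  abel

/-- The truncated exponential `1 + L + L² / 2`, with `c = 1 / 2`. -/
def truncExp (c : R) (L : A) : A := 1 + L + c • L ^ 2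

/-- The exponential agrees with the Cayley transform `(1 + L/2) / (1 - L/2)` up to cubic terms. This
gives access to its determinant. -/
theorem cayley_truncExp (hc : 2 * c = 1) {L : A} (hL : L ^ 3 = 0) :
    (1 - c • L) * truncExp c L = 1 + c • L := by
  have h2 : 2 * (Polynomial.C c : Polynomial R) = 1 := by
    rw [show (2 : Polynomial R) = Polynomial.C 2 from rfl, ← map_mul, hc, map_one]
  have key : (1 - Polynomial.C c * Polynomial.X) *
      (1 + Polynomial.X + Polynomial.C c * Polynomial.X ^ 2) =
      1 + Polynomial.C c * Polynomial.X - Polynomial.C c ^ 2 * Polynomial.X ^ 3 := by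
    linear_combination (-Polynomial.X) * h2
  have := congrArg (Polynomial.aeval L) key
  simpa [hL, truncExp, Algebra.smul_def] using this

theorem truncLog_truncExp {L : A} (hL : L ^ 3 = 0) :
    truncLog c (truncExp c L) = L := by
  have key : (Polynomial.X + Polynomial.C c * Polynomial.X ^ 2) -
      Polynomial.C c * (Polynomial.X + Polynomial.C c * Polynomial.X ^ 2) ^ 2 =
      Polynomial.X - (2 * Polynomial.C c ^ 2 + Polynomial.C c ^ 3 * Polynomial.X) *
        Polynomial.X ^ 3 := by
    ring
  have := congrArg (Polynomial.aeval L) key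
  simpa [hL, truncLog, truncExp, Algebra.smul_def, add_assoc] using this

theorem truncExp_truncLog {g : A} (hg : (g - 1) ^ 3 = 0) :
    truncExp c (truncLog c g) = g := by
  have key : 1 + (Polynomial.X - Polynomial.C c * Polynomial.X ^ 2) +
      Polynomial.C c * (Polynomial.X - Polynomial.C c * Polynomial.X ^ 2) ^ 2 =
      1 + Polynomial.X - (2 * Polynomial.C c ^ 2 - Polynomial.C c ^ 3 * Polynomial.X) *
        Polynomial.X ^ 3 := by
    ring
  have := congrArg (Polynomial.aeval (g - 1)) key
  simpa [hg, truncLog, truncExp, Algebra.smul_def] using this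

theorem truncLog_inv (hc : 2 * c = 1) {g h : A} (hhg : h * g = 1)
    (hg : (g - 1) ^ 3 = 0) : truncLog c h = -truncLog c g := by
  have hh : h - 1 = -(g - 1) + (g - 1) ^ 2 := by
    have e : h - 1 - (-(g - 1) + (g - 1) ^ 2) = -(h * (g - 1) ^ 3) := by
      have e2 : h * (g - 1) ^ 3 = (h * g) * (g - 1) ^ 2 - (h * g) * (g - 1) + h * g - h := by
        noncomm_ring
      rw [e2, hhg]
      noncomm_ring
    rw [hg, mul_zero, neg_zero, sub_eq_zero] at e
    exact e
  have h2 : 2 * (Polynomial.C c : Polynomial R) = 1 := by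
    rw [show (2 : Polynomial R) = Polynomial.C 2 from rfl, ← map_mul, hc, map_one]
  have key : (-Polynomial.X + Polynomial.X ^ 2) -
      Polynomial.C c * (-Polynomial.X + Polynomial.X ^ 2) ^ 2 =
      -(Polynomial.X - Polynomial.C c * Polynomial.X ^ 2) +
        (2 * Polynomial.C c - Polynomial.C c * Polynomial.X) * Polynomial.X ^ 3 := by
    linear_combination (-Polynomial.X ^ 2) * h2
  have := congrArg (Polynomial.aeval (g - 1)) key
  unfold truncLog
  rw [hh]
  simpa [hg, Algebra.smul_def] using this

end TruncatedLog

/-! ### Congruence subgroups, centralizers modulo powers of `π`, and determinants. -/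

section MatrixGroups

variable {R : Type*} [CommRing R] {π : R} {r l l' n : ℕ}

/-- The elements of `SL_n(R)` which are congruent to `1` modulo the annihilator of `c`. -/
def congSubgroup (n : ℕ) (c : R) : Subgroup (Matrix.SpecialLinearGroup (Fin n) R) where
  carrier := {g | c • (g.val - 1) = 0}
  one_mem' := by simp
  mul_mem' := by
    intro g h hg hh
    have e : (g * h).val - 1 = (g.val - 1) * h.val + (h.val - 1) := by
      rw [Matrix.SpecialLinearGroup.coe_mul]; noncomm_ring
    simp only [Set.mem_ofPred_eq] at hg hh ⊢
    rw [e, smul_add, ← smul_mul_assoc, hg, hh, zero_mul, add_zero]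
  inv_mem' := by
    intro g hg
    simp only [Set.mem_ofPred_eq] at hg ⊢
    have e : (g⁻¹).val - 1 = -((g⁻¹).val * (g.val - 1)) := by
      rw [mul_sub, ← Matrix.SpecialLinearGroup.coe_mul, inv_mul_cancel,
        Matrix.SpecialLinearGroup.coe_one]
      noncomm_ring
    rw [e, smul_neg, ← mul_smul_comm, hg, mul_zero, neg_zero]

theorem mem_congSubgroup {c : R} {g : Matrix.SpecialLinearGroup (Fin n) R} :
    g ∈ congSubgroup n c ↔ c • (g.val - 1) = 0 := Iff.rfl

theorem val_mul_inv (g : Matrix.SpecialLinearGroup (Fin n) R) : g.val * (g⁻¹).val = 1 := by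
  rw [← Matrix.SpecialLinearGroup.coe_mul, mul_inv_cancel, Matrix.SpecialLinearGroup.coe_one]

theorem val_inv_mul (g : Matrix.SpecialLinearGroup (Fin n) R) : (g⁻¹).val * g.val = 1 := by
  rw [← Matrix.SpecialLinearGroup.coe_mul, inv_mul_cancel, Matrix.SpecialLinearGroup.coe_one]

theorem congSubgroup_normal (c : R) : (congSubgroup n c).Normal where
  conj_mem := by
    intro x hx g
    rw [mem_congSubgroup] at hx ⊢
    have e : (g * x * g⁻¹).val - 1 = g.val * (x.val - 1) * (g⁻¹).val := by
      rw [mul_sub, sub_mul, mul_one, val_mul_inv]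
      simp
    rw [e, ← smul_mul_assoc, ← mul_smul_comm, hx, mul_zero, zero_mul]

theorem congSubgroup_mono {c d : R} (h : c ∣ d) : congSubgroup n c ≤ congSubgroup n d := by
  obtain ⟨k, rfl⟩ := h
  intro g hg
  rw [mem_congSubgroup] at hg ⊢
  rw [mul_comm, mul_smul, hg, smul_zero]

/-- The elements of `SL_n(R)` which commute with `B` modulo the annihilator of `c`. -/
def centSubgroup (c : R) (B : Matrix (Fin n) (Fin n) R) :
    Subgroup (Matrix.SpecialLinearGroup (Fin n) R) where
  carrier := {g | c • (g.val * B - B * g.val) = 0}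
  one_mem' := by simp
  mul_mem' := by
    intro g h hg hh
    have e : (g * h).val * B - B * (g * h).val =
        g.val * (h.val * B - B * h.val) + (g.val * B - B * g.val) * h.val := by
      rw [Matrix.SpecialLinearGroup.coe_mul]; noncomm_ring
    simp only [Set.mem_ofPred_eq] at hg hh ⊢
    rw [e, smul_add, ← Matrix.mul_smul, ← Matrix.smul_mul, hg, hh, zero_mul, mul_zero, add_zero]
  inv_mem' := by
    intro g hg
    simp only [Set.mem_ofPred_eq] at hg ⊢
    have e : (g⁻¹).val * B - B * (g⁻¹).val =
        -((g⁻¹).val * (g.val * B - B * g.val) * (g⁻¹).val) := by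
      have : (g⁻¹).val * (g.val * B - B * g.val) * (g⁻¹).val =
        ((g⁻¹).val * g.val) * B * (g⁻¹).val - (g⁻¹).val * B * (g.val * (g⁻¹).val) := by
        noncomm_ring
      rw [this, val_inv_mul, val_mul_inv]
      noncomm_ring
    rw [e, smul_neg, ← smul_mul_assoc, ← mul_smul_comm, hg, mul_zero, zero_mul, neg_zero]

theorem mem_centSubgroup {c : R} {B : Matrix (Fin n) (Fin n) R}
    {g : Matrix.SpecialLinearGroup (Fin n) R} :
    g ∈ centSubgroup c B ↔ c • (g.val * B - B * g.val) = 0 := Iff.rfl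

theorem congSubgroup_le_centSubgroup (c : R) (B : Matrix (Fin n) (Fin n) R) :
    congSubgroup n c ≤ centSubgroup c B := by
  intro g hg
  rw [mem_congSubgroup] at hg
  rw [mem_centSubgroup]
  have e : g.val * B - B * g.val = (g.val - 1) * B - B * (g.val - 1) := by noncomm_ring
  rw [e, smul_sub, ← smul_mul_assoc, ← mul_smul_comm, hg, zero_mul, mul_zero, sub_zero]

/-- Each factor is divisible by `π^l'`, and `3 l' ≥ r`. This is why second-order truncation is
exact. -/
theorem IsTruncatedDVR.mul_mul_eq_zero (hπ : IsTruncatedDVR π r) (hr : r = l + l')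
    (hl : l ≤ 2 * l') {a b d : Matrix (Fin n) (Fin n) R} (ha : π ^ l • a = 0)
    (hb : π ^ l • b = 0) (hd : π ^ l • d = 0) : a * b * d = 0 := by
  obtain ⟨a, rfl⟩ := hπ.exists_eq_smul (by omega : l' + l = r) ha
  obtain ⟨b, rfl⟩ := hπ.exists_eq_smul (by omega : l' + l = r) hb
  obtain ⟨d, rfl⟩ := hπ.exists_eq_smul (by omega : l' + l = r) hd
  simp only [Matrix.smul_mul, Matrix.mul_smul, smul_smul, ← pow_add]
  rw [hπ.pow_eq_zero_of_le (by omega), zero_smul]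

theorem IsTruncatedDVR.smul_mul_eq_zero (hπ : IsTruncatedDVR π r) (hr : r = l + l')
    (hl : l ≤ 2 * l') {a b : Matrix (Fin n) (Fin n) R} (ha : π ^ l • a = 0)
    (hb : π ^ l • b = 0) : π ^ l' • (a * b) = 0 := by
  obtain ⟨a, rfl⟩ := hπ.exists_eq_smul (by omega : l' + l = r) ha
  obtain ⟨b, rfl⟩ := hπ.exists_eq_smul (by omega : l' + l = r) hb
  simp only [Matrix.smul_mul, Matrix.mul_smul, smul_smul, ← pow_add]
  rw [hπ.pow_eq_zero_of_le (by omega), zero_smul]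

theorem IsTruncatedDVR.mul_eq_zero_of_smul (hπ : IsTruncatedDVR π r) (hr : r = l + l')
    {a b : Matrix (Fin n) (Fin n) R} (ha : π ^ l' • a = 0) (hb : π ^ l • b = 0) :
    a * b = 0 ∧ b * a = 0 := by
  obtain ⟨a, rfl⟩ := hπ.exists_eq_smul (by omega : l + l' = r) ha
  refine ⟨?_, ?_⟩
  · rw [Matrix.smul_mul, ← Matrix.mul_smul, hb, mul_zero]
  · rw [Matrix.mul_smul, ← Matrix.smul_mul, hb, zero_mul]

/-- The commutator of two elements of the congruence subgroup. -/
theorem commutator_val (hπ : IsTruncatedDVR π r) (hr : r = l + l') (hl : l ≤ 2 * l')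
    {g h : Matrix.SpecialLinearGroup (Fin n) R} (hg : g ∈ congSubgroup n (π ^ l))
    (hh : h ∈ congSubgroup n (π ^ l)) :
    (g * h * g⁻¹ * h⁻¹).val - 1 = (g.val - 1) * (h.val - 1) - (h.val - 1) * (g.val - 1) := by
  have hx : g⁻¹ * h⁻¹ ∈ congSubgroup n (π ^ l) :=
    Subgroup.mul_mem _ (Subgroup.inv_mem _ hg) (Subgroup.inv_mem _ hh)
  rw [mem_congSubgroup] at hg hh hx
  have e1 : (g * h * g⁻¹ * h⁻¹).val =
      (h.val * g.val + ((g.val - 1) * (h.val - 1) - (h.val - 1) * (g.val - 1))) *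
        (g⁻¹ * h⁻¹).val := by
    have : g * h * g⁻¹ * h⁻¹ = (g * h) * (g⁻¹ * h⁻¹) := by group
    rw [this, Matrix.SpecialLinearGroup.coe_mul, Matrix.SpecialLinearGroup.coe_mul g h]
    congr 1
    noncomm_ring
  have e2 : h.val * g.val * (g⁻¹ * h⁻¹).val = 1 := by
    rw [← Matrix.SpecialLinearGroup.coe_mul, ← Matrix.SpecialLinearGroup.coe_mul]
    simp
  have e3 : ((g.val - 1) * (h.val - 1) - (h.val - 1) * (g.val - 1)) * ((g⁻¹ * h⁻¹).val - 1) = 0 := by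
    rw [sub_mul, hπ.mul_mul_eq_zero hr hl hg hh hx, hπ.mul_mul_eq_zero hr hl hh hg hx, sub_zero]
  rw [e1, add_mul, e2, add_sub_cancel_left]
  rw [mul_sub, mul_one, sub_eq_zero] at e3
  exact e3

theorem commutator_mem (hπ : IsTruncatedDVR π r) (hr : r = l + l') (hl : l ≤ 2 * l')
    {g h : Matrix.SpecialLinearGroup (Fin n) R} (hg : g ∈ congSubgroup n (π ^ l))
    (hh : h ∈ congSubgroup n (π ^ l)) : g * h * g⁻¹ * h⁻¹ ∈ congSubgroup n (π ^ l') := by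
  rw [mem_congSubgroup, commutator_val hπ hr hl hg hh, smul_sub,
    hπ.smul_mul_eq_zero hr hl hg hh, hπ.smul_mul_eq_zero hr hl hh hg, sub_zero]

/-- Cyclicity of the trace moves the commutator onto `B`, so that commuting with `B` modulo a power
of `π` controls the commutator pairing. -/
theorem trace_commutator_mul (a b B : Matrix (Fin n) (Fin n) R) :
    ((a * b - b * a) * B).trace = (a * (b * B - B * b)).trace := by
  rw [sub_mul, mul_sub, Matrix.trace_sub, Matrix.trace_sub, mul_assoc, mul_assoc b,
    Matrix.trace_mul_comm b, mul_assoc]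

/-- The subgroup of `SL_n(R)` on which a character of the congruence subgroup extends. -/
def radSubgroup (c d : R) (B : Matrix (Fin n) (Fin n) R) :
    Subgroup (Matrix.SpecialLinearGroup (Fin n) R) :=
  congSubgroup n c ⊓ centSubgroup d B

/-- `θ(tr((g - 1) B))`. -/
def traceCharSL (θ : AddChar R ℂ) (B : Matrix (Fin n) (Fin n) R)
    (g : Matrix.SpecialLinearGroup (Fin n) R) : ℂ :=
  θ (((g.val - 1) * B).trace)

theorem addChar_ne_zero (θ : AddChar R ℂ) (x : R) : θ x ≠ 0 :=
  (θ.val_isUnit x).ne_zero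

theorem traceCharSL_mul (hπ : IsTruncatedDVR π r) (hr : r = l + l') (hl : l' ≤ l)
    (θ : AddChar R ℂ) (B : Matrix (Fin n) (Fin n) R)
    {g h : Matrix.SpecialLinearGroup (Fin n) R} (hg : g ∈ congSubgroup n (π ^ l'))
    (hh : h ∈ congSubgroup n (π ^ l')) :
    traceCharSL θ B (g * h) = traceCharSL θ B g * traceCharSL θ B h := by
  have h0 := (hπ.mul_eq_zero_of_smul hr hg (congSubgroup_mono (pow_dvd_pow π hl) hh)).1
  have e : (g * h).val - 1 = (g.val - 1) + (h.val - 1) := by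
    have : (g * h).val - 1 = (g.val - 1) + (h.val - 1) + (g.val - 1) * (h.val - 1) := by
      rw [Matrix.SpecialLinearGroup.coe_mul]; noncomm_ring
    rw [this, h0, add_zero]
  unfold traceCharSL
  rw [← AddChar.map_add_eq_mul, ← Matrix.trace_add, ← add_mul, e]

/-- Nondegeneracy of the trace pairing twisted by `θ`. -/
theorem eq_zero_of_forall_trace {θ : AddChar R ℂ} (hθ : ∀ x, (∀ y, θ (y * x) = 1) → x = 0)
    {D : Matrix (Fin n) (Fin n) R} (h : ∀ Y : Matrix (Fin n) (Fin n) R, θ ((Y * D).trace) = 1) :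
    D = 0 := by
  ext i j
  refine hθ _ fun y => ?_
  have := h (Matrix.single j i y)
  rwa [Matrix.trace_single_mul] at this

/-- Traceless test matrices suffice: since `n` is invertible, `Y` can be made traceless by
subtracting a scalar matrix, which pairs to zero with the traceless `D`. -/
theorem smul_eq_zero_of_forall_trace {θ : AddChar R ℂ}
    (hθ : ∀ x, (∀ y, θ (y * x) = 1) → x = 0) (hn : IsUnit (n : R)) (c : R)
    {D : Matrix (Fin n) (Fin n) R} (hD : D.trace = 0)
    (h : ∀ Y : Matrix (Fin n) (Fin n) R, Y.trace = 0 → θ (((c • Y) * D).trace) = 1) :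
    c • D = 0 := by
  refine eq_zero_of_forall_trace hθ fun Y => ?_
  obtain ⟨k, hk⟩ := hn.exists_right_inv
  have h1 := h (Y - (k * Y.trace) • 1) (by
    rw [Matrix.trace_sub, Matrix.trace_smul, Matrix.trace_one, Fintype.card_fin, smul_eq_mul]
    linear_combination -Y.trace * hk)
  rw [← h1]
  congr 1
  simp only [Matrix.mul_smul, Matrix.smul_mul, sub_mul, one_mul, Matrix.trace_smul,
    Matrix.trace_sub, hD, smul_zero, sub_zero, smul_sub]

theorem pow_truncLog_cube (hπ : IsTruncatedDVR π r) (hr : r = l + l') (hl : l ≤ 2 * l')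
    {a : Matrix (Fin n) (Fin n) R} (ha : π ^ l • a = 0) : a ^ 3 = 0 := by
  rw [pow_succ, pow_two, hπ.mul_mul_eq_zero hr hl ha ha ha]

theorem det_cayley (hπ : IsTruncatedDVR π r) (hr : r = l + l') (hl : l ≤ 2 * l') {c : R}
    (hc : 2 * c = 1) {L : Matrix (Fin n) (Fin n) R} (hL : π ^ l • L = 0) :
    (1 + c • L).det - (1 - c • L).det = L.trace ∧ IsUnit (1 - c • L).det := by
  obtain ⟨X, rfl⟩ := hπ.exists_eq_smul (by omega : l' + l = r) hL
  rw [smul_smul]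
  have h3 : (c * π ^ l') ^ 3 = 0 := by
    rw [mul_pow, ← pow_mul, hπ.pow_eq_zero_of_le (by omega), mul_zero]
  refine ⟨?_, ?_⟩
  · rw [det_one_add_sub_det_one_sub h3, Matrix.trace_smul, smul_eq_mul]
    linear_combination π ^ l' * X.trace * hc
  · have := isUnit_det_one_add_smul (s := -(c * π ^ l')) (IsNilpotent.neg ⟨3, h3⟩) X
    rwa [neg_smul, ← sub_eq_add_neg] at this

/-- By the Cayley form, the determinant is a quotient of `det(1 + L/2)` by `det(1 - L/2)`, and these
differ exactly by `tr L`. -/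
theorem det_truncExp (hπ : IsTruncatedDVR π r) (hr : r = l + l') (hl : l ≤ 2 * l') {c : R}
    (hc : 2 * c = 1) {L : Matrix (Fin n) (Fin n) R} (hL : π ^ l • L = 0) (htr : L.trace = 0) :
    (truncExp c L).det = 1 := by
  obtain ⟨h1, h2⟩ := det_cayley hπ hr hl hc hL
  have h3 := congrArg Matrix.det (cayley_truncExp hc (pow_truncLog_cube hπ hr hl hL))
  rw [Matrix.det_mul] at h3
  rw [htr, sub_eq_zero] at h1
  rw [h1] at h3
  exact h2.mul_left_cancel (by rw [h3, mul_one])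

theorem smul_truncLog {s c : R} {g : Matrix (Fin n) (Fin n) R} (hg : s • (g - 1) = 0) :
    s • truncLog c g = 0 := by
  unfold truncLog
  rw [smul_sub, hg, smul_comm, pow_two, ← smul_mul_assoc, hg, zero_mul, smul_zero, sub_zero]

theorem smul_truncExp {s c : R} {L : Matrix (Fin n) (Fin n) R} (hL : s • L = 0) :
    s • (truncExp c L - 1) = 0 := by
  unfold truncExp
  rw [add_assoc, add_sub_cancel_left, smul_add, hL, smul_comm, pow_two, ← smul_mul_assoc, hL,
    zero_mul, smul_zero, add_zero]

theorem trace_truncLog (hπ : IsTruncatedDVR π r) (hr : r = l + l') (hl : l ≤ 2 * l') {c : R}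
    (hc : 2 * c = 1) {g : Matrix.SpecialLinearGroup (Fin n) R}
    (hg : g ∈ congSubgroup n (π ^ l)) : (truncLog c g.val).trace = 0 := by
  have hL := smul_truncLog (c := c) hg
  obtain ⟨h1, h2⟩ := det_cayley hπ hr hl hc hL
  have h3 := congrArg Matrix.det (cayley_truncExp hc (pow_truncLog_cube hπ hr hl hL))
  rw [truncExp_truncLog (pow_truncLog_cube hπ hr hl hg), Matrix.det_mul, g.2, mul_one] at h3
  rw [← h1, h3, sub_self]

end MatrixGroups

/-! ### The stabilizer of the character and the radical of the commutator pairing. -/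

section Stabilizer

variable {R : Type*} [CommRing R] {π : R} {r l l' n : ℕ}

theorem traceCharSL_conj (θ : AddChar R ℂ) (B : Matrix (Fin n) (Fin n) R)
    (g x : Matrix.SpecialLinearGroup (Fin n) R) :
    traceCharSL θ B (g⁻¹ * x * g) = traceCharSL θ B x *
      θ (((x.val - 1) * (g.val * B * (g⁻¹).val - B)).trace) := by
  have e : (g⁻¹ * x * g).val - 1 = (g⁻¹).val * (x.val - 1) * g.val := by
    rw [mul_sub, sub_mul, mul_one, val_inv_mul]
    simp
  unfold traceCharSL
  rw [← AddChar.map_add_eq_mul, ← Matrix.trace_add, ← mul_add, add_sub_cancel, e]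
  congr 1
  rw [mul_assoc, mul_assoc, Matrix.trace_mul_comm]
  simp only [mul_assoc]

/-- Conjugation by `g` replaces `B` by `g B g⁻¹`. The two characters agree on `N` exactly when `g B
g⁻¹ - B` is killed by `π^l`, by nondegeneracy of the trace pairing on traceless matrices. -/
theorem mem_centSubgroup_iff_stabilizer (hπ : IsTruncatedDVR π r) (hr : r = l + l') (hl : l' ≤ l)
    {θ : AddChar R ℂ} (hθ : ∀ x, (∀ y, θ (y * x) = 1) → x = 0) (hn : IsUnit (n : R))
    (B : Matrix (Fin n) (Fin n) R) (g : Matrix.SpecialLinearGroup (Fin n) R) :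
    g ∈ centSubgroup (π ^ l) B ↔
      ∀ x ∈ congSubgroup n (π ^ l'), traceCharSL θ B (g⁻¹ * x * g) = traceCharSL θ B x := by
  have hD : g.val * B * (g⁻¹).val - B = (g.val * B - B * g.val) * (g⁻¹).val := by
    rw [sub_mul, mul_assoc B, val_mul_inv, mul_one]
  have hD' : g.val * B - B * g.val = (g.val * B * (g⁻¹).val - B) * g.val := by
    rw [hD, mul_assoc, val_inv_mul, mul_one]
  constructor
  · intro hg x hx
    rw [traceCharSL_conj, hD]
    rw [mem_centSubgroup] at hg
    have h1 : π ^ l • ((g.val * B - B * g.val) * (g⁻¹).val) = 0 := by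
      rw [← smul_mul_assoc, hg, zero_mul]
    rw [(hπ.mul_eq_zero_of_smul hr hx h1).1]
    simp
  · intro h
    rw [mem_centSubgroup, hD', ← smul_mul_assoc]
    rw [smul_eq_zero_of_forall_trace hθ hn (π ^ l) (D := g.val * B * (g⁻¹).val - B), zero_mul]
    · rw [Matrix.trace_sub, mul_assoc, Matrix.trace_mul_comm, mul_assoc, val_inv_mul, mul_one,
        sub_self]
    · intro Y hY
      -- As `2 l ≥ r`, the matrix `1 + π^l Y` has determinant exactly 1 for traceless `Y`.
      have hsq : (π ^ l) ^ 2 = 0 := by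
        rw [← pow_mul]; exact hπ.pow_eq_zero_of_le (by omega)
      obtain ⟨x, hx⟩ : ∃ x : Matrix.SpecialLinearGroup (Fin n) R, x.val = 1 + π ^ l • Y :=
        ⟨⟨_, by rw [det_one_add_smul_of_sq hsq, hY, mul_zero, add_zero]⟩, rfl⟩
      have h1 := h x (by
        rw [mem_congSubgroup, hx, add_sub_cancel_left, smul_smul, ← pow_add,
          hπ.pow_eq_zero_of_le (by omega), zero_smul])
      rw [traceCharSL_conj, hx, add_sub_cancel_left] at h1
      exact (mul_eq_left₀ (addChar_ne_zero θ _)).1 h1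

theorem traceCharSL_commutator (hπ : IsTruncatedDVR π r) (hr : r = l + l') (hl : l ≤ 2 * l')
    (θ : AddChar R ℂ) (B : Matrix (Fin n) (Fin n) R) {g h : Matrix.SpecialLinearGroup (Fin n) R}
    (hg : g ∈ congSubgroup n (π ^ l)) (hh : h ∈ congSubgroup n (π ^ l)) :
    traceCharSL θ B (g * h * g⁻¹ * h⁻¹) =
      θ (((g.val - 1) * ((h.val - 1) * B - B * (h.val - 1))).trace) := by
  rw [traceCharSL, commutator_val hπ hr hl hg hh, trace_commutator_mul]

theorem sub_one_mul_sub_mul_sub_one (g B : Matrix (Fin n) (Fin n) R) :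
    (g - 1) * B - B * (g - 1) = g * B - B * g := by
  noncomm_ring

theorem traceCharSL_commutator_eq_one (hπ : IsTruncatedDVR π r) (hr : r = l + l')
    (hl : l ≤ 2 * l') (θ : AddChar R ℂ) (B : Matrix (Fin n) (Fin n) R)
    {g h : Matrix.SpecialLinearGroup (Fin n) R} (hg : g ∈ congSubgroup n (π ^ l))
    (hh : h ∈ radSubgroup (π ^ l) (π ^ l') B) :
    traceCharSL θ B (g * h * g⁻¹ * h⁻¹) = 1 := by
  rw [traceCharSL_commutator hπ hr hl θ B hg hh.1, sub_one_mul_sub_mul_sub_one,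
    (hπ.mul_eq_zero_of_smul hr hh.2 hg).2]
  simp

/-- Test elements `exp(π^l' Y)` with `Y` traceless stay in `SL_n`. Their quadratic term drops out of
the pairing, since `h B - B h` is itself killed by `π^l` and triple products vanish. -/
theorem exists_traceCharSL_commutator_ne_one (hπ : IsTruncatedDVR π r) (hr : r = l + l')
    (hl : l ≤ 2 * l') {θ : AddChar R ℂ} (hθ : ∀ x, (∀ y, θ (y * x) = 1) → x = 0)
    (hn : IsUnit (n : R)) {c : R} (hc : 2 * c = 1) (B : Matrix (Fin n) (Fin n) R)
    {h : Matrix.SpecialLinearGroup (Fin n) R} (hh : h ∈ congSubgroup n (π ^ l))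
    (hhJ : h ∉ radSubgroup (π ^ l) (π ^ l') B) :
    ∃ g ∈ congSubgroup n (π ^ l), traceCharSL θ B (g * h * g⁻¹ * h⁻¹) ≠ 1 := by
  by_contra! hcon
  apply hhJ
  refine ⟨hh, ?_⟩
  have hhB : π ^ l • (h.val * B - B * h.val) = 0 := congSubgroup_le_centSubgroup _ B hh
  change π ^ l' • (h.val * B - B * h.val) = 0
  refine smul_eq_zero_of_forall_trace hθ hn (π ^ l') (D := h.val * B - B * h.val) ?_ ?_
  · rw [Matrix.trace_sub, Matrix.trace_mul_comm, sub_self]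
  · intro Y hY
    have hL : π ^ l • π ^ l' • Y = 0 := by
      rw [smul_smul, ← pow_add, hπ.pow_eq_zero_of_le hr.le, zero_smul]
    obtain ⟨g, hgval⟩ : ∃ g : Matrix.SpecialLinearGroup (Fin n) R,
        g.val = truncExp c (π ^ l' • Y) :=
      ⟨⟨_, det_truncExp hπ hr hl hc hL (by rw [Matrix.trace_smul, hY, smul_zero])⟩, rfl⟩
    have hg : g ∈ congSubgroup n (π ^ l) := by
      rw [mem_congSubgroup, hgval]
      exact smul_truncExp hL
    have h1 := hcon g hg
    rw [traceCharSL_commutator hπ hr hl θ B hg hh, sub_one_mul_sub_mul_sub_one, hgval] at h1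
    simp only [truncExp, add_assoc, add_sub_cancel_left] at h1
    rwa [add_mul (π ^ l' • Y), Matrix.smul_mul c, pow_two, hπ.mul_mul_eq_zero hr hl hL hL hhB,
      smul_zero, add_zero] at h1

end Stabilizer

/-! ### Characters of matrix groups given by trace pairings. -/

section Duality

variable {R : Type*} [CommRing R] {n : ℕ}

/-- The additive character `X ↦ θ(tr(X C))` of the matrix ring. -/
def matrixChar (θ : AddChar R ℂ) (C : Matrix (Fin n) (Fin n) R) :
    AddChar (Matrix (Fin n) (Fin n) R) ℂ :=
  θ.compAddMonoidHom ((Matrix.traceAddMonoidHom (Fin n) R).comp (AddMonoidHom.mulRight C))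

theorem matrixChar_apply (θ : AddChar R ℂ) (C X : Matrix (Fin n) (Fin n) R) :
    matrixChar θ C X = θ ((X * C).trace) := rfl

/-- Injectivity is nondegeneracy of the pairing, and a finite abelian group has as many characters
as elements. -/
theorem matrixChar_surjective [Finite R] {θ : AddChar R ℂ}
    (hθ : ∀ x, (∀ y, θ (y * x) = 1) → x = 0) :
    Function.Surjective (matrixChar (n := n) θ) := by
  have := Fintype.ofFinite (Matrix (Fin n) (Fin n) R)
  refine ((Fintype.bijective_iff_injective_and_card _).2 ⟨?_, ?_⟩).2
  · intro C D h
    rw [← sub_eq_zero]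
    refine eq_zero_of_forall_trace hθ fun Y => ?_
    have := DFunLike.congr_fun h Y
    rw [matrixChar_apply, matrixChar_apply] at this
    rw [mul_sub, Matrix.trace_sub, AddChar.map_sub_eq_div, this,
      div_self (addChar_ne_zero θ _)]
  · exact AddChar.card_eq.symm

/-- A character of a group `J` factoring through an additive map to the matrix ring is given by a
matrix. -/
theorem exists_matrix_of_character [Finite R] {θ : AddChar R ℂ}
    (hθ : ∀ x, (∀ y, θ (y * x) = 1) → x = 0) {J : Type*} [Group J]
    (φ : J →* Multiplicative (Matrix (Fin n) (Fin n) R)) (κ : J →* ℂˣ) (hφκ : φ.ker ≤ κ.ker) :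
    ∃ C : Matrix (Fin n) (Fin n) R, ∀ j, (κ j : ℂ) = θ (((φ j).toAdd * C).trace) := by
  have hs : φ.rangeRestrict.ker ≤ κ.ker := by rwa [MonoidHom.ker_rangeRestrict]
  let κ' : φ.range →* ℂˣ :=
    MonoidHom.liftOfSurjective φ.rangeRestrict φ.rangeRestrict_surjective ⟨κ, hs⟩
  have hκ' : ∀ j, κ' (φ.rangeRestrict j) = κ j := fun j =>
    MonoidHom.liftOfRightInverse_comp_apply _ _ _ ⟨κ, hs⟩ j
  have : NeZero (Monoid.exponent (Multiplicative (Matrix (Fin n) (Fin n) R))) :=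
    ⟨Monoid.exponent_ne_zero_of_finite⟩
  -- The character descends to the image of `φ`, and characters of a subgroup of a finite abelian
  -- group extend to the whole group.
  obtain ⟨η, hη⟩ := MonoidHom.domRestrict_surjective ℂ φ.range κ'
  let η' : AddChar (Matrix (Fin n) (Fin n) R) ℂ :=
    AddChar.toMonoidHomEquiv.symm ((Units.coeHom ℂ).comp η)
  obtain ⟨C, hC⟩ := matrixChar_surjective hθ η'
  refine ⟨C, fun j => ?_⟩
  rw [← matrixChar_apply, hC, ← hκ' j, ← hη]
  rfl

end Duality

/-! ### Cyclic vectors and matrices commuting with `B`. -/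

section Krylov

variable {R : Type*} [CommRing R] {π : R} {r l l' n : ℕ}

/-- The matrix with columns `v, B v, …, B ^ (n - 1) v`. -/
def krylov (B : Matrix (Fin n) (Fin n) R) (v : Fin n → R) : Matrix (Fin n) (Fin n) R :=
  Matrix.of fun a i => ((B ^ (i : ℕ)).mulVec v) a

theorem krylov_mulVec (B : Matrix (Fin n) (Fin n) R) (v c : Fin n → R) :
    (krylov B v).mulVec c = (∑ i, c i • B ^ (i : ℕ)).mulVec v := by
  ext a
  rw [Matrix.sum_mulVec, Finset.sum_apply]
  simp only [Matrix.mulVec, dotProduct, krylov, Matrix.of_apply, Matrix.smul_apply, smul_eq_mul,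
    Finset.sum_mul]
  refine Finset.sum_congr rfl fun i _ => Finset.sum_congr rfl fun j _ => by ring

theorem exists_mulVec_eq {B : Matrix (Fin n) (Fin n) R} {v : Fin n → R}
    (hv : IsUnit (krylov B v).det) (w : Fin n → R) :
    ∃ c : Fin n → R, (∑ i, c i • B ^ (i : ℕ)).mulVec v = w := by
  refine ⟨(krylov B v)⁻¹.mulVec w, ?_⟩
  rw [← krylov_mulVec, Matrix.mulVec_mulVec, Matrix.mul_nonsing_inv _ hv, Matrix.one_mulVec]

theorem mul_krylov {A B : Matrix (Fin n) (Fin n) R} (hAB : A * B = B * A) (v : Fin n → R)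
    (hA : A.mulVec v = 0) : A * krylov B v = 0 := by
  ext a i
  have h1 : (A * B ^ (i : ℕ)).mulVec v = 0 := by
    rw [(Commute.pow_right (show Commute A B from hAB) _).eq, ← Matrix.mulVec_mulVec, hA,
      Matrix.mulVec_zero]
  rw [← Matrix.mulVec_mulVec] at h1
  exact congrFun h1 a

/-- A matrix commuting with `B` is determined by its value on a cyclic vector. -/
theorem eq_zero_of_mulVec_eq_zero {A B : Matrix (Fin n) (Fin n) R} {v : Fin n → R}
    (hv : IsUnit (krylov B v).det) (hAB : A * B = B * A) (hA : A.mulVec v = 0) : A = 0 := by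
  have h := mul_krylov hAB v hA
  have := congrArg (· * (krylov B v)⁻¹) h
  simpa [mul_assoc, Matrix.mul_nonsing_inv _ hv] using this

theorem sum_pow_mem_adjoin (B : Matrix (Fin n) (Fin n) R) (c : Fin n → R) :
    ∑ i, c i • B ^ (i : ℕ) ∈ Algebra.adjoin R {B} :=
  Subalgebra.sum_mem _ fun _ _ => Subalgebra.smul_mem _
    (Subalgebra.pow_mem _ (Algebra.self_mem_adjoin_singleton R B) _) _

theorem commute_of_mem_adjoin {B P : Matrix (Fin n) (Fin n) R} (hP : P ∈ Algebra.adjoin R {B}) :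
    P * B = B * P :=
  (Algebra.commute_of_mem_adjoin_self hP).symm.eq

/-- A matrix commuting with `B` modulo the annihilator of `s` is a polynomial in `B` modulo the
annihilator of `s`. -/
theorem exists_sum_pow_of_commute {B : Matrix (Fin n) (Fin n) R} {v : Fin n → R}
    (hv : IsUnit (krylov B v).det) {s : R} {g : Matrix (Fin n) (Fin n) R}
    (hg : s • (g * B - B * g) = 0) :
    ∃ c : Fin n → R, s • (g - ∑ i, c i • B ^ (i : ℕ)) = 0 := by
  obtain ⟨c, hc⟩ := exists_mulVec_eq hv (g.mulVec v)
  refine ⟨c, eq_zero_of_mulVec_eq_zero hv ?_ ?_⟩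
  · have h1 := commute_of_mem_adjoin (sum_pow_mem_adjoin B c)
    rw [Matrix.smul_mul, Matrix.mul_smul, sub_mul, mul_sub, h1, ← sub_eq_zero, ← smul_sub,
      sub_sub_sub_cancel_right, hg]
  · rw [Matrix.smul_mulVec, Matrix.sub_mulVec, hc, sub_self, smul_zero]

theorem mul_comm_of_commute {B : Matrix (Fin n) (Fin n) R} {v : Fin n → R}
    (hv : IsUnit (krylov B v).det) {g h : Matrix (Fin n) (Fin n) R}
    (hg : g * B = B * g) (hh : h * B = B * h) : g * h = h * g := by
  obtain ⟨c, hc⟩ := exists_sum_pow_of_commute hv (s := 1) (g := g) (by rw [hg, sub_self, smul_zero])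
  rw [one_smul, sub_eq_zero] at hc
  rw [hc, Finset.sum_mul, Finset.mul_sum]
  refine Finset.sum_congr rfl fun i _ => ?_
  rw [Matrix.smul_mul, Matrix.mul_smul, (Commute.pow_right (show Commute h B from hh) _).eq]

/-- The Krylov determinant does not change modulo the nilpotent `π`. Cyclicity therefore survives
the passage from `B` to `B'`. -/
theorem isUnit_det_krylov_add (hπ : IsNilpotent π) {B : Matrix (Fin n) (Fin n) R} {v : Fin n → R}
    (hv : IsUnit (krylov B v).det) (Z : Matrix (Fin n) (Fin n) R) :
    IsUnit (krylov (B + π • Z) v).det := by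
  have h1 : (Ideal.Quotient.mk (Ideal.span {π})) (krylov (B + π • Z) v).det =
      (Ideal.Quotient.mk (Ideal.span {π})) (krylov B v).det := by
    rw [RingHom.map_det, RingHom.map_det]
    congr 1
    have hmap : (Ideal.Quotient.mk (Ideal.span {π})).mapMatrix (B + π • Z) =
        (Ideal.Quotient.mk (Ideal.span {π})).mapMatrix B := by
      ext a b
      have hπ0 : (Ideal.Quotient.mk (Ideal.span {π})) π = 0 :=
        Ideal.Quotient.eq_zero_iff_mem.2 (Ideal.mem_span_singleton_self π)
      simp [hπ0]
    ext a i
    simp only [RingHom.mapMatrix_apply, Matrix.map_apply, krylov, Matrix.of_apply]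
    rw [RingHom.map_mulVec, RingHom.map_mulVec, ← RingHom.mapMatrix_apply,
      ← RingHom.mapMatrix_apply, map_pow, map_pow, hmap]
  rw [Ideal.Quotient.mk_eq_mk_iff_sub_mem, Ideal.mem_span_singleton] at h1
  obtain ⟨z, hz⟩ := h1
  rw [eq_add_of_sub_eq' hz]
  exact IsNilpotent.isUnit_add_left_of_commute ((Commute.all _ _).isNilpotent_mul_right hπ) hv
    (Commute.all _ _)

/-- The stabilizer is the product of the centralizer and of a congruence subgroup. -/
theorem exists_centralizer_mul (hπ : IsTruncatedDVR π r) [Finite R] (hr : r = l + l')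
    (hl' : 1 ≤ l') (hn : IsUnit (n : R)) {B : Matrix (Fin n) (Fin n) R} {v : Fin n → R}
    (hv : IsUnit (krylov B v).det) {g : Matrix.SpecialLinearGroup (Fin n) R}
    (hg : g ∈ centSubgroup (π ^ l) B) :
    ∃ t ∈ centSubgroup (1 : R) B, ∃ h ∈ congSubgroup n (π ^ l), g = t * h := by
  obtain ⟨c, hc⟩ := exists_sum_pow_of_commute hv hg
  set P := ∑ i, c i • B ^ (i : ℕ) with hP
  have hPB : P * B = B * P := commute_of_mem_adjoin (sum_pow_mem_adjoin B c)
  obtain ⟨Z, hZ⟩ := hπ.exists_eq_smul (by omega : l' + l = r) hc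
  have hPg : P = g.val * (1 + π ^ l' • (-((g⁻¹).val * Z))) := by
    rw [mul_add, mul_one, Matrix.mul_smul, mul_neg, ← mul_assoc, val_mul_inv, one_mul, smul_neg,
      ← hZ]
    abel
  have hπn : IsNilpotent π := ⟨r, hπ.pow_eq_zero⟩
  have hdet : P.det = (1 + π ^ l' • (-((g⁻¹).val * Z))).det := by
    rw [hPg, Matrix.det_mul, g.2, one_mul]
  have hunit : IsUnit P.det := by
    rw [hdet]
    exact isUnit_det_one_add_smul (hπn.pow_of_pos (by omega)) _
  obtain ⟨u, hu⟩ := hunit.exists_left_inv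
  have hdvd : π ^ l' ∣ P.det - 1 := by
    rw [hdet, Matrix.det_one_add_smul, add_assoc, add_sub_cancel_left, pow_two, ← mul_assoc,
      ← add_mul]
    exact dvd_mul_left _ _
  have hu1 : π ^ l' ∣ u - 1 := by
    have : u - 1 = -(u * (P.det - 1)) := by linear_combination hu
    rw [this]
    exact (hdvd.mul_left u).neg_right
  -- `P` commutes with `B` and is congruent to `g` mod `π^l'`, but its determinant is only congruent
  -- to 1. Scaling by an `n`-th root of the inverse determinant corrects this; the root is congruent
  -- to 1 mod `π^l'`, so the congruence with `g` survives.
  obtain ⟨k, hk, hk1⟩ := exists_pow_eq_of_dvd_sub_one hπn hn hl' hu1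
  obtain ⟨t, ht⟩ : ∃ t : Matrix.SpecialLinearGroup (Fin n) R, t.val = k • P :=
    ⟨⟨k • P, by rw [Matrix.det_smul, Fintype.card_fin, hk, hu]⟩, rfl⟩
  have hkP : π ^ l • (k • P) = π ^ l • P := by
    obtain ⟨z, hz⟩ := hk1
    have : π ^ l * k = π ^ l := by
      have h0 : π ^ l * π ^ l' = 0 := by rw [← pow_add, hπ.pow_eq_zero_of_le hr.le]
      linear_combination π ^ l * hz + z * h0
    rw [smul_smul, this]
  refine ⟨t, ?_, t⁻¹ * g, ?_, by group⟩
  · rw [mem_centSubgroup, ht, one_smul, Matrix.smul_mul, Matrix.mul_smul, hPB, sub_self]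
  · rw [mem_congSubgroup]
    have e : (t⁻¹ * g).val - 1 = (t⁻¹).val * (g.val - t.val) := by
      rw [mul_sub, val_inv_mul]
      simp
    rw [e, ← Matrix.mul_smul, smul_sub, ht, hkP, ← smul_sub, hc, mul_zero]

end Krylov

/-! ### Extensions of the character to `J` and the centralizers fixing them. -/

section ExtendedCharacters

variable {R : Type*} [CommRing R] {π : R} {r l l' n : ℕ}

/-- Every extension to the subgroup `J` of the character attached to `B` has the form
`j ↦ θ(tr(log(j) (B + π ^ l' C)))`. -/
theorem exists_extension_eq [Finite R] (hπ : IsTruncatedDVR π r) (hr : r = l + l')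
    (hl2 : l ≤ 2 * l') {θ : AddChar R ℂ} (hθ : ∀ x, (∀ y, θ (y * x) = 1) → x = 0)
    {c : R} (hc : 2 * c = 1) (B : Matrix (Fin n) (Fin n) R)
    (χ : Matrix.SpecialLinearGroup (Fin n) R → ℂ)
    (hχ : ∀ a ∈ radSubgroup (π ^ l) (π ^ l') B, ∀ b ∈ radSubgroup (π ^ l) (π ^ l') B,
      χ (a * b) = χ a * χ b)
    (hχN : ∀ x ∈ congSubgroup n (π ^ l'), χ x = traceCharSL θ B x) :
    ∃ C : Matrix (Fin n) (Fin n) R, ∀ j ∈ radSubgroup (π ^ l) (π ^ l') B,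
      χ j = θ ((truncLog c j.val * (B + π ^ l' • C)).trace) := by
  set J := radSubgroup (π ^ l) (π ^ l') B with hJ
  -- One extension is `j ↦ θ(tr(log(j) B))`: the commutator term of the logarithm pairs to zero with
  -- `B` because `b` commutes with `B` modulo `π^l`.
  have hlog : ∀ a ∈ J, ∀ b ∈ J, θ ((truncLog c (a * b).val * B).trace) =
      θ ((truncLog c a.val * B).trace) * θ ((truncLog c b.val * B).trace) := by
    intro a ha b hb
    rw [Matrix.SpecialLinearGroup.coe_mul, truncLog_mul hc
      (hπ.mul_mul_eq_zero hr hl2 ha.1 ha.1 hb.1) (hπ.mul_mul_eq_zero hr hl2 hb.1 ha.1 hb.1)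
      (hπ.mul_mul_eq_zero hr hl2 ha.1 hb.1 ha.1) (hπ.mul_mul_eq_zero hr hl2 ha.1 hb.1 hb.1),
      add_mul, add_mul, Matrix.smul_mul, Matrix.trace_add, Matrix.trace_add, Matrix.trace_smul,
      trace_commutator_mul, sub_one_mul_sub_mul_sub_one,
      (hπ.mul_eq_zero_of_smul hr hb.2 ha.1).2, Matrix.trace_zero, smul_zero, add_zero,
      AddChar.map_add_eq_mul]
  let κ₀ : J →* ℂ :=
    { toFun := fun j => χ j * (θ ((truncLog c j.1.val * B).trace))⁻¹
      map_one' := by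
        have h1 := hχN 1 (Subgroup.one_mem _)
        simp only [Subgroup.coe_one, h1, traceCharSL]
        simp [truncLog]
      map_mul' := by
        intro a b
        simp only [Subgroup.coe_mul]
        rw [hχ a a.2 b b.2, hlog a a.2 b b.2, mul_inv]
        ring }
  -- The ratio of two extensions is trivial on `N`, which is the kernel of this map; the map is
  -- additive because products of two elements `j - 1` are killed by `π^l'`.
  let φ : J →* Multiplicative (Matrix (Fin n) (Fin n) R) :=
    { toFun := fun j => Multiplicative.ofAdd (π ^ l' • (j.1.val - 1))
      map_one' := by simp
      map_mul' := by
        intro a b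
        rw [← ofAdd_add, ← smul_add]
        congr 1
        have e : (a * b).1.val - 1 = (a.1.val - 1) + (b.1.val - 1) +
            (a.1.val - 1) * (b.1.val - 1) := by
          rw [Subgroup.coe_mul, Matrix.SpecialLinearGroup.coe_mul]; noncomm_ring
        rw [e, smul_add _ (_ + _), hπ.smul_mul_eq_zero hr hl2 a.2.1 b.2.1, add_zero] }
  obtain ⟨C, hC⟩ := exists_matrix_of_character hθ φ κ₀.toHomUnits (by
    intro j hj
    rw [MonoidHom.mem_ker] at hj ⊢
    have hjN : j.1 ∈ congSubgroup n (π ^ l') := hj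
    ext
    change χ j * (θ ((truncLog c j.1.val * B).trace))⁻¹ = 1
    have h2 : truncLog c j.1.val = j.1.val - 1 := by
      rw [truncLog, pow_two, (hπ.mul_eq_zero_of_smul hr hjN j.2.1).1, smul_zero, sub_zero]
    rw [hχN _ hjN, h2, traceCharSL, mul_inv_cancel₀ (addChar_ne_zero θ _)])
  refine ⟨C, fun j hj => ?_⟩
  have h1 := hC ⟨j, hj⟩
  change χ j * (θ ((truncLog c j.val * B).trace))⁻¹ =
    θ (((π ^ l' • (j.val - 1)) * C).trace) at h1
  have h2 : π ^ l' • (j.val - 1) = π ^ l' • truncLog c j.val := by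
    rw [truncLog, smul_sub _ (_ - _), smul_comm (π ^ l') c, pow_two,
      hπ.smul_mul_eq_zero hr hl2 hj.1 hj.1, smul_zero, sub_zero]
  rw [mul_inv_eq_iff_eq_mul₀ (addChar_ne_zero θ _)] at h1
  rw [h1, h2, mul_add, Matrix.trace_add, AddChar.map_add_eq_mul, mul_comm, Matrix.smul_mul,
    Matrix.mul_smul]

theorem centSubgroup_add_smul {s t : R} (hst : s * t = 0) (B C : Matrix (Fin n) (Fin n) R) :
    centSubgroup s (B + t • C) = centSubgroup s B := by
  ext g
  rw [mem_centSubgroup, mem_centSubgroup]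
  have e : s • (g.val * (B + t • C) - (B + t • C) * g.val) = s • (g.val * B - B * g.val) := by
    have : g.val * (B + t • C) - (B + t • C) * g.val =
        (g.val * B - B * g.val) + t • (g.val * C - C * g.val) := by
      simp only [mul_add, add_mul, Matrix.smul_mul, Matrix.mul_smul, smul_sub]
      abel
    rw [this, smul_add, smul_smul, hst, zero_smul, add_zero]
  rw [e]

theorem truncLog_conj (c : R) (g x : Matrix.SpecialLinearGroup (Fin n) R) :
    truncLog c (g⁻¹ * x * g).val = (g⁻¹).val * truncLog c x.val * g.val := by
  have e : (g⁻¹ * x * g).val - 1 = (g⁻¹).val * (x.val - 1) * g.val := by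
    rw [mul_sub, sub_mul, mul_one, val_inv_mul]
    simp
  have e2 : ((g⁻¹).val * (x.val - 1) * g.val) ^ 2 = (g⁻¹).val * (x.val - 1) ^ 2 * g.val := by
    have : ((g⁻¹).val * (x.val - 1) * g.val) ^ 2 =
      (g⁻¹).val * (x.val - 1) * (g.val * (g⁻¹).val) * (x.val - 1) * g.val := by noncomm_ring
    rw [this, val_mul_inv]
    noncomm_ring
  unfold truncLog
  rw [e, e2, mul_sub _ (_ - _), sub_mul (_ * _), Matrix.mul_smul, Matrix.smul_mul]

theorem trace_truncLog_conj_mul (c : R) {B : Matrix (Fin n) (Fin n) R}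
    {t : Matrix.SpecialLinearGroup (Fin n) R} (ht : t ∈ centSubgroup (1 : R) B)
    (x : Matrix.SpecialLinearGroup (Fin n) R) :
    (truncLog c (t⁻¹ * x * t).val * B).trace = (truncLog c x.val * B).trace := by
  rw [mem_centSubgroup, one_smul, sub_eq_zero] at ht
  rw [truncLog_conj, mul_assoc, ht, mul_assoc, Matrix.trace_mul_comm, mul_assoc, mul_assoc,
    val_mul_inv, mul_one]

/-- `T` is the exact centralizer of `B' = B + π^l' C`, where `χ(j) = θ(tr(log(j) B'))`. Replacing
`B` by `B'` changes neither `Γ` nor `J`, and keeps a cyclic vector. So `T` is commutative, it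
complements `H` in `Γ` up to intersection, and it visibly preserves `χ`. -/
theorem exists_stabilizing_centralizer [Finite R] (hπ : IsTruncatedDVR π r) (hr : r = l + l')
    (hl : l' ≤ l) (hl2 : l ≤ l' + 1) (hl' : 1 ≤ l') {θ : AddChar R ℂ}
    (hθ : ∀ x, (∀ y, θ (y * x) = 1) → x = 0) (hn : IsUnit (n : R)) {c : R} (hc : 2 * c = 1)
    {B : Matrix (Fin n) (Fin n) R} {v : Fin n → R} (hv : IsUnit (krylov B v).det)
    (χ : Matrix.SpecialLinearGroup (Fin n) R → ℂ)
    (hχ : ∀ a ∈ radSubgroup (π ^ l) (π ^ l') B, ∀ b ∈ radSubgroup (π ^ l) (π ^ l') B,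
      χ (a * b) = χ a * χ b)
    (hχN : ∀ x ∈ congSubgroup n (π ^ l'), χ x = traceCharSL θ B x) :
    ∃ T : Subgroup (Matrix.SpecialLinearGroup (Fin n) R), T ≤ centSubgroup (π ^ l) B ∧
      (∀ s ∈ T, ∀ t ∈ T, s * t = t * s) ∧
      (∀ g ∈ centSubgroup (π ^ l) B, ∃ t ∈ T, ∃ h ∈ congSubgroup n (π ^ l), g = t * h) ∧
      (∀ t ∈ T, ∀ j ∈ radSubgroup (π ^ l) (π ^ l') B,
        t⁻¹ * j * t ∈ radSubgroup (π ^ l) (π ^ l') B ∧ χ (t⁻¹ * j * t) = χ j) ∧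
      (∀ t ∈ T, ∀ h ∈ congSubgroup n (π ^ l),
        h * t * h⁻¹ * t⁻¹ ∈ radSubgroup (π ^ l) (π ^ l') B → χ (h * t * h⁻¹ * t⁻¹) = 1) := by
  have hl3 : l ≤ 2 * l' := by omega
  obtain ⟨C, hC⟩ := exists_extension_eq hπ hr hl3 hθ hc B χ hχ hχN
  set B' := B + π ^ l' • C with hB'
  have hv' : IsUnit (krylov B' v).det := by
    have : B' = B + π • (π ^ (l' - 1) • C) := by
      rw [hB', smul_smul, ← pow_succ', Nat.sub_add_cancel hl']
    rw [this]
    exact isUnit_det_krylov_add ⟨r, hπ.pow_eq_zero⟩ hv _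
  have hΓ : centSubgroup (π ^ l) B' = centSubgroup (π ^ l) B :=
    centSubgroup_add_smul (by rw [← pow_add, hπ.pow_eq_zero_of_le hr.le]) B C
  have hJ' : ∀ h ∈ congSubgroup n (π ^ l),
      π ^ l' • (h.val * B' - B' * h.val) = π ^ l' • (h.val * B - B * h.val) := by
    intro h hh
    have e1 : h.val * B' - B' * h.val = (h.val * B - B * h.val) +
        π ^ l' • ((h.val - 1) * C - C * (h.val - 1)) := by
      rw [hB', sub_one_mul_sub_mul_sub_one]
      simp only [mul_add, add_mul, Matrix.smul_mul, Matrix.mul_smul, smul_sub]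
      abel
    obtain ⟨X, hX⟩ := hπ.exists_eq_smul (by omega : l' + l = r) hh
    rw [e1, hX, smul_add, Matrix.smul_mul, Matrix.mul_smul, ← smul_sub, smul_smul, smul_smul,
      ← pow_add, ← pow_add, hπ.pow_eq_zero_of_le (by omega : r ≤ l' + l' + l'), zero_smul, add_zero]
  have hmemJ : ∀ h, h ∈ radSubgroup (π ^ l) (π ^ l') B ↔
      h ∈ congSubgroup n (π ^ l) ∧ π ^ l' • (h.val * B' - B' * h.val) = 0 := by
    intro h
    constructor
    · intro hh
      exact ⟨hh.1, by rw [hJ' h hh.1]; exact hh.2⟩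
    · rintro ⟨h1, h2⟩
      exact ⟨h1, by rw [hJ' h h1] at h2; exact h2⟩
  have hTΓ : centSubgroup (1 : R) B' ≤ centSubgroup (π ^ l) B := by
    rw [← hΓ]
    intro t ht
    rw [mem_centSubgroup, one_smul] at ht
    rw [mem_centSubgroup, ht, smul_zero]
  refine ⟨centSubgroup (1 : R) B', hTΓ, ?_, ?_, ?_, ?_⟩
  · intro s hs t ht
    rw [mem_centSubgroup, one_smul, sub_eq_zero] at hs ht
    exact Subtype.ext (mul_comm_of_commute hv' hs ht)
  · intro g hg
    rw [← hΓ] at hg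
    exact exists_centralizer_mul hπ hr hl' hn hv' hg
  · intro t ht j hj
    have htj : t⁻¹ * j * t ∈ radSubgroup (π ^ l) (π ^ l') B := by
      rw [hmemJ] at hj ⊢
      refine ⟨by simpa using (congSubgroup_normal (π ^ l)).conj_mem j hj.1 t⁻¹, ?_⟩
      have hjc : j ∈ centSubgroup (π ^ l') B' := hj.2
      have htc : t ∈ centSubgroup (π ^ l') B' := by
        rw [mem_centSubgroup, one_smul] at ht
        rw [mem_centSubgroup, ht, smul_zero]
      exact Subgroup.mul_mem _ (Subgroup.mul_mem _ (Subgroup.inv_mem _ htc) hjc) htc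
    exact ⟨htj, by rw [hC _ htj, hC _ hj, trace_truncLog_conj_mul c ht]⟩
  · intro t ht h hh hJ
    rw [hC _ hJ]
    have hk : t * h⁻¹ * t⁻¹ ∈ congSubgroup n (π ^ l) :=
      (congSubgroup_normal (π ^ l)).conj_mem _ (Subgroup.inv_mem _ hh) t
    obtain ⟨k, rfl⟩ : ∃ k, k = t * h⁻¹ * t⁻¹ := ⟨_, rfl⟩
    set k := t * h⁻¹ * t⁻¹ with hkdef
    have e : h * t * h⁻¹ * t⁻¹ = h * k := by rw [hkdef]; group
    rw [e] at hJ ⊢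
    -- The commutator is `h k` with `k` the conjugate of `h⁻¹` by `t`. As `t` commutes with `B'`,
    -- the logarithms of `h` and `k` pair oppositely with `B'`.
    have hkB : (truncLog c k.val * B').trace = -(truncLog c h.val * B').trace := by
      have h1 := trace_truncLog_conj_mul c (Subgroup.inv_mem _ ht) h⁻¹
      rw [inv_inv] at h1
      rw [h1, truncLog_inv hc (val_inv_mul h) (pow_truncLog_cube hπ hr hl3 hh), Matrix.neg_mul,
        Matrix.trace_neg]
    -- The remaining second-order term may be written with `h k` in place of `k`, as triple products
    -- vanish. Since `h k` lies in the radical `J`, that term pairs to zero.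
    have hcomm : (h.val - 1) * (k.val - 1) - (k.val - 1) * (h.val - 1) =
        (h.val - 1) * ((h * k).val - 1) - ((h * k).val - 1) * (h.val - 1) := by
      have e2 : (h * k).val - 1 = (h.val - 1) + (k.val - 1) + (h.val - 1) * (k.val - 1) := by
        rw [Matrix.SpecialLinearGroup.coe_mul]; noncomm_ring
      have e3 := hπ.mul_mul_eq_zero hr hl3 hh hh hk
      have e4 := hπ.mul_mul_eq_zero hr hl3 hh hk hh
      rw [e2, mul_add, add_mul, e4, ← mul_assoc, e3]
      noncomm_ring
    rw [Matrix.SpecialLinearGroup.coe_mul, truncLog_mul hc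
      (hπ.mul_mul_eq_zero hr hl3 hh hh hk) (hπ.mul_mul_eq_zero hr hl3 hk hh hk)
      (hπ.mul_mul_eq_zero hr hl3 hh hk hh) (hπ.mul_mul_eq_zero hr hl3 hh hk hk), hcomm,
      add_mul, add_mul, Matrix.smul_mul, Matrix.trace_add, Matrix.trace_add, Matrix.trace_smul,
      trace_commutator_mul, sub_one_mul_sub_mul_sub_one, hkB]
    rw [hmemJ] at hJ
    rw [(hπ.mul_eq_zero_of_smul hr hJ.2 hh).2]
    simp

end ExtendedCharacters

/-! ### Application of the Heisenberg argument to `N`, `J`, `H` and `Γ`. -/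

section MatrixDimension

variable {R : Type*} [CommRing R] {π : R} {r l l' n : ℕ}

theorem dimension_of_traceCharSL [Finite R] (hπ : IsTruncatedDVR π r) (hr : r = l + l')
    (hl : l' ≤ l) (hl2 : l ≤ l' + 1) (hl' : 1 ≤ l') {θ : AddChar R ℂ}
    (hθ : ∀ x, (∀ y, θ (y * x) = 1) → x = 0) (hn : IsUnit (n : R)) {c : R} (hc : 2 * c = 1)
    {B : Matrix (Fin n) (Fin n) R} {v : Fin n → R} (hv : IsUnit (krylov B v).det)
    {V : Type*} [AddCommGroup V] [Module ℂ V]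
    {ρ : Representation ℂ (Matrix.SpecialLinearGroup (Fin n) R) V} (hρ : ρ.IsIrreducible)
    (hne : ∃ v : V, v ≠ 0 ∧ ∀ x ∈ congSubgroup n (π ^ l'), ρ x v = traceCharSL θ B x • v) :
    ∃ d : ℕ, Nat.card (centSubgroup (π ^ l) B) * Module.finrank ℂ V =
        Nat.card (Matrix.SpecialLinearGroup (Fin n) R) * d ∧
      Nat.card (radSubgroup (π ^ l) (π ^ l') B) * d ^ 2 = Nat.card (congSubgroup n (π ^ l)) := by
  have hl3 : l ≤ 2 * l' := by omega
  have hN : congSubgroup n (π ^ l') ≤ congSubgroup n (π ^ l) :=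
    congSubgroup_mono (pow_dvd_pow π hl)
  have : Finite (Matrix.SpecialLinearGroup (Fin n) R) := Subtype.finite
  refine dimension_of_heisenberg hρ (congSubgroup n (π ^ l')) _ _ _ ?_ inf_le_left
    (congSubgroup_le_centSubgroup _ B) (congSubgroup_normal _) (congSubgroup_normal _)
    (traceCharSL θ B) (fun _ _ => addChar_ne_zero θ _)
    (fun x hx y hy => traceCharSL_mul hπ hr hl θ B hx hy)
    (mem_centSubgroup_iff_stabilizer hπ hr hl hθ hn B) hne ?_ ?_ ?_
  · exact fun x hx => ⟨hN hx, congSubgroup_le_centSubgroup _ B hx⟩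
  · intro h hh j hj
    exact ⟨commutator_mem hπ hr hl3 hh hj.1,
      traceCharSL_commutator_eq_one hπ hr hl3 θ B hh hj⟩
  · intro h hh hhJ
    obtain ⟨g, hg, hgh⟩ := exists_traceCharSL_commutator_ne_one hπ hr hl3 hθ hn hc B hh hhJ
    exact ⟨g, hg, commutator_mem hπ hr hl3 hg hh, hgh⟩
  · exact exists_stabilizing_centralizer hπ hr hl hl2 hl' hθ hn hc hv

end MatrixDimension

/-! ### Orders of annihilators, commutants and congruence subgroups. -/

section Counting

theorem card_eq_card_ker_mul_card {A B : Type*} [AddGroup A] [AddGroup B] (f : A →+ B)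
    (hf : Function.Surjective f) : Nat.card A = Nat.card f.ker * Nat.card B := by
  rw [← AddSubgroup.card_mul_index f.ker, AddSubgroup.index_ker,
    AddMonoidHom.range_eq_top.2 hf, Nat.card_congr AddSubgroup.topEquiv.toEquiv]

theorem card_preimage {A B : Type*} [AddGroup A] [AddGroup B] (f : A →+ B)
    (hf : Function.Surjective f) (p : B → Prop) :
    Nat.card {a // p (f a)} = Nat.card {b // p b} * Nat.card f.ker := by
  rw [← Nat.card_prod]
  let s := Function.surjInv hf
  have hs : ∀ b, f (s b) = b := Function.surjInv_eq hf
  exact Nat.card_congr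
    { toFun := fun a => (⟨f a, a.2⟩, ⟨a - s (f a), by
        rw [AddMonoidHom.mem_ker, map_sub, hs, sub_self]⟩)
      invFun := fun x => ⟨x.2 + s x.1, by
        have := x.2.2
        rw [AddMonoidHom.mem_ker] at this
        rw [map_add, this, zero_add, hs]
        exact x.1.2⟩
      left_inv := fun a => Subtype.ext (sub_add_cancel _ _)
      right_inv := fun x => by
        have h1 := x.2.2
        rw [AddMonoidHom.mem_ker] at h1
        have h2 : f (x.2 + s x.1) = x.1 := by rw [map_add, h1, zero_add, hs]
        ext
        · exact h2
        · simp only [h2, add_sub_cancel_right] }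

theorem card_eq_card_ker_mul_card_range {A B : Type*} [Group A] [Group B] (f : A →* B) :
    Nat.card A = Nat.card f.ker * Nat.card f.range := by
  rw [← Subgroup.card_mul_index f.ker, Subgroup.index_ker]

theorem card_matrix_subtype {n : ℕ} {α : Type*} (p : α → Prop) :
    Nat.card {Z : Matrix (Fin n) (Fin n) α // ∀ i j, p (Z i j)} = Nat.card {x // p x} ^ (n * n) := by
  rw [Nat.card_congr (show {Z : Matrix (Fin n) (Fin n) α // ∀ i j, p (Z i j)} ≃
    (Fin n → Fin n → {x // p x}) from
    { toFun := fun Z i j => ⟨Z.1 i j, Z.2 i j⟩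
      invFun := fun f => ⟨Matrix.of fun i j => (f i j).1, fun i j => (f i j).2⟩
      left_inv := fun _ => rfl
      right_inv := fun _ => rfl })]
  simp [Nat.card_fun, pow_mul]

theorem card_vector_subtype {n : ℕ} {α : Type*} (p : α → Prop) :
    Nat.card {c : Fin n → α // ∀ i, p (c i)} = Nat.card {x // p x} ^ n := by
  rw [Nat.card_congr (Equiv.subtypePiEquivPi (p := fun _ : Fin n => p))]
  simp [Nat.card_fun]

variable {R : Type*} [CommRing R] {π : R} {r l l' n q : ℕ}

/-- Multiplication by `π` maps the annihilator of `π^(i+1)` onto that of `π^i`, with kernel the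
annihilator of `π`. So the orders are powers of a single number, identified as `q` by the case `i =
r`. -/
theorem IsTruncatedDVR.card_annihilator [Finite R] (hπ : IsTruncatedDVR π r) (hr : r ≠ 0)
    (hq : Nat.card R = q ^ r) {i : ℕ} (hi : i ≤ r) :
    Nat.card {x : R // π ^ i * x = 0} = q ^ i := by
  have hstep : ∀ i, i + 1 ≤ r → Nat.card {x : R // π ^ (i + 1) * x = 0} =
      Nat.card {x : R // π ^ 1 * x = 0} * Nat.card {x : R // π ^ i * x = 0} := by
    intro i hi
    let A := (AddMonoidHom.mulLeft (π ^ (i + 1))).ker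
    let B := (AddMonoidHom.mulLeft (π ^ i)).ker
    let f : A →+ B := ((AddMonoidHom.mulLeft π).comp A.subtype).codRestrict B (by
      rintro ⟨x, hx⟩
      have hx : π ^ (i + 1) * x = 0 := hx
      change π ^ i * (π * x) = 0
      rw [← mul_assoc, ← pow_succ, hx])
    have hf : Function.Surjective f := by
      rintro ⟨y, hy⟩
      obtain ⟨z, hz⟩ := hπ.dvd_of_mul_eq_zero (r - i) i (by omega) y hy
      have hy : π ^ i * y = 0 := hy
      refine ⟨⟨π ^ (r - i - 1) * z, ?_⟩, ?_⟩
      · change π ^ (i + 1) * (π ^ (r - i - 1) * z) = 0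
        rw [← mul_assoc, ← pow_add, hπ.pow_eq_zero_of_le (by omega), zero_mul]
      · refine Subtype.ext ?_
        change π * (π ^ (r - i - 1) * z) = y
        rw [hz, ← mul_assoc, ← pow_succ', show r - i - 1 + 1 = r - i by omega]
    have h1 := card_eq_card_ker_mul_card f hf
    have h2 : Nat.card f.ker = Nat.card {x : R // π ^ 1 * x = 0} := Nat.card_congr
      { toFun := fun x => ⟨x.1.1, by
          have h := congrArg Subtype.val x.2
          rw [pow_one]; exact h⟩
        invFun := fun x => ⟨⟨x.1, by
          change π ^ (i + 1) * x.1 = 0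
          have h : π * x.1 = 0 := by simpa using x.2
          rw [pow_succ, mul_assoc, h, mul_zero]⟩, Subtype.ext (by
            have h : π * x.1 = 0 := by simpa using x.2
            exact h)⟩
        left_inv := fun _ => rfl
        right_inv := fun _ => rfl }
    rw [h2] at h1
    exact h1
  have hpow : ∀ i, i ≤ r → Nat.card {x : R // π ^ i * x = 0} =
      Nat.card {x : R // π ^ 1 * x = 0} ^ i := by
    intro i
    induction i with
    | zero =>
      intro _
      have : Unique {x : R // π ^ 0 * x = 0} :=
        { default := ⟨0, by simp⟩
          uniq := fun x => Subtype.ext (by simpa using x.2) }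
      simp
    | succ i ih =>
      intro hi
      rw [hstep i hi, ih (by omega), pow_succ (Nat.card _) i, mul_comm]
  have hR : Nat.card {x : R // π ^ r * x = 0} = Nat.card R :=
    Nat.card_congr (Equiv.subtypeUnivEquiv fun x => by rw [hπ.pow_eq_zero, zero_mul])
  rw [hpow i hi]
  rw [hpow r le_rfl, hq] at hR
  rw [Nat.pow_left_injective hr hR]

/-- The matrices commuting with `B` modulo the annihilator of `s`. -/
def commSubring (s : R) (B : Matrix (Fin n) (Fin n) R) : Subring (Matrix (Fin n) (Fin n) R) where
  carrier := {X | s • (X * B - B * X) = 0}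
  one_mem' := by simp
  zero_mem' := by simp
  add_mem' := by
    intro X Y hX hY
    simp only [Set.mem_ofPred_eq] at hX hY ⊢
    rw [add_mul, mul_add, add_sub_add_comm, smul_add, hX, hY, add_zero]
  neg_mem' := by
    intro X hX
    simp only [Set.mem_ofPred_eq] at hX ⊢
    rw [neg_mul, mul_neg, ← neg_sub', smul_neg, hX, neg_zero]
  mul_mem' := by
    intro X Y hX hY
    simp only [Set.mem_ofPred_eq] at hX hY ⊢
    have e : X * Y * B - B * (X * Y) = X * (Y * B - B * Y) + (X * B - B * X) * Y := by
      noncomm_ring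
    rw [e, smul_add, ← Matrix.mul_smul, ← Matrix.smul_mul, hX, hY, zero_mul, mul_zero, add_zero]

theorem mem_commSubring {s : R} {B X : Matrix (Fin n) (Fin n) R} :
    X ∈ commSubring s B ↔ s • (X * B - B * X) = 0 := Iff.rfl

theorem sum_pow_mem_commSubring (s : R) (B : Matrix (Fin n) (Fin n) R) (c : Fin n → R) :
    ∑ i, c i • B ^ (i : ℕ) ∈ commSubring s B := by
  rw [mem_commSubring, commute_of_mem_adjoin (sum_pow_mem_adjoin B c), sub_self, smul_zero]

theorem sum_pow_smul_injective {B : Matrix (Fin n) (Fin n) R} {v : Fin n → R}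
    (hv : IsUnit (krylov B v).det) {s : R} {c : Fin n → R}
    (hc : s • ∑ i, c i • B ^ (i : ℕ) = 0) : s • c = 0 := by
  have h1 : (krylov B v).mulVec (s • c) = 0 := by
    rw [Matrix.mulVec_smul, krylov_mulVec, ← Matrix.smul_mulVec, hc, Matrix.zero_mulVec]
  have h2 := congrArg ((krylov B v)⁻¹.mulVec) h1
  rwa [Matrix.mulVec_mulVec, Matrix.nonsing_inv_mul _ hv, Matrix.one_mulVec,
    Matrix.mulVec_zero] at h2

/-- The matrices killed by `s`. -/
def killedBy (n : ℕ) (s : R) : AddSubgroup (Matrix (Fin n) (Fin n) R) :=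
  (smulAddHom R (Matrix (Fin n) (Fin n) R) s).ker

theorem mem_killedBy {s : R} {Z : Matrix (Fin n) (Fin n) R} : Z ∈ killedBy n s ↔ s • Z = 0 :=
  Iff.rfl

theorem killedBy_le_commSubring (s : R) (B : Matrix (Fin n) (Fin n) R) :
    ∀ Z ∈ killedBy n s, Z ∈ commSubring s B := by
  intro Z hZ
  rw [mem_killedBy] at hZ
  rw [mem_commSubring, smul_sub, ← Matrix.smul_mul, hZ, ← Matrix.mul_smul, hZ, zero_mul,
    mul_zero, sub_zero]

/-- The parametrization of `commSubring s B` by polynomials in `B` and matrices killed by `s`. -/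
def polyAddKilled (s : R) (B : Matrix (Fin n) (Fin n) R) :
    (Fin n → R) × killedBy n s →+ commSubring s B where
  toFun x := ⟨∑ i, x.1 i • B ^ (i : ℕ) + x.2, Subring.add_mem _ (sum_pow_mem_commSubring s B _)
    (killedBy_le_commSubring s B _ x.2.2)⟩
  map_zero' := by simp
  map_add' := by
    intro x y
    ext1
    simp only [Prod.fst_add, Prod.snd_add, Pi.add_apply, add_smul, Finset.sum_add_distrib,
      AddSubgroup.coe_add, Subring.coe_add]
    abel

theorem polyAddKilled_surjective {s : R} {B : Matrix (Fin n) (Fin n) R} {v : Fin n → R}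
    (hv : IsUnit (krylov B v).det) : Function.Surjective (polyAddKilled s B) := by
  rintro ⟨X, hX⟩
  obtain ⟨c, hc⟩ := exists_sum_pow_of_commute hv hX
  exact ⟨(c, ⟨_, hc⟩), Subtype.ext (add_sub_cancel _ _)⟩

theorem card_ker_polyAddKilled {s : R} {B : Matrix (Fin n) (Fin n) R} {v : Fin n → R}
    (hv : IsUnit (krylov B v).det) :
    Nat.card (polyAddKilled s B).ker = Nat.card {x : R // s * x = 0} ^ n := by
  rw [← card_vector_subtype]
  have hmem : ∀ x : (polyAddKilled s B).ker,
      ∑ i, x.1.1 i • B ^ (i : ℕ) + (x.1.2 : Matrix (Fin n) (Fin n) R) = 0 := fun x =>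
    congrArg Subtype.val x.2
  exact Nat.card_congr
    { toFun := fun x => ⟨x.1.1, by
        have h1 := hmem x
        have h2 : s • (x.1.2 : Matrix (Fin n) (Fin n) R) = 0 := x.1.2.2
        have h3 := sum_pow_smul_injective hv (s := s) (c := x.1.1) (by
          rw [eq_neg_of_add_eq_zero_left h1, smul_neg, h2, neg_zero])
        exact fun i => congrFun h3 i⟩
      invFun := fun c => ⟨(c.1, ⟨-∑ i, c.1 i • B ^ (i : ℕ), by
        rw [mem_killedBy, smul_neg, Finset.smul_sum, neg_eq_zero]
        refine Finset.sum_eq_zero fun i _ => ?_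
        rw [smul_smul, c.2 i, zero_smul]⟩), Subtype.ext (add_neg_cancel _)⟩
      left_inv := fun x => by
        refine Subtype.ext (Prod.ext rfl (Subtype.ext ?_))
        exact (eq_neg_of_add_eq_zero_right (hmem x)).symm
      right_inv := fun _ => rfl }

theorem card_killedBy (s : R) :
    Nat.card (killedBy n s) = Nat.card {x : R // s * x = 0} ^ (n * n) := by
  rw [← card_matrix_subtype]
  exact Nat.card_congr (Equiv.subtypeEquivRight fun Z => by
    rw [mem_killedBy, ← Matrix.ext_iff]
    rfl)

/-- Each element is a polynomial in `B` plus a matrix killed by `s`; the ambiguity is a coefficient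
vector killed by `s`. -/
theorem card_commSubring {s : R} {B : Matrix (Fin n) (Fin n) R} {v : Fin n → R}
    (hv : IsUnit (krylov B v).det) :
    Nat.card {x : R // s * x = 0} ^ n * Nat.card (commSubring s B) =
      Nat.card R ^ n * Nat.card {x : R // s * x = 0} ^ (n * n) := by
  rw [← card_ker_polyAddKilled hv, ← card_eq_card_ker_mul_card _ (polyAddKilled_surjective hv),
    Nat.card_prod, card_killedBy]
  simp [Nat.card_fun]

theorem isUnit_add_smul_iff (hπ : IsNilpotent π) (P Z : Matrix (Fin n) (Fin n) R) :
    IsUnit (P + π • Z) ↔ IsUnit P := by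
  have key : ∀ P Z : Matrix (Fin n) (Fin n) R, IsUnit P → IsUnit (P + π • Z) := by
    intro P Z hP
    obtain ⟨u, rfl⟩ := hP
    have : (u : Matrix (Fin n) (Fin n) R) + π • Z = u * (1 + π • ((u⁻¹ : (Matrix _ _ R)ˣ) * Z)) := by
      rw [mul_add, mul_one, Matrix.mul_smul, ← mul_assoc, Units.mul_inv, one_mul]
    rw [this]
    exact u.isUnit.mul ((Matrix.isUnit_iff_isUnit_det _).2 (isUnit_det_one_add_smul hπ _))
  refine ⟨fun h => ?_, key P Z⟩
  have := key _ (-Z) h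
  rwa [smul_neg, add_neg_cancel_right] at this

theorem isUnit_commSubring_iff {s : R} {B : Matrix (Fin n) (Fin n) R} (X : commSubring s B) :
    IsUnit X ↔ IsUnit (X : Matrix (Fin n) (Fin n) R) := by
  refine ⟨fun h => h.map (commSubring s B).subtype, fun h => ?_⟩
  obtain ⟨⟨x, y, hxy, hyx⟩, rfl : x = X⟩ := h
  have h1 := X.2
  rw [mem_commSubring] at h1
  have hmem : y ∈ commSubring s B := by
    rw [mem_commSubring]
    have e : y * B - B * y = -(y * (X * B - B * X) * y) := by
      have : y * (X * B - B * X) * y = (y * X) * B * y - y * B * (X * y) := by noncomm_ring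
      rw [this, hxy, hyx]
      noncomm_ring
    rw [e, smul_neg, ← Matrix.smul_mul, ← Matrix.mul_smul, h1, mul_zero, zero_mul, neg_zero]
  exact ⟨⟨X, ⟨y, hmem⟩, Subtype.ext hxy, Subtype.ext hyx⟩, rfl⟩

theorem card_units_eq_card_isUnit (M : Type*) [Monoid M] :
    Nat.card Mˣ = Nat.card {x : M // IsUnit x} :=
  Nat.card_congr
    { toFun := fun u => ⟨u, u.isUnit⟩
      invFun := fun x => x.2.unit
      left_inv := fun _ => Units.ext rfl
      right_inv := fun _ => Subtype.ext rfl }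

/-- A matrix killed by `π^l` is divisible by `π^l'`, which is nilpotent, so only the polynomial part
decides invertibility. -/
theorem card_units_commSubring (hπ : IsTruncatedDVR π r) (hr : r = l + l') (hl' : 1 ≤ l')
    {B : Matrix (Fin n) (Fin n) R} {v : Fin n → R} (hv : IsUnit (krylov B v).det) :
    Nat.card (commSubring (π ^ l) B)ˣ * Nat.card {x : R // π ^ l * x = 0} ^ n =
      Nat.card {c : Fin n → R // IsUnit (∑ i, c i • B ^ (i : ℕ))} *
        Nat.card {x : R // π ^ l * x = 0} ^ (n * n) := by
  rw [← card_ker_polyAddKilled hv, card_units_eq_card_isUnit,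
    ← card_preimage _ (polyAddKilled_surjective hv) IsUnit, ← card_killedBy, ← Nat.card_prod]
  refine Nat.card_congr
    { toFun := fun x => (⟨x.1.1, ?_⟩, x.1.2)
      invFun := fun y => ⟨(y.1.1, y.2), ?_⟩
      left_inv := fun _ => rfl
      right_inv := fun _ => rfl }
  all_goals
    have key : ∀ x : (Fin n → R) × killedBy n (π ^ l),
        IsUnit (polyAddKilled (π ^ l) B x) ↔ IsUnit (∑ i, x.1 i • B ^ (i : ℕ)) := by
      intro x
      obtain ⟨Z, hZ⟩ := hπ.exists_eq_smul (by omega : l' + l = r) x.2.2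
      rw [isUnit_commSubring_iff]
      change IsUnit (_ + (x.2 : Matrix (Fin n) (Fin n) R)) ↔ _
      rw [hZ]
      exact isUnit_add_smul_iff (IsNilpotent.pow_of_pos ⟨r, hπ.pow_eq_zero⟩ (by omega)) _ _
  · exact (key _).1 x.2
  · exact (key (y.1.1, y.2)).2 y.1.2

/-- The determinant on the units of `commSubring s B`. -/
def detUnits (s : R) (B : Matrix (Fin n) (Fin n) R) : (commSubring s B)ˣ →* Rˣ :=
  Units.map ((Matrix.detMonoidHom (n := Fin n) (R := R)).comp
    ((commSubring s B).subtype : commSubring s B →* Matrix (Fin n) (Fin n) R))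

theorem card_ker_detUnits (s : R) (B : Matrix (Fin n) (Fin n) R) :
    Nat.card (detUnits s B).ker = Nat.card (centSubgroup s B) :=
  Nat.card_congr
    { toFun := fun u => ⟨⟨u.1.1.1, congrArg Units.val u.2⟩, u.1.1.2⟩
      invFun := fun g => ⟨((isUnit_commSubring_iff (⟨g.1.val, g.2⟩ : commSubring s B)).2
          ((Matrix.isUnit_iff_isUnit_det _).2 (by
            change IsUnit g.1.val.det
            rw [g.1.2]; exact isUnit_one))).unit, Units.ext g.1.2⟩
      left_inv := fun u => Subtype.ext (Units.ext rfl)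
      right_inv := fun g => rfl }

/-- The traceless matrices killed by `s`, which commute with `B` modulo the annihilator of `t`. -/
def tracelessKilled (s t : R) (B : Matrix (Fin n) (Fin n) R) :
    AddSubgroup (Matrix (Fin n) (Fin n) R) :=
  killedBy n s ⊓ (Matrix.traceAddMonoidHom (Fin n) R).ker ⊓ (commSubring t B).toAddSubgroup

theorem mem_tracelessKilled {s t : R} {B L : Matrix (Fin n) (Fin n) R} :
    L ∈ tracelessKilled s t B ↔ (s • L = 0 ∧ L.trace = 0) ∧ t • (L * B - B * L) = 0 := Iff.rfl

/-- Truncated logarithm and exponential are inverse bijections; the quadratic terms do not affect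
the condition on `B`, because `t` kills products. A general `t` covers both `J` and `H`. -/
theorem card_radSubgroup (hπ : IsTruncatedDVR π r) (hr : r = l + l')
    (hl2 : l ≤ 2 * l') {c : R} (hc : 2 * c = 1) {t : R} (ht : π ^ l' ∣ t)
    (B : Matrix (Fin n) (Fin n) R) :
    Nat.card (radSubgroup (π ^ l) t B) = Nat.card (tracelessKilled (π ^ l) t B) := by
  have ht2 : ∀ a b : Matrix (Fin n) (Fin n) R, π ^ l • a = 0 → π ^ l • b = 0 →
      t • (a * b) = 0 := by
    obtain ⟨t, rfl⟩ := ht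
    intro a b ha hb
    rw [mul_comm, mul_smul, hπ.smul_mul_eq_zero hr hl2 ha hb, smul_zero]
  have hcomm : ∀ a : Matrix (Fin n) (Fin n) R, π ^ l • a = 0 → ∀ k : R,
      t • ((a + k • a ^ 2) * B - B * (a + k • a ^ 2)) = t • (a * B - B * a) := by
    intro a ha k
    have e : (a + k • a ^ 2) * B - B * (a + k • a ^ 2) =
        (a * B - B * a) + k • (a * (a * B) - (B * a) * a) := by
      simp only [add_mul, mul_add, Matrix.smul_mul, Matrix.mul_smul, smul_sub, pow_two, mul_assoc]
      abel
    rw [e, smul_add, smul_comm t k, smul_sub t (a * (a * B)),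
      ht2 a (a * B) ha (by rw [← Matrix.smul_mul, ha, zero_mul]),
      ht2 (B * a) a (by rw [← Matrix.mul_smul, ha, mul_zero]) ha]
    simp
  refine Nat.card_congr
    { toFun := fun g => ⟨truncLog c g.1.val, ?_⟩
      invFun := fun L => ⟨⟨truncExp c L.1, det_truncExp hπ hr hl2 hc L.2.1.1 L.2.1.2⟩, ?_⟩
      left_inv := fun g => Subtype.ext (Subtype.ext
        (truncExp_truncLog (pow_truncLog_cube hπ hr hl2 g.2.1)))
      right_inv := fun L => Subtype.ext
        (truncLog_truncExp (pow_truncLog_cube hπ hr hl2 L.2.1.1)) }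
  · refine mem_tracelessKilled.2 ⟨⟨smul_truncLog g.2.1, trace_truncLog hπ hr hl2 hc g.2.1⟩, ?_⟩
    have h1 := hcomm (g.1.val - 1) g.2.1 (-c)
    rw [neg_smul, ← sub_eq_add_neg, sub_one_mul_sub_mul_sub_one] at h1
    exact h1.trans g.2.2
  · refine ⟨smul_truncExp L.2.1.1, ?_⟩
    have h1 := hcomm L.1 L.2.1.1 c
    change t • (truncExp c L.1 * B - B * truncExp c L.1) = 0
    rw [← sub_one_mul_sub_mul_sub_one]
    simp only [truncExp, add_assoc, add_sub_cancel_left]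
    exact h1.trans L.2.2

theorem radSubgroup_self (s : R) (B : Matrix (Fin n) (Fin n) R) :
    radSubgroup s s B = congSubgroup n s :=
  inf_eq_left.2 (congSubgroup_le_centSubgroup s B)

/-- The commutator with `B`, multiplied by `s`. -/
def smulAd (s : R) (B : Matrix (Fin n) (Fin n) R) :
    Matrix (Fin n) (Fin n) R →+ Matrix (Fin n) (Fin n) R where
  toFun X := s • (X * B - B * X)
  map_zero' := by simp
  map_add' := by
    intro X Y
    rw [add_mul, mul_add, add_sub_add_comm, smul_add]

/-- On logarithms, `J` is the kernel in `H` of `L ↦ π^l' (L B - B L)`. Writing `L = π^l' X`, and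
dropping the trace condition by adding scalar matrices, its image is that of `X ↦ π^(2l') (X B - B
X)` on all matrices, whose kernel has known order. -/
theorem card_congSubgroup_mul [Finite R] (hπ : IsTruncatedDVR π r) (hr : r = l + l') (hl : l' ≤ l)
    (hl2 : l ≤ 2 * l') {c : R} (hc : 2 * c = 1) (hn : IsUnit (n : R))
    (B : Matrix (Fin n) (Fin n) R) :
    Nat.card (congSubgroup n (π ^ l)) * Nat.card (commSubring (π ^ (2 * l')) B) =
      Nat.card (radSubgroup (π ^ l) (π ^ l') B) * Nat.card R ^ (n * n) := by
  rw [← radSubgroup_self (π ^ l) B, card_radSubgroup hπ hr hl2 hc (pow_dvd_pow π hl),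
    card_radSubgroup hπ hr hl2 hc dvd_rfl]
  set S := tracelessKilled (π ^ l) (π ^ l) B
  let f : S →+ Matrix (Fin n) (Fin n) R := (smulAd (π ^ l') B).comp S.subtype
  have hle : ∀ Y : Matrix (Fin n) (Fin n) R, π ^ l' • Y = 0 → π ^ l • Y = 0 := by
    intro Y hY
    obtain ⟨k, hk⟩ := pow_dvd_pow π hl
    rw [hk, mul_comm, mul_smul, hY, smul_zero]
  have hker : Nat.card f.ker = Nat.card (tracelessKilled (π ^ l) (π ^ l') B) := Nat.card_congr
    { toFun := fun L => ⟨L.1.1, mem_tracelessKilled.2 ⟨L.1.2.1, L.2⟩⟩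
      invFun := fun L => ⟨⟨L.1, mem_tracelessKilled.2 ⟨L.2.1, by
        exact hle _ L.2.2⟩⟩, L.2.2⟩
      left_inv := fun _ => rfl
      right_inv := fun _ => rfl }
  have hrange : f.range = (smulAd (π ^ (2 * l')) B).range := by
    ext D
    constructor
    · rintro ⟨⟨L, hL⟩, rfl⟩
      obtain ⟨X, hX⟩ := hπ.exists_eq_smul (by omega : l' + l = r) hL.1.1
      refine ⟨X, ?_⟩
      change π ^ (2 * l') • (X * B - B * X) = π ^ l' • (L * B - B * L)
      rw [hX, Matrix.smul_mul, Matrix.mul_smul, ← smul_sub, smul_smul, ← pow_add, two_mul]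
    · rintro ⟨X, rfl⟩
      obtain ⟨k, hk⟩ := hn.exists_right_inv
      have h0 : π ^ l • (π ^ l' • (X - (k * X.trace) • (1 : Matrix (Fin n) (Fin n) R))) = 0 := by
        rw [smul_smul, ← pow_add, hπ.pow_eq_zero_of_le hr.le, zero_smul]
      refine ⟨⟨π ^ l' • (X - (k * X.trace) • 1), mem_tracelessKilled.2 ⟨⟨h0, ?_⟩,
        killedBy_le_commSubring _ B _ h0⟩⟩, ?_⟩
      · rw [Matrix.trace_smul, Matrix.trace_sub, Matrix.trace_smul, Matrix.trace_one,
          Fintype.card_fin, smul_eq_mul, smul_eq_mul]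
        linear_combination -π ^ l' * X.trace * hk
      · change π ^ l' • ((π ^ l' • (X - (k * X.trace) • (1 : Matrix (Fin n) (Fin n) R))) * B -
          B * (π ^ l' • (X - (k * X.trace) • (1 : Matrix (Fin n) (Fin n) R)))) =
          π ^ (2 * l') • (X * B - B * X)
        rw [Matrix.smul_mul, Matrix.mul_smul, ← smul_sub, smul_smul, ← pow_add, ← two_mul]
        congr 1
        rw [sub_mul, mul_sub, Matrix.smul_mul, Matrix.mul_smul, one_mul, mul_one]
        abel
  have h1 : Nat.card S = Nat.card f.ker * Nat.card f.range := by
    rw [← AddSubgroup.card_mul_index f.ker, AddSubgroup.index_ker]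
  have h2 : Nat.card (Matrix (Fin n) (Fin n) R) = Nat.card (smulAd (π ^ (2 * l')) B).ker *
      Nat.card (smulAd (π ^ (2 * l')) B).range := by
    rw [← AddSubgroup.card_mul_index (smulAd (π ^ (2 * l')) B).ker, AddSubgroup.index_ker]
  have h3 : Nat.card (smulAd (π ^ (2 * l')) B).ker = Nat.card (commSubring (π ^ (2 * l')) B) := rfl
  have h4 : Nat.card (Matrix (Fin n) (Fin n) R) = Nat.card R ^ (n * n) := by
    simp [Matrix, Nat.card_fun, pow_mul]
  rw [h1, hker, ← h4, h2, h3, hrange]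
  ring

end Counting

/-! ### Orders of linear groups and the value of `d`. -/

section LinearGroups

variable {R : Type*} [CommRing R] {π : R} {r l l' n q : ℕ}

theorem card_matrix (R : Type*) (n : ℕ) :
    Nat.card (Matrix (Fin n) (Fin n) R) = Nat.card R ^ (n * n) := by
  simp [Matrix, Nat.card_fun, pow_mul]

theorem card_SL_mul_card_units (hn : n ≠ 0) :
    Nat.card (GL (Fin n) R) = Nat.card (Matrix.SpecialLinearGroup (Fin n) R) * Nat.card Rˣ := by
  have : NeZero n := ⟨hn⟩
  rw [card_eq_card_ker_mul_card_range Matrix.GeneralLinearGroup.det,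
    MonoidHom.range_eq_top.2 Matrix.GeneralLinearGroup.det_surjective, Nat.card_congr Subgroup.topEquiv.toEquiv]
  congr 1
  exact Nat.card_congr
    { toFun := fun g => ⟨g.1.1, congrArg Units.val g.2⟩
      invFun := fun g => ⟨Matrix.GeneralLinearGroup.mk'' g.1 (by rw [g.2]; exact isUnit_one),
        Units.ext g.2⟩
      left_inv := fun _ => Subtype.ext (Units.ext rfl)
      right_inv := fun _ => rfl }

/-- Invertibility is detected on the residue field, so `GL_n(R)` is a union of fibres of reduction.
-/
theorem card_GL_mul {k : Type*} [Field k] (φ : R →+* k) [IsLocalHom φ]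
    (hφ : Function.Surjective φ) :
    Nat.card (GL (Fin n) R) * Nat.card k ^ (n * n) =
      Nat.card (GL (Fin n) k) * Nat.card R ^ (n * n) := by
  let f : Matrix (Fin n) (Fin n) R →+ Matrix (Fin n) (Fin n) k := φ.mapMatrix.toAddMonoidHom
  have hf : Function.Surjective f := by
    intro A
    choose g hg using hφ
    exact ⟨A.map g, by ext i j; exact hg _⟩
  have hunit : ∀ A : Matrix (Fin n) (Fin n) R, IsUnit A ↔ IsUnit (f A) := by
    intro A
    rw [Matrix.isUnit_iff_isUnit_det, Matrix.isUnit_iff_isUnit_det]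
    change _ ↔ IsUnit (φ.mapMatrix A).det
    rw [← RingHom.map_det, isUnit_map_iff]
  have h1 : Nat.card (GL (Fin n) R) = Nat.card (GL (Fin n) k) * Nat.card f.ker := by
    rw [card_units_eq_card_isUnit, card_units_eq_card_isUnit, ← card_preimage f hf]
    exact Nat.card_congr (Equiv.subtypeEquivRight hunit)
  have h2 := card_eq_card_ker_mul_card f hf
  rw [card_matrix, card_matrix] at h2
  rw [h1, h2]
  ring

theorem isotypic_dimension_eq [Finite R] (hπ : IsTruncatedDVR π r) (hr : r = l + l')
    (hl : l' ≤ l) (hl2 : l ≤ l' + 1) (hl' : 1 ≤ l') (hq : Nat.card R = q ^ r) (hq0 : 0 < q)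
    (hn : IsUnit (n : R)) {c : R} (hc : 2 * c = 1)
    {B : Matrix (Fin n) (Fin n) R} {v : Fin n → R} (hv : IsUnit (krylov B v).det) {d : ℕ}
    (hd : Nat.card (radSubgroup (π ^ l) (π ^ l') B) * d ^ 2 = Nat.card (congSubgroup n (π ^ l))) :
    d = q ^ ((r - 2 * l') * (n * (n - 1) / 2)) := by
  obtain ⟨k, hk⟩ : ∃ k, n * (n - 1) = k * 2 := by
    have := Nat.even_mul_pred_self n
    obtain ⟨k, hk⟩ := this
    exact ⟨k, by rw [hk]; ring⟩
  have hnn : n * n = n + 2 * k := by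
    rcases n with _ | n
    · simp at hk ⊢; exact hk
    · simp only [Nat.add_sub_cancel] at hk
      linarith
  -- Here `m` is the parity of `r`, so `d` is 1 for even `r` and `q^(n(n-1)/2)` for odd `r`.
  obtain ⟨m, hm⟩ : ∃ m, r = 2 * l' + m := ⟨r - 2 * l', by omega⟩
  rw [hk, Nat.mul_div_cancel _ (by norm_num), hm, Nat.add_sub_cancel_left]
  have : Finite (Matrix.SpecialLinearGroup (Fin n) R) := Subtype.finite
  have h1 := card_congSubgroup_mul hπ hr hl (by omega) hc hn B
  have h2 := card_commSubring (s := π ^ (2 * l')) hv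
  rw [hπ.card_annihilator (by omega) hq (by omega : 2 * l' ≤ r), hq] at h2
  rw [← hd, hq, mul_assoc] at h1
  have h3 := Nat.eq_of_mul_eq_mul_left Nat.card_pos h1
  have h4 : d ^ 2 * ((q ^ r) ^ n * (q ^ (2 * l')) ^ (n * n)) =
      (q ^ m ) ^ (2 * k) * ((q ^ r) ^ n * (q ^ (2 * l')) ^ (n * n)) := by
    calc _ = (q ^ (2 * l')) ^ n * (d ^ 2 * Nat.card (commSubring (π ^ (2 * l')) B)) := by
          rw [← h2]; ring
      _ = _ := by rw [h3, hnn, hm]; ring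
  have h5 := Nat.eq_of_mul_eq_mul_right (by positivity) h4
  have h6 : d ^ 2 = (q ^ (m * k)) ^ 2 := by rw [h5]; ring
  exact Nat.pow_left_injective (by norm_num) h6

end LinearGroups

/-! ### Completeness, lifting of idempotents and locality of the ring of integers of the extension.
-/

theorem isAdicComplete_of_basis {A S ι : Type*} [CommRing A] [CommRing S] [Algebra A S] [Fintype ι]
    (b : Module.Basis ι A S) (I : Ideal A) [IsAdicComplete I A] : IsAdicComplete I S := by
  have hcoord : ∀ (k : ℕ) (x : S), x ∈ (I ^ k • ⊤ : Submodule A S) ↔ ∀ i, b.repr x i ∈ I ^ k := by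
    intro k x
    constructor
    · intro hx i
      have := Submodule.mem_map_of_mem (f := b.coord i) hx
      rw [Submodule.map_smul''] at this
      have := Submodule.smul_mono (le_refl (I ^ k)) (le_top (a := Submodule.map (b.coord i) ⊤)) this
      simpa using this
    · intro h
      rw [← b.sum_repr x]
      exact Submodule.sum_mem _ fun i _ => Submodule.smul_mem_smul (h i) trivial
  refine @IsAdicComplete.mk _ _ _ _ _ _ ⟨fun x hx => ?_⟩ ⟨fun f hf => ?_⟩
  · apply b.repr.injective
    ext i
    rw [map_zero, Finsupp.zero_apply]
    refine IsHausdorff.haus (inferInstance : IsHausdorff I A) _ fun k => ?_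
    have := hx k
    rw [SModEq.zero] at this ⊢
    simpa using (hcoord k x).1 this i
  · have hc : ∀ i, ∃ L : A, ∀ k, b.repr (f k) i ≡ L [SMOD (I ^ k • ⊤ : Submodule A A)] := by
      intro i
      refine IsPrecomplete.prec inferInstance fun {j k} hjk => ?_
      have := hf hjk
      rw [SModEq.sub_mem, hcoord] at this
      rw [SModEq.sub_mem]
      simpa using this i
    choose L hL using hc
    refine ⟨∑ i, L i • b i, fun k => ?_⟩
    rw [SModEq.sub_mem, hcoord]
    intro i
    have := hL i k
    rw [SModEq.sub_mem] at this
    have h2 := congrFun (b.repr_sum_self L) i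
    rw [map_sub, Finsupp.sub_apply, h2]
    simpa using this

/-- Idempotents lift along a Henselian pair. -/
theorem exists_idempotent_lift {S : Type*} [CommRing S] (J : Ideal S) [HenselianRing S J] {y : S}
    (hy : y * y - y ∈ J) : ∃ e : S, e * e = e ∧ e - y ∈ J := by
  obtain ⟨e, he, hey⟩ := HenselianRing.is_henselian (I := J)
    (Polynomial.X ^ 2 - Polynomial.X : Polynomial S) (by
      nontriviality S
      exact Polynomial.monic_X_pow_sub (n := 2) (by rw [Polynomial.degree_X]; norm_num)) y
    (by simpa [sq] using hy) (by
      refine IsUnit.of_mul_eq_one (Ideal.Quotient.mk J (2 * y - 1)) ?_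
      rw [← map_mul, ← map_one (Ideal.Quotient.mk J), Ideal.Quotient.mk_eq_mk_iff_sub_mem]
      convert J.mul_mem_left 4 hy using 1
      simp only [Polynomial.derivative_sub, Polynomial.derivative_X_pow, Polynomial.derivative_X]
      simp
      ring)
  refine ⟨e, ?_, hey⟩
  have : e ^ 2 - e = 0 := by simpa [Polynomial.IsRoot] using he
  linear_combination this

theorem exists_pow_idempotent {T : Type*} [CommRing T] [Finite T] (x : T) :
    ∃ k, k ≠ 0 ∧ x ^ k * x ^ k = x ^ k := by
  obtain ⟨i, j, hij, h⟩ := Finite.exists_ne_map_eq_of_infinite fun k : ℕ => x ^ k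
  wlog hlt : i < j generalizing i j
  · exact this j i hij.symm h.symm (by omega)
  obtain ⟨d, rfl⟩ : ∃ d, j = i + d := ⟨j - i, by omega⟩
  have hd : 0 < d := by omega
  have h1 : ∀ a c, i ≤ a → x ^ (a + c * d) = x ^ a := by
    intro a c ha
    induction c with
    | zero => simp
    | succ c ih =>
      obtain ⟨e, rfl⟩ : ∃ e, a = i + e := ⟨a - i, by omega⟩
      rw [← ih, show i + e + (c + 1) * d = i + d + (e + c * d) by ring, pow_add, ← show _ = _ from h,
        ← pow_add]
      congr 1
      ring
  -- The exponent must be a multiple of the period `d` and at least the preperiod `i`.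
  refine ⟨(i + 1) * d, by positivity, ?_⟩
  rw [← pow_add, h1]
  nlinarith

/-- Modulo `J`, which lies in the Jacobson radical, some power of `x` is idempotent. It lifts to an
idempotent of the domain `S`, which is 0 or 1; accordingly `1 - x` or `x` is a unit. -/
theorem isLocalRing_of_basis {A S ι : Type*} [CommRing A] [CommRing S] [IsDomain S] [Algebra A S]
    [Fintype ι] (b : Module.Basis ι A S) (I : Ideal A) [IsAdicComplete I A] [Finite (A ⧸ I)] :
    IsLocalRing S := by
  have h1 := isAdicComplete_of_basis b I
  rw [← IsAdicComplete.map_algebraMap_iff (S := S)] at h1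
  set J := I.map (algebraMap A S)
  have : Module.Finite A S := .of_basis b
  have : Module.Finite (A ⧸ I) (S ⧸ J) := .of_restrictScalars_finite A (A ⧸ I) (S ⧸ J)
  have : Finite (S ⧸ J) := Module.finite_of_finite (A ⧸ I)
  refine IsLocalRing.of_isUnit_or_isUnit_one_sub_self fun x => ?_
  obtain ⟨k, hk, hx⟩ := exists_pow_idempotent (Ideal.Quotient.mk J x)
  rw [← map_pow, ← map_mul, Ideal.Quotient.mk_eq_mk_iff_sub_mem] at hx
  obtain ⟨e, he, hex⟩ := exists_idempotent_lift J hx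
  have hJ := IsAdicComplete.le_jacobson_bot J
  have hu : ∀ z ∈ J, IsUnit (1 + z) := fun z hz => by
    have := Ideal.mem_jacobson_bot.1 (hJ hz) 1
    rwa [mul_one, add_comm] at this
  have h2 : e * (e - 1) = 0 := by linear_combination he
  rcases mul_eq_zero.1 h2 with h0 | h0
  · right
    have := hu (-x ^ k) (by simpa [h0] using hex)
    refine isUnit_of_dvd_unit ?_ this
    simpa [sub_eq_add_neg] using sub_dvd_pow_sub_pow (1 : S) x k
  · left
    have := hu (x ^ k - e) (by simpa using J.neg_mem hex)
    rw [sub_eq_zero.1 h0] at this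
    exact (isUnit_pow_iff hk).1 (by simpa using this)

end SLRep

namespace SLRep

open IsLocalRing Polynomial

/-! ### Powers of a generator `β` and the cyclic vector they provide. -/

section PowerSpan

variable {A S : Type*} [CommRing A] [CommRing S] [Algebra A S] {n : ℕ}
  (b : Module.Basis (Fin n) A S) {β : S}

/-- Divide by the characteristic polynomial of multiplication by `β`, which is monic of degree `n`
and vanishes at `β`. -/
theorem exists_eq_sum_pow (b : Module.Basis (Fin n) A S) (hβ : Algebra.adjoin A {β} = ⊤) (x : S) :
    ∃ c : Fin n → A, x = ∑ i, c i • β ^ (i : ℕ) := by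
  rcases subsingleton_or_nontrivial A with h | h
  · have := Module.subsingleton A S
    exact ⟨0, Subsingleton.elim _ _⟩
  have hx : x ∈ Algebra.adjoin A {β} := hβ ▸ Algebra.mem_top
  rw [Algebra.adjoin_singleton_eq_range_aeval] at hx
  obtain ⟨p, rfl⟩ := hx
  set B := Algebra.leftMulMatrix b β
  have h0 : aeval β B.charpoly = 0 := by
    apply Algebra.leftMulMatrix_injective b
    rw [← aeval_algHom_apply, map_zero, Matrix.aeval_self_charpoly]
  have hm : B.charpoly.Monic := Matrix.charpoly_monic B
  have hp : aeval β p = aeval β (p %ₘ B.charpoly) := by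
    conv_lhs => rw [← modByMonic_add_div p B.charpoly]
    rw [map_add, map_mul, h0, zero_mul, add_zero]
  have hdeg : (p %ₘ B.charpoly).natDegree < n ∨ p %ₘ B.charpoly = 0 := by
    rcases eq_or_ne (p %ₘ B.charpoly) 0 with h | h
    · exact Or.inr h
    · left
      have := degree_modByMonic_lt p hm
      rw [Matrix.charpoly_degree_eq_dim, Fintype.card_fin] at this
      exact (natDegree_lt_iff_degree_lt h).2 this
  refine ⟨fun i => (p %ₘ B.charpoly).coeff i, ?_⟩
  change aeval β p = _
  rw [hp]
  rcases hdeg with h | h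
  · rw [aeval_eq_sum_range' h, Finset.sum_range]
  · simp [h]

theorem krylov_repr_one (β : S) :
    krylov (Algebra.leftMulMatrix b β) (b.repr 1) =
      Matrix.of fun a i : Fin n => b.repr (β ^ (i : ℕ)) a := by
  ext a i
  simp only [krylov, Matrix.of_apply]
  rw [← map_pow, Algebra.leftMulMatrix_mulVec_repr, mul_one]

/-- With the coordinates of `1` as starting vector, the Krylov matrix expresses the powers of `β` in
the basis `b`. It has a right inverse, as those powers span. -/
theorem isUnit_det_krylov (hβ : Algebra.adjoin A {β} = ⊤) :
    IsUnit (krylov (Algebra.leftMulMatrix b β) (b.repr 1)).det := by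
  choose c hc using fun j => exists_eq_sum_pow b hβ (b j)
  refine Matrix.isUnit_det_of_right_inverse (B := Matrix.of fun i j => c j i) ?_
  rw [krylov_repr_one]
  ext a j
  have := congrArg (fun x => b.repr x a) (hc j)
  simp only [map_sum, map_smul, Finsupp.coe_finsetSum, Finset.sum_apply, Finsupp.smul_apply,
    smul_eq_mul, Module.Basis.repr_self] at this
  simp only [Matrix.mul_apply, Matrix.of_apply]
  rw [Matrix.one_apply, Finset.sum_congr rfl fun i _ => mul_comm _ _, ← this,
    Finsupp.single_apply]
  simp [eq_comm]

theorem krylov_map {R : Type*} [CommRing R] (φ : A →+* R) (B : Matrix (Fin n) (Fin n) A)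
    (v : Fin n → A) : krylov (φ.mapMatrix B) (φ ∘ v) = φ.mapMatrix (krylov B v) := by
  ext a i
  simp only [krylov, Matrix.of_apply, RingHom.mapMatrix_apply, Matrix.map_apply]
  rw [← RingHom.mapMatrix_apply, ← map_pow, RingHom.map_mulVec]
  rfl

theorem isUnit_leftMulMatrix_iff (x : S) : IsUnit (Algebra.leftMulMatrix b x) ↔ IsUnit x := by
  refine ⟨fun h => ?_, fun h => h.map _⟩
  obtain ⟨N, hN⟩ := h.exists_right_inv
  have h1 : (Algebra.leftMulMatrix b x).mulVec (N.mulVec (b.repr 1)) = b.repr 1 := by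
    rw [Matrix.mulVec_mulVec, hN, Matrix.one_mulVec]
  set y : S := ∑ i, N.mulVec (b.repr 1) i • b i
  have hy : b.repr y = N.mulVec (b.repr 1) := b.repr_sum_self _
  rw [← hy, Algebra.leftMulMatrix_mulVec_repr] at h1
  exact IsUnit.of_mul_eq_one y (b.repr.injective (DFunLike.coe_injective h1))

theorem isUnit_norm_iff_of_basis (b : Module.Basis (Fin n) A S) (x : S) : IsUnit (Algebra.norm A x) ↔ IsUnit x := by
  rw [Algebra.norm_eq_matrix_det b, ← Matrix.isUnit_iff_isUnit_det, isUnit_leftMulMatrix_iff]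

end PowerSpan

/-! ### Quotients of a discrete valuation ring by powers of its maximal ideal. -/

section Quotients

variable {A : Type*} [CommRing A] [IsDomain A] [IsDiscreteValuationRing A]

theorem isTruncatedDVR_mk {ϖ : A} (hϖ : maximalIdeal A = Ideal.span {ϖ}) (r : ℕ) :
    IsTruncatedDVR (Ideal.Quotient.mk (maximalIdeal A ^ r) ϖ) r where
  pow_eq_zero := by
    rw [← map_pow, Ideal.Quotient.eq_zero_iff_mem, hϖ]
    exact Ideal.pow_mem_pow (Ideal.mem_span_singleton_self ϖ) r
  dvd_of_mul_eq_zero i j hij x hx := by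
    obtain ⟨x, rfl⟩ := Ideal.Quotient.mk_surjective x
    rw [← map_pow, ← map_mul, Ideal.Quotient.eq_zero_iff_mem, hϖ, Ideal.span_singleton_pow,
      Ideal.mem_span_singleton, ← hij, add_comm i j, pow_add] at hx
    have h0 : ϖ ≠ 0 := by
      rintro rfl
      exact IsDiscreteValuationRing.not_a_field A (by simp [hϖ])
    rw [← map_pow]
    exact map_dvd _ ((mul_dvd_mul_iff_left (pow_ne_zero j h0)).1 hx)

theorem card_quotient_maximalIdeal_pow (r : ℕ) :
    Nat.card (A ⧸ maximalIdeal A ^ r) = Nat.card (ResidueField A) ^ r := by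
  have := cardQuot_pow_of_prime (P := maximalIdeal A) (IsDiscreteValuationRing.not_a_field A) (i := r)
  rwa [Submodule.cardQuot_apply, Submodule.cardQuot_apply] at this

theorem finite_quotient_maximalIdeal_pow [Finite (ResidueField A)] (r : ℕ) :
    Finite (A ⧸ maximalIdeal A ^ r) := by
  refine Nat.finite_of_card_ne_zero ?_
  rw [card_quotient_maximalIdeal_pow]
  exact pow_ne_zero _ Nat.card_pos.ne'

theorem nontrivial_quotient_maximalIdeal_pow {r : ℕ} (hr : r ≠ 0) :
    Nontrivial (A ⧸ maximalIdeal A ^ r) :=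
  Ideal.Quotient.nontrivial_iff.2 fun h =>
    (maximalIdeal.isMaximal A).ne_top (top_le_iff.1 (h ▸ Ideal.pow_le_self hr))

end Quotients

end SLRep

namespace SLRep

open IsLocalRing

/-! ### Reduction of multiplication matrices. -/

section Reduction

variable {A S : Type*} [CommRing A] [CommRing S] [Algebra A S] {n : ℕ}

theorem leftMulMatrix_sum_pow (b : Module.Basis (Fin n) A S) (β : S) {R : Type*} [CommRing R]
    (φ : A →+* R) (c : Fin n → A) :
    φ.mapMatrix (Algebra.leftMulMatrix b (∑ i, c i • β ^ (i : ℕ))) =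
      ∑ i, φ (c i) • (φ.mapMatrix (Algebra.leftMulMatrix b β)) ^ (i : ℕ) := by
  rw [map_sum, map_sum]
  refine Finset.sum_congr rfl fun i _ => ?_
  rw [map_smul, map_pow, ← map_pow φ.mapMatrix]
  ext a j
  simp

theorem isUnit_mapMatrix_leftMulMatrix_iff (b : Module.Basis (Fin n) A S) {R : Type*} [CommRing R]
    (φ : A →+* R) [IsLocalHom φ] (x : S) :
    IsUnit (φ.mapMatrix (Algebra.leftMulMatrix b x)) ↔ IsUnit x := by
  rw [Matrix.isUnit_iff_isUnit_det, ← RingHom.map_det, isUnit_map_iff,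
    ← Matrix.isUnit_iff_isUnit_det, isUnit_leftMulMatrix_iff]

end Reduction

/-! ### Counting invertible polynomials in `B`. -/

section UnitCount

variable {A S : Type*} [CommRing A] [IsDomain A] [IsDiscreteValuationRing A] [CommRing S]
  [Algebra A S] {n r l l' : ℕ}

theorem isLocalHom_quotient_mk_pow (hr : r ≠ 0) :
    IsLocalHom (Ideal.Quotient.mk (maximalIdeal A ^ r)) := by
  have := nontrivial_quotient_maximalIdeal_pow (A := A) hr
  exact .of_surjective _ Ideal.Quotient.mk_surjective

/-- Sending coefficients to the polynomial in `β` modulo the maximal ideal of `S` is an additive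
surjection, and invertibility means a nonzero image. This is the source of the factor `1 - q^(-f)`.
-/
theorem card_isUnit_sum_pow [IsLocalRing S] [Finite (ResidueField A)]
    (b : Module.Basis (Fin n) A S) {β : S} (hβ : Algebra.adjoin A {β} = ⊤) (hr : r ≠ 0)
    (hS : Ideal.map (algebraMap A S) (maximalIdeal A) ≤ maximalIdeal S) :
    Nat.card {c : Fin n → A ⧸ maximalIdeal A ^ r // IsUnit (∑ i, c i •
        ((Ideal.Quotient.mk (maximalIdeal A ^ r)).mapMatrix
          (Algebra.leftMulMatrix b β)) ^ (i : ℕ))} * Nat.card (S ⧸ maximalIdeal S) =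
      (Nat.card (S ⧸ maximalIdeal S) - 1) * Nat.card (A ⧸ maximalIdeal A ^ r) ^ n := by
  have := finite_quotient_maximalIdeal_pow (A := A) r
  have := isLocalHom_quotient_mk_pow (A := A) hr
  let ψ : A ⧸ maximalIdeal A ^ r →+* S ⧸ maximalIdeal S :=
    Ideal.Quotient.lift _ ((Ideal.Quotient.mk (maximalIdeal S)).comp (algebraMap A S)) fun a ha =>
      Ideal.Quotient.eq_zero_iff_mem.2 (hS (Ideal.mem_map_of_mem _ (Ideal.pow_le_self hr ha)))
  let f : (Fin n → A ⧸ maximalIdeal A ^ r) →+ S ⧸ maximalIdeal S :=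
    { toFun := fun c => ∑ i, ψ (c i) * Ideal.Quotient.mk (maximalIdeal S) β ^ (i : ℕ)
      map_zero' := by simp
      map_add' := fun c d => by simp [add_mul, Finset.sum_add_distrib] }
  have hfc : ∀ c : Fin n → A, f (fun i => Ideal.Quotient.mk _ (c i)) =
      Ideal.Quotient.mk (maximalIdeal S) (∑ i, c i • β ^ (i : ℕ)) := by
    intro c
    simp [f, ψ, Algebra.smul_def]
  have hf : Function.Surjective f := by
    intro y
    obtain ⟨x, rfl⟩ := Ideal.Quotient.mk_surjective y
    obtain ⟨c, rfl⟩ := exists_eq_sum_pow b hβ x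
    exact ⟨_, hfc c⟩
  have hunit : ∀ c : Fin n → A ⧸ maximalIdeal A ^ r, IsUnit (∑ i, c i •
        ((Ideal.Quotient.mk (maximalIdeal A ^ r)).mapMatrix
          (Algebra.leftMulMatrix b β)) ^ (i : ℕ)) ↔ f c ≠ 0 := by
    intro c
    choose d hd using fun i => Ideal.Quotient.mk_surjective (c i)
    obtain rfl : (fun i => Ideal.Quotient.mk _ (d i)) = c := funext hd
    rw [hfc, ne_eq, Ideal.Quotient.eq_zero_iff_mem, IsLocalRing.notMem_maximalIdeal,
      ← leftMulMatrix_sum_pow, isUnit_mapMatrix_leftMulMatrix_iff]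
  have : Finite (S ⧸ maximalIdeal S) := .of_surjective f hf
  have h1 := card_preimage f hf (· ≠ 0)
  have h2 := card_eq_card_ker_mul_card f hf
  have h3 : Nat.card {y : S ⧸ maximalIdeal S // y ≠ 0} = Nat.card (S ⧸ maximalIdeal S) - 1 := by
    have := Fintype.ofFinite (S ⧸ maximalIdeal S)
    classical
    rw [Nat.card_eq_fintype_card, Nat.card_eq_fintype_card, Fintype.card_subtype_compl,
      Fintype.card_subtype_eq]
  have h4 : Nat.card (Fin n → A ⧸ maximalIdeal A ^ r) = Nat.card (A ⧸ maximalIdeal A ^ r) ^ n := by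
    simp [Nat.card_fun]
  rw [Nat.card_congr (Equiv.subtypeEquivRight hunit), h1, h3, ← h4, h2]
  ring

end UnitCount

/-! ### Determinants of the commutant and norms of units. -/

section NormRange

variable {A S : Type*} [CommRing A] [IsDomain A] [IsDiscreteValuationRing A] [CommRing S]
  [Algebra A S] {n r l l' : ℕ}

theorem exists_pow_eq_of_sub_one_mem [HenselianRing A (maximalIdeal A)] (hn : IsUnit (n : A))
    {w : A} (hw : w - 1 ∈ maximalIdeal A) : ∃ c, c ^ n = w := by
  have hn0 : n ≠ 0 := by
    rintro rfl
    simp at hn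
  obtain ⟨c, hc, -⟩ := HenselianRing.is_henselian (I := maximalIdeal A)
    (Polynomial.X ^ n - Polynomial.C w : Polynomial A) (Polynomial.monic_X_pow_sub_C _ hn0) 1
    (by simpa using (maximalIdeal A).neg_mem hw) (by
      rw [Polynomial.derivative_sub, Polynomial.derivative_X_pow, Polynomial.derivative_C]
      simpa using hn.map (Ideal.Quotient.mk (maximalIdeal A)))
  exact ⟨c, by simpa [Polynomial.IsRoot, sub_eq_zero] using hc⟩

/-- Modulo the maximal ideal, an element of the commutant is multiplication by some `x` in `S`, so
its determinant is a norm up to a factor congruent to 1. That factor is an `n`-th power `c^n`, which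
is the norm of `c`. -/
theorem comap_range_detUnits [HenselianRing A (maximalIdeal A)] (b : Module.Basis (Fin n) A S)
    {β : S} (hβ : Algebra.adjoin A {β} = ⊤) {ϖ : A} (hϖ : maximalIdeal A = Ideal.span {ϖ})
    (hr : r = l + l') (hl' : 1 ≤ l') (hn : IsUnit (n : A)) :
    (detUnits (Ideal.Quotient.mk (maximalIdeal A ^ r) ϖ ^ l)
        ((Ideal.Quotient.mk (maximalIdeal A ^ r)).mapMatrix (Algebra.leftMulMatrix b β))).range.comap
      (Units.map (Ideal.Quotient.mk (maximalIdeal A ^ r)).toMonoidHom) =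
    (Units.map (Algebra.norm A : S →* A)).range := by
  have hr0 : r ≠ 0 := by omega
  have := isLocalHom_quotient_mk_pow (A := A) hr0
  have hπ := isTruncatedDVR_mk hϖ r
  set φ := Ideal.Quotient.mk (maximalIdeal A ^ r) with hφ
  set B := φ.mapMatrix (Algebra.leftMulMatrix b β) with hB
  have hv : IsUnit (krylov B (φ ∘ b.repr 1)).det := by
    rw [hB, krylov_map, ← RingHom.map_det]
    exact (isUnit_det_krylov b hβ).map φ
  ext u
  simp only [Subgroup.mem_comap, MonoidHom.mem_range]
  constructor
  · rintro ⟨X, hX⟩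
    have hXu : φ u = (X.1 : Matrix (Fin n) (Fin n) _).det := (congrArg Units.val hX).symm
    obtain ⟨c, hc⟩ := exists_sum_pow_of_commute hv X.1.2
    choose d hd using fun i => Ideal.Quotient.mk_surjective (c i)
    obtain rfl : (fun i => φ (d i)) = c := funext hd
    have hsum := leftMulMatrix_sum_pow b β φ d
    rw [← hB] at hsum
    beta_reduce at hc
    rw [← hsum] at hc
    set x := ∑ i, d i • β ^ (i : ℕ)
    have hsub : φ u - φ (Algebra.norm A x) ∈ Ideal.span {φ ϖ} := by
      rw [← Ideal.Quotient.mk_eq_mk_iff_sub_mem, hXu, Algebra.norm_eq_matrix_det b,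
        RingHom.map_det φ, RingHom.map_det, RingHom.map_det]
      congr 1
      ext i j
      simp only [RingHom.mapMatrix_apply, Matrix.map_apply]
      rw [Ideal.Quotient.mk_eq_mk_iff_sub_mem, Ideal.mem_span_singleton]
      have h1 := congrFun (congrFun hc i) j
      have h2 := hπ.dvd_of_mul_eq_zero l' l (by omega) _ h1
      exact (dvd_pow_self _ (by omega)).trans h2
    have hmem : (u : A) - Algebra.norm A x ∈ maximalIdeal A := by
      rw [Ideal.mem_span_singleton] at hsub
      obtain ⟨z, hz⟩ := hsub
      obtain ⟨z, rfl⟩ := Ideal.Quotient.mk_surjective z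
      rw [← map_sub, ← map_mul, Ideal.Quotient.mk_eq_mk_iff_sub_mem] at hz
      have h1 := Ideal.pow_le_self hr0 hz
      have h2 : ϖ * z ∈ maximalIdeal A := by
        rw [hϖ]
        exact Ideal.mul_mem_right _ _ (Ideal.mem_span_singleton_self ϖ)
      simpa using Ideal.add_mem _ h1 h2
    have hNu : IsUnit (Algebra.norm A x) := by
      by_contra h
      have h1 : Algebra.norm A x ∈ maximalIdeal A := h
      have h2 := Ideal.add_mem _ hmem h1
      rw [sub_add_cancel] at h2
      exact h2 u.isUnit
    obtain ⟨y, hy⟩ := hNu.exists_right_inv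
    obtain ⟨c, hc⟩ := exists_pow_eq_of_sub_one_mem hn (w := u * y) (by
      have := Ideal.mul_mem_right y _ hmem
      rwa [sub_mul, hy] at this)
    have hN : Algebra.norm A (algebraMap A S c * x) = u := by
      rw [map_mul, Algebra.norm_algebraMap_of_basis b, Fintype.card_fin, hc]
      linear_combination (u : A) * hy
    obtain ⟨z, hz⟩ := (isUnit_norm_iff_of_basis b _).1 (hN ▸ u.isUnit)
    exact ⟨z, Units.ext (by rw [Units.coe_map, hz]; exact hN)⟩
  · rintro ⟨x, rfl⟩
    let X : commSubring (φ ϖ ^ l) B := ⟨φ.mapMatrix (Algebra.leftMulMatrix b x), by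
      rw [mem_commSubring, hB, ← map_mul, ← map_mul, ← map_mul, ← map_mul, mul_comm, sub_self,
        smul_zero]⟩
    have hX : IsUnit X := (isUnit_commSubring_iff X).2
      ((x.isUnit.map (Algebra.leftMulMatrix b)).map φ.mapMatrix)
    refine ⟨hX.unit, Units.ext ?_⟩
    change (φ.mapMatrix (Algebra.leftMulMatrix b x)).det = φ (Algebra.norm A (x : S))
    rw [Algebra.norm_eq_matrix_det b, RingHom.map_det]

end NormRange

end SLRep

/-! ### Arithmetic of the group orders. -/

namespace SLRep

open IsLocalRing

theorem prod_pow_sub_pow {q : ℝ} (hq : q ≠ 0) (n : ℕ) :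
    ∏ i : Fin n, (q ^ n - q ^ (i : ℕ)) =
      q ^ (n * n) * ∏ k ∈ Finset.Icc 1 n, (1 - (q ^ k)⁻¹) := by
  have h1 : ∏ k ∈ Finset.Icc 1 n, (1 - (q ^ k)⁻¹) = ∏ i : Fin n, (1 - (q ^ (n - (i : ℕ)))⁻¹) := by
    rw [Fin.prod_univ_eq_prod_range (fun i => 1 - (q ^ (n - i))⁻¹) n]
    refine Finset.prod_bij' (fun k _ => n - k) (fun i _ => n - i) ?_ ?_ ?_ ?_ ?_ <;>
      simp only [Finset.mem_Icc, Finset.mem_range]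
    · intro a ha; omega
    · intro a ha; omega
    · intro a ha; omega
    · intro a ha; omega
    · intro a ha
      rw [Nat.sub_sub_self ha.2]
  have h2 : q ^ (n * n) = ∏ _i : Fin n, q ^ n := by simp [pow_mul]
  rw [h1, h2, ← Finset.prod_mul_distrib]
  refine Finset.prod_congr rfl fun i _ => ?_
  have : q ^ n = q ^ (n - (i : ℕ)) * q ^ (i : ℕ) := by rw [← pow_add]; congr 1; omega
  rw [mul_sub, mul_one, this]
  field_simp

/-- Dictionary of orders: `Γ` the stabilizer, `U` the units of the commutant, `D` their
determinants, `M` the invertible polynomials in `B`, `G` and `H` the general and special linear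
groups, `Ru` the units of `R`; `idx` is the norm index. -/
theorem dim_eq_of_card_eq {q f n r l l' Γ D U M G H Ru d dim idx : ℕ} (hq : 1 < q) (hf : f ≠ 0)
    (hl : l' ≤ l) (hr : r = l + l') (hΓ : Γ * dim = H * d)
    (hd : d = q ^ ((r - 2 * l') * (n * (n - 1) / 2))) (hU : U = Γ * D) (hD : D * idx = Ru)
    (hidx : idx ≠ 0) (hUM : U * (q ^ l) ^ n = M * (q ^ l) ^ (n * n))
    (hM : M * q ^ f = (q ^ f - 1) * (q ^ r) ^ n) (hGL : G = H * Ru)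
    (hGLq : G * q ^ (n * n) = (∏ i : Fin n, (q ^ n - q ^ (i : ℕ))) * (q ^ r) ^ (n * n)) :
    (dim : ℝ) = (q : ℝ) ^ (r * (n * (n - 1) / 2)) / idx *
      ((∏ k ∈ Finset.Icc 1 n, (1 - ((q : ℝ) ^ k)⁻¹)) / (1 - ((q : ℝ) ^ f)⁻¹)) := by
  obtain ⟨k, hk⟩ : ∃ k, n * (n - 1) = k * 2 := by
    obtain ⟨k, hk⟩ := Nat.even_mul_pred_self n
    exact ⟨k, by rw [hk]; ring⟩
  have hnn : n * n = n + 2 * k := by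
    rcases n with _ | n
    · simp at hk ⊢; exact hk
    · simp only [Nat.add_sub_cancel] at hk
      linarith
  rw [hk, Nat.mul_div_cancel _ (by norm_num)] at hd ⊢
  have hq1 : (1 : ℝ) < q := by exact_mod_cast hq
  have hq0 : (q : ℝ) ≠ 0 := by positivity
  have hf1 : (1 : ℝ) < (q : ℝ) ^ f := one_lt_pow₀ hq1 hf
  have hfne : 1 - ((q : ℝ) ^ f)⁻¹ ≠ 0 := by
    have := inv_lt_one_of_one_lt₀ hf1
    linarith
  have hidx' : (idx : ℝ) ≠ 0 := by exact_mod_cast hidx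
  set E := ∏ k ∈ Finset.Icc 1 n, (1 - ((q : ℝ) ^ k)⁻¹)
  have hGL' : (G : ℝ) = E * ((q : ℝ) ^ r) ^ (n * n) := by
    have h := congrArg (Nat.cast : ℕ → ℝ) hGLq
    push_cast at h
    have hcast : ∀ i : Fin n, (((q ^ n - q ^ (i : ℕ) : ℕ)) : ℝ) = (q : ℝ) ^ n - (q : ℝ) ^ (i : ℕ) := by
      intro i
      rw [Nat.cast_sub (Nat.pow_le_pow_right (by omega) i.2.le)]
      push_cast
      rfl
    rw [Finset.prod_congr rfl fun i _ => hcast i, prod_pow_sub_pow hq0] at h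
    apply mul_right_cancel₀ (pow_ne_zero (n * n) hq0)
    rw [h]
    ring
  have hM' : (M : ℝ) = (1 - ((q : ℝ) ^ f)⁻¹) * ((q : ℝ) ^ r) ^ n := by
    have h := congrArg (Nat.cast : ℕ → ℝ) hM
    rw [Nat.cast_mul, Nat.cast_mul, Nat.cast_sub (Nat.one_le_pow _ _ (by omega))] at h
    push_cast at h
    field_simp
    linarith
  have hmain : (U : ℝ) * idx * dim = G * d := by
    have : U * idx * dim = G * d := by
      rw [hU, hGL, ← hD]
      calc Γ * D * idx * dim = Γ * dim * (D * idx) := by ring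
        _ = _ := by rw [hΓ]; ring
    exact_mod_cast this
  have hUM' : (U : ℝ) * ((q : ℝ) ^ l) ^ n = M * ((q : ℝ) ^ l) ^ (n * n) := by exact_mod_cast hUM
  have hd' : (d : ℝ) = (q : ℝ) ^ ((r - 2 * l') * k) := by rw [hd]; push_cast; rfl
  obtain ⟨m, hm⟩ : ∃ m, l = l' + m := ⟨l - l', by omega⟩
  have hrm : r - 2 * l' = m := by omega
  rw [hrm] at hd'
  have hfin : (dim : ℝ) * (idx * (1 - ((q : ℝ) ^ f)⁻¹)) = (q : ℝ) ^ (r * k) * E := by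
    have hz : ((q : ℝ) ^ r) ^ n * ((q : ℝ) ^ l) ^ (n * n) ≠ 0 := by positivity
    apply mul_right_cancel₀ hz
    calc _ = (M * ((q : ℝ) ^ l) ^ (n * n)) * idx * dim := by rw [hM']; ring
      _ = (U * idx * dim) * ((q : ℝ) ^ l) ^ n := by rw [← hUM']; ring
      _ = E * ((q : ℝ) ^ r) ^ (n * n) * (q : ℝ) ^ (m * k) * ((q : ℝ) ^ l) ^ n := by
        rw [hmain, hGL', hd']
      _ = _ := by
        rw [hnn, hr, hm]
        ring
  rw [div_mul_div_comm, eq_div_iff (mul_ne_zero hidx' hfne), hfin]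

end SLRep

/-! ### The dimension formula over a Henselian discrete valuation ring. -/

namespace SLRep

open IsLocalRing

theorem finrank_eq_of_traceCharSL {A S : Type*} [CommRing A] [IsDomain A]
    [IsDiscreteValuationRing A] [Finite (ResidueField A)] [HenselianRing A (maximalIdeal A)]
    [CommRing S] [Algebra A S] [IsLocalRing S] {n r l l' f : ℕ}
    (hS : Ideal.map (algebraMap A S) (maximalIdeal A) ≤ maximalIdeal S)
    (hf : Nat.card (S ⧸ maximalIdeal S) = Nat.card (ResidueField A) ^ f)
    (b : Module.Basis (Fin n) A S) {β : S} (hβ : Algebra.adjoin A {β} = ⊤)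
    {ϖ : A} (hϖ : maximalIdeal A = Ideal.span {ϖ}) (hr : r = l + l') (hl : l' ≤ l)
    (hl2 : l ≤ l' + 1) (hl' : 1 ≤ l') (h2 : IsUnit (2 : A)) (hn : IsUnit (n : A))
    {θ : AddChar (A ⧸ maximalIdeal A ^ r) ℂ} (hθ : ∀ x, (∀ y, θ (y * x) = 1) → x = 0)
    {V : Type*} [AddCommGroup V] [Module ℂ V]
    {ρ : Representation ℂ (Matrix.SpecialLinearGroup (Fin n) (A ⧸ maximalIdeal A ^ r)) V}
    (hρ : ρ.IsIrreducible)
    (hne : ∃ v : V, v ≠ 0 ∧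
      ∀ x ∈ congSubgroup n (Ideal.Quotient.mk (maximalIdeal A ^ r) ϖ ^ l'),
        ρ x v = traceCharSL θ ((Ideal.Quotient.mk (maximalIdeal A ^ r)).mapMatrix
          (Algebra.leftMulMatrix b β)) x • v) :
    FiniteDimensional ℂ V ∧ (Units.map (Algebra.norm A : S →* A)).range.FiniteIndex ∧
      (Module.finrank ℂ V : ℝ) = (Nat.card (ResidueField A) : ℝ) ^ (r * (n * (n - 1) / 2)) /
          ((Units.map (Algebra.norm A : S →* A)).range.index : ℝ) *
        ((∏ k ∈ Finset.Icc 1 n, (1 - ((Nat.card (ResidueField A) : ℝ) ^ k)⁻¹)) /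
          (1 - ((Nat.card (ResidueField A) : ℝ) ^ f)⁻¹)) := by
  have hr0 : r ≠ 0 := by omega
  have hlocal := isLocalHom_quotient_mk_pow (A := A) hr0
  have hfin := finite_quotient_maximalIdeal_pow (A := A) r
  have hnt := nontrivial_quotient_maximalIdeal_pow (A := A) hr0
  have hπ := isTruncatedDVR_mk hϖ r
  have hcard := card_quotient_maximalIdeal_pow (A := A) r
  have hN := comap_range_detUnits b hβ hϖ hr hl' hn
  have hcount := card_isUnit_sum_pow b hβ hr0 hS
  have hsurj : Function.Surjective (Ideal.Quotient.mk (maximalIdeal A ^ r)) :=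
    Ideal.Quotient.mk_surjective
  have hv : IsUnit (krylov ((Ideal.Quotient.mk (maximalIdeal A ^ r)).mapMatrix
      (Algebra.leftMulMatrix b β)) (Ideal.Quotient.mk (maximalIdeal A ^ r) ∘ b.repr 1)).det := by
    rw [krylov_map, ← RingHom.map_det]
    exact (isUnit_det_krylov b hβ).map _
  let res : A ⧸ maximalIdeal A ^ r →+* ResidueField A :=
    Ideal.Quotient.factor (Ideal.pow_le_self hr0)
  have hres : Function.Surjective res := Ideal.Quotient.factor_surjective _
  have hres' : IsLocalHom res := by
    have : IsLocalRing (A ⧸ maximalIdeal A ^ r) := .of_surjective' _ hsurj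
    exact .of_surjective _ hres
  have hGLmul := card_GL_mul (n := n) res hres
  set q := Nat.card (ResidueField A) with hq
  set φ := Ideal.Quotient.mk (maximalIdeal A ^ r)
  set B := φ.mapMatrix (Algebra.leftMulMatrix b β)
  have hq1 : 1 < q := Finite.one_lt_card
  have hn' : IsUnit (n : A ⧸ maximalIdeal A ^ r) := by simpa using hn.map φ
  have hn0 : n ≠ 0 := by
    rintro rfl
    simp at hn
  obtain ⟨c, hc⟩ : ∃ c : A ⧸ maximalIdeal A ^ r, 2 * c = 1 := by
    obtain ⟨c, hc⟩ := h2.exists_right_inv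
    exact ⟨φ c, by rw [← map_one φ, ← hc, map_mul, map_ofNat]⟩
  have hSL : Finite (Matrix.SpecialLinearGroup (Fin n) (A ⧸ maximalIdeal A ^ r)) := Subtype.finite
  have hf0 : f ≠ 0 := by
    rintro rfl
    rw [pow_zero] at hf
    have : Finite (ResidueField S) := Nat.finite_of_card_ne_zero (α := S ⧸ maximalIdeal S) (by omega)
    have h := Finite.one_lt_card (α := ResidueField S)
    exact absurd hf h.ne'
  obtain ⟨d, hd1, hd2⟩ := dimension_of_traceCharSL hπ hr hl hl2 hl' hθ hn' hc hv hρ hne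
  have hd := isotypic_dimension_eq hπ hr hl hl2 hl' hcard (by omega) hn' hc hv hd2
  -- Units lift along reduction, so the norm index can be computed in the finite group of units of
  -- the quotient; in particular it is finite.
  have hidx : (Units.map (Algebra.norm A : S →* A)).range.index =
      (detUnits (φ ϖ ^ l) B).range.index := by
    rw [← hN]
    exact Subgroup.index_comap_of_surjective _
      (IsLocalRing.surjective_units_map_of_local_ringHom φ hsurj hlocal)
  have hidx0 : (Units.map (Algebra.norm A : S →* A)).range.index ≠ 0 := by
    rw [hidx]
    exact Subgroup.index_ne_zero_of_finite
  refine ⟨finiteDimensional_of_isIrreducible hρ, ⟨hidx0⟩, ?_⟩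
  have hann := hπ.card_annihilator hr0 hcard (show l ≤ r by omega)
  have hU := card_units_commSubring hπ hr hl' hv
  rw [hann] at hU
  rw [hf, hcard] at hcount
  refine dim_eq_of_card_eq (U := Nat.card (commSubring (φ ϖ ^ l) B)ˣ)
    (D := Nat.card (detUnits (φ ϖ ^ l) B).range) hq1 hf0 hl hr hd1 hd ?_ ?_ hidx0 hU hcount
    (card_SL_mul_card_units hn0) ?_
  · rw [card_eq_card_ker_mul_card_range (detUnits (φ ϖ ^ l) B), card_ker_detUnits]
  · rw [hidx, Subgroup.card_mul_index]
  · have := Fintype.ofFinite (ResidueField A)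
    rw [hGLmul, hcard, Matrix.card_GL_field, ← Nat.card_eq_fintype_card]

end SLRep

namespace SLRep

open IsLocalRing

/-! ### Local fields: completeness and the additive character of the quotient ring. -/

section LocalField

variable {F : Type*} [Field F] [ValuativeRel F] [TopologicalSpace F] [IsNonarchimedeanLocalField F]

theorem isAdicComplete_integers : IsAdicComplete 𝓂[F] 𝒪[F] := by
  let := IsTopologicalAddGroup.rightUniformSpace F
  have := isUniformAddGroup_of_addCommGroup (G := F)
  infer_instance

theorem isUnit_natCast_of_not_dvd {m : ℕ} (hm : ¬ ringChar 𝓀[F] ∣ m) : IsUnit (m : 𝒪[F]) := by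
  by_contra h
  apply hm
  rw [← ringChar.spec, ← map_natCast (residue 𝒪[F])]
  exact (residue_eq_zero_iff _).2 h

theorem mk_pow_eq_zero_iff {ϖ : 𝒪[F]} (hϖ : 𝓂[F] = Ideal.span {ϖ}) (r : ℕ) (a : 𝒪[F]) :
    Ideal.Quotient.mk (𝓂[F] ^ r) a = 0 ↔ ϖ ^ r ∣ a := by
  rw [Ideal.Quotient.eq_zero_iff_mem, hϖ, Ideal.span_singleton_pow, Ideal.mem_span_singleton]

/-- The additive character of `O_F / 𝔭^r` induced by `x ↦ τ(ϖ^{-r} x)`. -/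
theorem exists_addChar_quotient {τ : AddChar F Circle} (hτ : HasConductorIntegers τ)
    {ϖ : 𝒪[F]} (hϖ : 𝓂[F] = Ideal.span {ϖ}) (r : ℕ) :
    ∃ θ : AddChar (𝒪[F] ⧸ 𝓂[F] ^ r) ℂ,
      (∀ a : 𝒪[F], θ (Ideal.Quotient.mk _ a) = (τ (((ϖ : F) ^ r)⁻¹ * (a : F)) : ℂ)) ∧
      ∀ x, (∀ y, θ (y * x) = 1) → x = 0 := by
  have h0 : (ϖ : F) ^ r ≠ 0 :=
    pow_ne_zero _ fun h => uniformizer_ne_zero hϖ (Subtype.ext h)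
  have hint : ∀ z : 𝒪[F], τ (z : F) = 1 := by
    intro z
    have h2 : (z : F) ∈ {x : F | x ∈ 𝒪[F]} := z.2
    rw [← hτ] at h2
    simpa using h2 1
  let f : 𝒪[F] →+ Additive Circle :=
    { toFun := fun a => Additive.ofMul (τ (((ϖ : F) ^ r)⁻¹ * (a : F)))
      map_zero' := by simp
      map_add' := fun a b => by
        rw [← ofMul_mul, ← AddChar.map_add_eq_mul]
        congr 2
        push_cast
        ring }
  have hf : ∀ a ∈ (𝓂[F] ^ r).toAddSubgroup, f a = 0 := by
    intro a ha
    have ha' : Ideal.Quotient.mk (𝓂[F] ^ r) a = 0 := Ideal.Quotient.eq_zero_iff_mem.2 ha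
    obtain ⟨z, rfl⟩ := (mk_pow_eq_zero_iff hϖ r a).1 ha'
    change Additive.ofMul (τ (((ϖ : F) ^ r)⁻¹ * ((ϖ ^ r * z : 𝒪[F]) : F))) = 0
    rw [ofMul_eq_zero]
    convert hint z using 2
    push_cast
    rw [← mul_assoc, inv_mul_cancel₀ h0, one_mul]
  let g : 𝒪[F] ⧸ 𝓂[F] ^ r →+ Additive Circle := QuotientAddGroup.lift _ f hf
  let θ : AddChar (𝒪[F] ⧸ 𝓂[F] ^ r) ℂ :=
    { toFun := fun x => ((Additive.toMul (g x) : Circle) : ℂ)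
      map_zero_eq_one' := by simp
      map_add_eq_mul' := fun x y => by simp }
  refine ⟨θ, fun a => rfl, fun x hx => ?_⟩
  obtain ⟨a, rfl⟩ := Ideal.Quotient.mk_surjective x
  -- Nondegeneracy of `θ` is the conductor condition: triviality on all multiples of `a` makes
  -- `ϖ^(-r) a` integral.
  have hmem : ((ϖ : F) ^ r)⁻¹ * (a : F) ∈ {x : F | ∀ y : 𝒪[F], τ (x * (y : F)) = 1} := by
    intro y
    have h1 : θ (Ideal.Quotient.mk _ (y * a)) = 1 := by
      rw [map_mul]
      exact hx _
    have h2 : (τ (((ϖ : F) ^ r)⁻¹ * ((y * a : 𝒪[F]) : F)) : ℂ) = 1 := h1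
    rw [Circle.coe_eq_one] at h2
    rw [← h2]
    congr 1
    push_cast
    ring
  rw [hτ] at hmem
  rw [mk_pow_eq_zero_iff hϖ]
  refine ⟨⟨_, hmem⟩, Subtype.ext ?_⟩
  push_cast
  rw [← mul_assoc, mul_inv_cancel₀ h0, one_mul]

theorem mem_congruenceKernel_of_mem_congSubgroup {ϖ : 𝒪[F]} (hϖ : 𝓂[F] = Ideal.span {ϖ})
    {n l l' r : ℕ} (hr : r = l + l') {g : SLQuot F n r}
    (hg : g ∈ congSubgroup n (Ideal.Quotient.mk (𝓂[F] ^ r) ϖ ^ l')) :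
    g ∈ congruenceKernel F n (show l ≤ r by omega) := by
  rw [congruenceKernel, MonoidHom.mem_ker]
  ext i j
  rw [Matrix.SpecialLinearGroup.map_apply_coe, RingHom.mapMatrix_apply, Matrix.map_apply]
  have h1 : Ideal.Quotient.mk (𝓂[F] ^ r) ϖ ^ l' *
      (g.val i j - (1 : Matrix (Fin n) (Fin n) (𝒪[F] ⧸ 𝓂[F] ^ r)) i j) = 0 :=
    congrFun (congrFun hg i) j
  obtain ⟨z, hz⟩ := (isTruncatedDVR_mk hϖ r).dvd_of_mul_eq_zero l l' hr.symm _ h1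
  rw [sub_eq_iff_eq_add.1 hz, map_add, map_mul, map_pow, Ideal.Quotient.factor_mk, ← map_pow,
    (mk_pow_eq_zero_iff hϖ l _).2 dvd_rfl, zero_mul, zero_add, Matrix.SpecialLinearGroup.coe_one,
    Matrix.one_apply, Matrix.one_apply]
  split_ifs <;> simp

/-- Both sides see `τ` at the same point, since `ϖ^(-r) ϖ^l = ϖ^(-l')`. -/
theorem psi_eq_traceCharSL {τ : AddChar F Circle} (hτ : HasConductorIntegers τ)
    {ϖ : 𝒪[F]} (hϖ : 𝓂[F] = Ideal.span {ϖ}) {n l l' r : ℕ} (hl : l' ≤ l) (hr : r = l + l')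
    {θ : AddChar (𝒪[F] ⧸ 𝓂[F] ^ r) ℂ}
    (hθ : ∀ a : 𝒪[F], θ (Ideal.Quotient.mk _ a) = (τ (((ϖ : F) ^ r)⁻¹ * (a : F)) : ℂ))
    (B : Matrix (Fin n) (Fin n) 𝒪[F]) (h : congruenceKernel F n (show l ≤ r by omega)) :
    (psi hl hr hτ hϖ B h : ℂ) = traceCharSL θ (redMat n r B) (h : SLQuot F n r) := by
  have h0 : (ϖ : F) ≠ 0 := fun h => uniformizer_ne_zero hϖ (Subtype.ext h)
  obtain ⟨X, hX⟩ := exists_rep (by omega) hϖ h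
  have hXB : (redMat n r (1 + ϖ ^ l • X) - 1) * redMat n r B = redMat n r (ϖ ^ l • X * B) := by
    simp only [redMat, map_add, map_one, add_sub_cancel_left, map_mul]
  rw [psi_apply hl hr hτ hϖ B h X hX, traceCharSL, hX, hXB]
  have htr : (redMat n r (ϖ ^ l • X * B)).trace =
      Ideal.Quotient.mk (𝓂[F] ^ r) (ϖ ^ l * (X * B).trace) := by
    rw [← smul_eq_mul (ϖ ^ l), ← Matrix.trace_smul, Matrix.smul_mul]
    exact (AddMonoidHom.map_trace (Ideal.Quotient.mk (𝓂[F] ^ r)) _).symm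
  rw [htr, hθ]
  congr 2
  push_cast
  rw [hr, pow_add, mul_inv_rev, mul_assoc, inv_mul_cancel_left₀ (pow_ne_zero l h0)]

end LocalField

/-! ### Comparison of the field norm with the norm of integers. -/

section Norm

variable {F K : Type*} [Field F] [ValuativeRel F] [Field K] [Algebra F K]

theorem algebraMap_norm_ringOfIntegers [FiniteDimensional F K] {n : ℕ}
    (b : Module.Basis (Fin n) 𝒪[F] (ringOfIntegers F K)) (x : ringOfIntegers F K) :
    Algebra.norm F (x : K) = (Algebra.norm 𝒪[F] x : F) := by
  have := Module.Free.of_basis b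
  have := Module.Finite.of_basis b
  have : IsLocalization (Algebra.algebraMapSubmonoid (ringOfIntegers F K)
      (nonZeroDivisors 𝒪[F])) K := IsIntegralClosure.isLocalization 𝒪[F] F K (ringOfIntegers F K)
  exact Algebra.norm_localization 𝒪[F] (nonZeroDivisors 𝒪[F]) x

theorem normUnits_eq_range [FiniteDimensional F K] {n : ℕ}
    (b : Module.Basis (Fin n) 𝒪[F] (ringOfIntegers F K)) :
    normUnits F K = (Units.map (Algebra.norm 𝒪[F] : ringOfIntegers F K →* 𝒪[F])).range := by
  ext u
  rw [normUnits, Subgroup.mem_comap, Subgroup.mem_map]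
  constructor
  · rintro ⟨_, ⟨x, rfl⟩, hx⟩
    refine ⟨x, Units.ext (Subtype.ext ?_)⟩
    have h1 : Algebra.norm F ((x : ringOfIntegers F K) : K) = ((u : 𝒪[F]) : F) :=
      congrArg Units.val hx
    rw [algebraMap_norm_ringOfIntegers b] at h1
    exact h1
  · rintro ⟨x, rfl⟩
    exact ⟨_, ⟨x, rfl⟩, Units.ext (algebraMap_norm_ringOfIntegers b x)⟩

end Norm

end SLRep

theorem mainTheorem2
    {F : Type*} [Field F] [ValuativeRel F] [TopologicalSpace F] [IsNonarchimedeanLocalField F]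
    (hdyadic : ringChar 𝓀[F] ≠ 2)
    {K : Type*} [Field K] [Algebra F K]
    (n : ℕ) (hn : ¬ ringChar 𝓀[F] ∣ n) (hK : Module.finrank F K = n)
    (P : Ideal (SLRep.ringOfIntegers F K)) (hP : P.IsMaximal)
    (ϖ : 𝒪[F]) (hϖ : 𝓂[F] = Ideal.span {ϖ})
    (τ : AddChar F Circle) (hτcont : Continuous τ) (hτ : SLRep.HasConductorIntegers τ)
    (b : Module.Basis (Fin n) 𝒪[F] (SLRep.ringOfIntegers F K))
    (β : SLRep.ringOfIntegers F K) (hβ : Algebra.adjoin 𝒪[F] {β} = ⊤)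
    (hβtr : Algebra.trace F K (β : K) = 0)
    (r l l' : ℕ) (hr2 : 2 ≤ r) (hl' : l' = r / 2) (hl : l' ≤ l) (hr : r = l + l')
    {V : Type*} [AddCommGroup V] [Module ℂ V]
    (δ : Representation ℂ (SLRep.SLQuot F n r) V) (hδ : δ.IsIrreducible)
    (hδψ : SLRep.ContainsCharacter δ
      (SLRep.psi hl hr hτ hϖ (Algebra.leftMulMatrix b β))) :
    FiniteDimensional ℂ V ∧ (SLRep.normUnits F K).FiniteIndex ∧
      (Module.finrank ℂ V : ℝ) =
        (Nat.card 𝓀[F] : ℝ) ^ (r * (n * (n - 1) / 2)) / ((SLRep.normUnits F K).index : ℝ) *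
          ((∏ k ∈ Finset.Icc 1 n, (1 - ((Nat.card 𝓀[F] : ℝ) ^ k)⁻¹)) /
            (1 - ((Nat.card 𝓀[F] : ℝ) ^ (P.inertiaDeg 𝒪[F]))⁻¹)) := by
  have hn0 : n ≠ 0 := by
    rintro rfl
    exact hn (dvd_zero _)
  have : FiniteDimensional F K := Module.finite_of_finrank_pos (by omega)
  have := SLRep.isAdicComplete_integers (F := F)
  have : Finite (𝒪[F] ⧸ 𝓂[F]) := inferInstanceAs (Finite 𝓀[F])
  -- Locality forces `P` to be the only maximal ideal, so its inertia degree is that of `K / F`.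
  have := SLRep.isLocalRing_of_basis b 𝓂[F]
  have hPm : P = IsLocalRing.maximalIdeal _ := IsLocalRing.eq_maximalIdeal hP
  have hPc : P.comap (algebraMap 𝒪[F] (SLRep.ringOfIntegers F K)) = 𝓂[F] :=
    IsLocalRing.eq_maximalIdeal (Ideal.isMaximal_comap_of_isIntegral_of_isMaximal P)
  have hS := Ideal.map_le_iff_le_comap.2 hPc.ge
  have : P.LiesOver 𝓂[F] := ⟨hPc.symm⟩
  have : Module.Finite 𝒪[F] (SLRep.ringOfIntegers F K) := .of_basis b
  have hcard := (Ideal.cardQuot_pow_inertiaDeg 𝓂[F] P).symm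
  rw [Submodule.cardQuot_apply, Submodule.cardQuot_apply] at hcard
  have h2 : IsUnit ((2 : ℕ) : 𝒪[F]) := by
    refine SLRep.isUnit_natCast_of_not_dvd fun h => hdyadic ?_
    refine ((Nat.dvd_prime Nat.prime_two).1 h).resolve_left fun h1 => ?_
    exact CharP.ringChar_ne_one h1
  obtain ⟨θ, hθ, hθp⟩ := SLRep.exists_addChar_quotient hτ hϖ r
  obtain ⟨v, hv0, hv⟩ := hδψ
  rw [SLRep.normUnits_eq_range b]
  rw [hPm] at hS hcard
  refine SLRep.finrank_eq_of_traceCharSL hS (f := P.inertiaDeg 𝒪[F]) (hPm ▸ hcard) b hβ hϖ hr hl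
    (by omega) (by omega) (by exact_mod_cast h2) (SLRep.isUnit_natCast_of_not_dvd hn) hθp hδ
    ⟨v, hv0, fun x hx => ?_⟩
  rw [← SLRep.psi_eq_traceCharSL hτ hϖ hl hr hθ _
    ⟨x, SLRep.mem_congruenceKernel_of_mem_congSubgroup hϖ hr hx⟩]
  exact hv ⟨x, _⟩
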